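/- Let $n\ge 2$, let $\mathbb B^n\subset\mathbb C^n$ be the open unit ball with coordinates $z_j=x_j+iy_j$, and let $\alpha\in(0,1)$. Put $$X=\{z\in\mathbb B^n : x_1^2+y_1^2+x_2^2<\alpha^2,\ x_2>0,\ y_2=0,\ x_j=y_j=0 \text{ for } j>2\},\qquad \nu_X=dx_1\wedge dy_1\wedge dx_2 .$$ Notation. Let $\langle z,w\rangle=\sum_j z_j\bar w_j-1$; let $\mathcal K(z,w)=\frac{n!}{\pi^n}(-\langle z,w\rangle)^{-(n+1)}$ be the Bergman kernel of $\mathbb B^n$, $dV=\mathcal K(z,z)\,dV_e$ the invariant volume ($dV_e$ is the Euclidean volume), and $c(\mathbb B^n,k)$ the constant with $c(\mathbb B^n,k)\int_{\mathbb B^n}\mathcal K(z,w)^k\mathcal K(w,z)^k\mathcal K(w,w)^{-k}\,dV(w)=\mathcal K(z,z)^k$. Let $\tau$ be the complex hyperbolic distance, $\cosh^2\frac{\tau(z,w)}2=\frac{\langle z,w\rangle\langle w,z\rangle}{\langle z,z\rangle\langle w,w\rangle}$, and $\mathrm{dist}(A,B)=\inf\{\tau(z,w): z\in A, w\in B\}$.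 The group $SU(n,1)$ acts on $\mathbb B^n$ by fractional-linear transformations; $J(\gamma,z)$ denotes the complex Jacobian of $\gamma$ at $z$. For a discrete subgroup $\Gamma\subset SU(n,1)$ acting freely on $\mathbb B^n$ with $\Gamma\backslash\mathbb B^n$ compact, a unitary representation $\rho:\Gamma\to U(m)$, $j\in\{1,\dots,m\}$ and a positive integer $k$, let $$\Theta_p^{(j;k)}(z)=c(\mathbb B^n,k)\sum_{\gamma\in\Gamma}\rho(\gamma^{-1})\,\mathcal K(\gamma z,p)^k e_j\,J(\gamma,z)^k,\qquad \Theta_X^{(j;k)}(z)=\int_X\Theta_p^{(j;k)}(z)\,\mathcal K(p,p)^{-k/2}\,\nu_X(p),$$ where $e_j$ is the $j$-th standard basis vector of $\mathbb C^m$, and let $(F,G)=\int_{\Gamma\backslash\mathbb B^n}F(z)^T\overline{G(z)}\,\mathcal K(z,z)^{-k}\,dV(z)$. Then: (a) $X$ is a $3$-dimensional CR submanifold of $\mathbb B^n$ (with the complex hyperbolic metric), i.e. $TX$ contains a smooth distribution invariant under the complex structure whose orthogonal complement in $TX$ is mapped by the complex structure into the normal bundle; $X$ is neither totally real nor complex.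 (b) There is a constant $C>0$, depending only on $n$ and $\alpha$, such that for all $\Gamma$, $m$, $\rho$, $j$ as above for which $X$ is contained in a Dirichlet fundamental domain $\mathcal F$ of $\Gamma$ with $\mathrm{dist}(X,\partial\mathcal F)>0$, the following holds for all sufficiently large $k$: the series and the integrals above converge absolutely; $\Theta_X^{(j;k)}$ is holomorphic on $\mathbb B^n$ and satisfies $J(\gamma,z)^k\,\Theta_X^{(j;k)}(\gamma z)=\rho(\gamma)\,\Theta_X^{(j;k)}(z)$ for $\gamma\in\Gamma$, $z\in\mathbb B^n$; and $$(\Theta_X^{(j;k)},\Theta_X^{(j;k)})\le C\,k^{n-2}.$$ In particular $(\Theta_X^{(j;k)},\Theta_X^{(j;k)})$ is not asymptotic, as $k\to\infty$, to $c\,k^{n-\frac32}$ for any constant $c\ne0$. -/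

import Mathlib

noncomputable section

namespace BallForms

open Matrix
open scoped ContDiff ComplexConjugate

/-- The space `ℂⁿ`; its `volume` is the Euclidean (Lebesgue) measure `dx₁ dy₁ ⋯ dxₙ dyₙ`. -/
abbrev Cn (n : ℕ) : Type := Fin n → ℂ

/-- The open unit ball `𝔹ⁿ` of `ℂⁿ` for the Euclidean norm. -/
def ball (n : ℕ) : Set (Cn n) := {z | ∑ i, ‖z i‖ ^ 2 < 1}

/-- `⟨z, w⟩ = z₁ w̄₁ + ⋯ + zₙ w̄ₙ - 1`. -/
def herm {n : ℕ} (z w : Cn n) : ℂ := ∑ i, z i * conj (w i) - 1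

/-- The Bergman kernel of `𝔹ⁿ`: `(n! / πⁿ) (-⟨z, w⟩)^{-(n+1)}`. -/
def kernel {n : ℕ} (z w : Cn n) : ℂ :=
  ((n.factorial : ℂ) / (Real.pi : ℂ) ^ n) * ((-herm z w) ^ (n + 1))⁻¹

/-- The constant `c(𝔹ⁿ, k)`, determined by
`c ∫_𝔹 K(z,w)ᵏ K(w,z)ᵏ K(w,w)⁻ᵏ dV(w) = K(z,z)ᵏ` at `z = 0`, where `dV(w) = K(w,w) dV_e(w)`. -/
def kernelConst (n k : ℕ) : ℂ :=
  kernel (0 : Cn n) 0 ^ k /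
    ∫ w in ball n, kernel 0 w ^ k * kernel w 0 ^ k * (kernel w w ^ k)⁻¹ * kernel w w

/-- The diagonal matrix `σ = diag(1, …, 1, -1)` of size `n + 1`. -/
def sigma (n : ℕ) : Matrix (Fin (n + 1)) (Fin (n + 1)) ℂ :=
  Matrix.diagonal fun i => if i = Fin.last n then -1 else 1

/-- `SU(n,1) = {A ∈ SL(n+1, ℂ) | Aᵀ σ Ā = σ}`. -/
def SU (n : ℕ) : Subgroup (SpecialLinearGroup (Fin (n + 1)) ℂ) where
  carrier := {A | (A : Matrix (Fin (n + 1)) (Fin (n + 1)) ℂ)ᵀ * sigma n *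
    (A : Matrix (Fin (n + 1)) (Fin (n + 1)) ℂ).map (starRingEnd ℂ) = sigma n}
  one_mem' := by simp
  mul_mem' := by
    intro A B hA hB
    obtain ⟨M, hM⟩ := A
    obtain ⟨N, hN⟩ := B
    change Mᵀ * sigma n * M.map (starRingEnd ℂ) = sigma n at hA
    change Nᵀ * sigma n * N.map (starRingEnd ℂ) = sigma n at hB
    change (M * N)ᵀ * sigma n * (M * N).map (starRingEnd ℂ) = sigma n
    rw [Matrix.transpose_mul, Matrix.map_mul]
    calc Nᵀ * Mᵀ * sigma n * (M.map (starRingEnd ℂ) * N.map (starRingEnd ℂ))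
        = Nᵀ * (Mᵀ * sigma n * M.map (starRingEnd ℂ)) * N.map (starRingEnd ℂ) := by
          simp only [Matrix.mul_assoc]
      _ = sigma n := by rw [hA, hB]
  inv_mem' := by
    intro A hA
    obtain ⟨M, hM⟩ := A
    change Mᵀ * sigma n * M.map (starRingEnd ℂ) = sigma n at hA
    change M.adjugateᵀ * sigma n * M.adjugate.map (starRingEnd ℂ) = sigma n
    have h : M * M.adjugate = 1 := by rw [Matrix.mul_adjugate, hM, one_smul]
    generalize M.adjugate = N at *
    have h1 : Nᵀ * Mᵀ = 1 := by rw [← Matrix.transpose_mul, h, Matrix.transpose_one]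
    have h2 : M.map (starRingEnd ℂ) * N.map (starRingEnd ℂ) = 1 := by
      rw [← Matrix.map_mul, h]; simp
    calc Nᵀ * sigma n * N.map (starRingEnd ℂ)
        = Nᵀ * (Mᵀ * sigma n * M.map (starRingEnd ℂ)) * N.map (starRingEnd ℂ) := by rw [hA]
      _ = (Nᵀ * Mᵀ) * sigma n * (M.map (starRingEnd ℂ) * N.map (starRingEnd ℂ)) := by
          simp only [Matrix.mul_assoc]
      _ = sigma n := by rw [h1, h2]; simp

/-- The underlying matrix of an element of `SU(n,1)`. -/
def mat {n : ℕ} (g : SU n) : Matrix (Fin (n + 1)) (Fin (n + 1)) ℂ :=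
  (g : SpecialLinearGroup (Fin (n + 1)) ℂ)

/-- The fractional-linear action of `SU(n,1)` on the ball. -/
def act {n : ℕ} (g : SU n) (z : Cn n) : Cn n := fun i =>
  (∑ j, mat g i.castSucc (Fin.castSucc j) * z j + mat g i.castSucc (Fin.last n)) /
    (∑ j, mat g (Fin.last n) (Fin.castSucc j) * z j + mat g (Fin.last n) (Fin.last n))

/-- The complex Jacobian `J(γ, z)`: the determinant of the complex derivative of `γ` at `z`. -/
def jac {n : ℕ} (g : SU n) (z : Cn n) : ℂ := (fderiv ℂ (act g) z).det

/-- The quotient `Γ \ 𝔹ⁿ` with the quotient topology. -/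
abbrev BallQuotient {n : ℕ} (Γ : Subgroup (SU n)) : Type :=
  Quot fun z w : ball n => ∃ g ∈ Γ, act g z.1 = w.1

/-- `Γ` acts freely on the ball (with `Γ` discrete: the quotient is smooth and the projection
is a covering map). -/
def ActsFreely {n : ℕ} (Γ : Subgroup (SU n)) : Prop :=
  ∀ g ∈ Γ, g ≠ 1 → ∀ z ∈ ball n, act g z ≠ z

/-- The complex hyperbolic distance on the ball:
`cosh² (τ(z,w)/2) = ⟨z,w⟩⟨w,z⟩ / (⟨z,z⟩⟨w,w⟩)`. -/
def hypDist {n : ℕ} (z w : Cn n) : ℝ :=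
  2 * Real.arcosh (Real.sqrt (‖herm z w‖ ^ 2 / (‖herm z z‖ * ‖herm w w‖)))

/-- `dist(A, B) = inf {τ(z,w) | z ∈ A, w ∈ B}` (`∞` if one of the sets is empty). -/
def setDist {n : ℕ} (A B : Set (Cn n)) : ENNReal :=
  ⨅ z ∈ A, ⨅ w ∈ B, ENNReal.ofReal (hypDist z w)

/-- The Dirichlet fundamental domain of `Γ` centred at `p₀`. -/
def dirichlet {n : ℕ} (Γ : Subgroup (SU n)) (p₀ : Cn n) : Set (Cn n) :=
  {z | z ∈ ball n ∧ ∀ g ∈ Γ, g ≠ 1 → hypDist z p₀ < hypDist z (act g p₀)}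

/-- Vector-valued holomorphic automorphic forms of weight `k` for `(ρ, Γ)`:
`J(γ,z)ᵏ F(γ z) = ρ(γ) F(z)`. -/
def IsAutomorphicForm {n m : ℕ} (Γ : Subgroup (SU n)) (ρ : Γ →* unitaryGroup (Fin m) ℂ)
    (k : ℕ) (F : Cn n → Fin m → ℂ) : Prop :=
  DifferentiableOn ℂ F (ball n) ∧
    ∀ g : Γ, ∀ z ∈ ball n, jac g.1 z ^ k • F (act g.1 z) = (ρ g).1 *ᵥ F z

/-- The function `F(z)ᵀ conj(G(z)) K(z,z)⁻ᵏ` times the density `K(z,z)` of the invariant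
volume `dV` with respect to the Euclidean volume. -/
def innerDensity {n m : ℕ} (k : ℕ) (F G : Cn n → Fin m → ℂ) (z : Cn n) : ℂ :=
  (∑ i, F z i * conj (G z i)) * (kernel z z ^ k)⁻¹ * kernel z z

/-- The inner product `(F, G) = ∫_{Γ\𝔹} F(z)ᵀ conj(G(z)) K(z,z)⁻ᵏ dV(z)`, the integral over the
quotient being taken over the Dirichlet fundamental domain centred at `p₀`. -/
def innerProd {n m : ℕ} (Γ : Subgroup (SU n)) (p₀ : Cn n) (k : ℕ)
    (F G : Cn n → Fin m → ℂ) : ℂ :=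
  ∫ z in dirichlet Γ p₀, innerDensity k F G z

/-- The term `ρ(γ⁻¹) T_p(γ z) J(γ,z)ᵏ` of the Poincaré series, where `T_p` has `j`-th component
`K(·,p)ᵏ` and all other components zero. -/
def thetaTerm {n m : ℕ} (Γ : Subgroup (SU n)) (ρ : Γ →* unitaryGroup (Fin m) ℂ)
    (j : Fin m) (k : ℕ) (z p : Cn n) (g : Γ) : Fin m → ℂ :=
  jac g.1 z ^ k • ((ρ g⁻¹).1 *ᵥ Pi.single j (kernel (act g.1 z) p ^ k))

/-- The Poincaré series `Θ_p^{(j;k)}(z) = c(𝔹ⁿ,k) ∑_γ ρ(γ⁻¹) T_p(γ z) J(γ,z)ᵏ`. -/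
def thetaPoint {n m : ℕ} (Γ : Subgroup (SU n)) (ρ : Γ →* unitaryGroup (Fin m) ℂ)
    (j : Fin m) (k : ℕ) (z p : Cn n) : Fin m → ℂ :=
  kernelConst n k • ∑' g : Γ, thetaTerm Γ ρ j k z p g

/-- The integrand `Θ_p^{(j;k)}(z) K(p,p)^{-k/2}`, as a function of `p`. -/
def thetaIntegrand {n m : ℕ} (Γ : Subgroup (SU n)) (ρ : Γ →* unitaryGroup (Fin m) ℂ)
    (j : Fin m) (k : ℕ) (z p : Cn n) : Fin m → ℂ :=
  ((kernel p p).re ^ (-(k : ℝ) / 2)) • thetaPoint Γ ρ j k z p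

/-- `Θ_Λ^{(j;k)}(z) = ∫_Λ Θ_p^{(j;k)}(z) K(p,p)^{-k/2} ν(p)`; the positive volume form `ν` on
the submanifold `Λ` enters as the measure on `ℂⁿ`, concentrated on `Λ`, that it defines. -/
def thetaSub {n m : ℕ} (Γ : Subgroup (SU n)) (ρ : Γ →* unitaryGroup (Fin m) ℂ)
    (j : Fin m) (k : ℕ) (ν : MeasureTheory.Measure (Cn n)) (z : Cn n) : Fin m → ℂ :=
  ∫ p, thetaIntegrand Γ ρ j k z p ∂ν

/-- `X = {x₁² + y₁² + x₂² < α², x₂ > 0, y₂ = 0, x_j = y_j = 0 for j > 2}` in `𝔹ⁿ`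
(the coordinates `z₁, z₂` of the text are those with index `0, 1` in `Fin n`). -/
def halfBall (n : ℕ) (hn : 2 ≤ n) (α : ℝ) : Set (Cn n) :=
  {z | z ∈ ball n ∧
    (z ⟨0, by omega⟩).re ^ 2 + (z ⟨0, by omega⟩).im ^ 2 + (z ⟨1, by omega⟩).re ^ 2 < α ^ 2 ∧
    0 < (z ⟨1, by omega⟩).re ∧ (z ⟨1, by omega⟩).im = 0 ∧ ∀ i : Fin n, 2 ≤ i.1 → z i = 0}

/-- The linear map `(z₁, x₂) ↦ (z₁, x₂, 0, …, 0)`, whose restriction is a global chart of `X`. -/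
def embed (n : ℕ) (w : ℂ × ℝ) : Cn n := fun i =>
  if i.1 = 0 then w.1 else if i.1 = 1 then (w.2 : ℂ) else 0

/-- The measure on `X` defined by `ν_X = dx₁ ∧ dy₁ ∧ dx₂`. -/
def halfBallMeasure (n : ℕ) (α : ℝ) : MeasureTheory.Measure (Cn n) :=
  (MeasureTheory.volume.restrict
    {w : ℂ × ℝ | w.1.re ^ 2 + w.1.im ^ 2 + w.2 ^ 2 < α ^ 2 ∧ 0 < w.2}).map (embed n)

/-- `X` is a smooth embedded submanifold of real dimension `q`. -/
def IsSubmanifold {n : ℕ} (q : ℕ) (X : Set (Cn n)) : Prop :=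
  ∀ p ∈ X, ∃ Φ : OpenPartialHomeomorph (Cn n) (Cn n), p ∈ Φ.source ∧
    ContDiffOn ℝ ∞ Φ Φ.source ∧ ContDiffOn ℝ ∞ Φ.symm Φ.target ∧
    ∃ W : Submodule ℝ (Cn n), Module.finrank ℝ W = q ∧
      Φ '' (Φ.source ∩ X) = Φ.target ∩ (W : Set (Cn n))

/-- The tangent space of a submanifold `X` at `p`, as a real subspace of `ℂⁿ`. -/
def tangentSp {n : ℕ} (X : Set (Cn n)) (p : Cn n) : Submodule ℝ (Cn n) :=
  Submodule.span ℝ (tangentConeAt ℝ X p)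

/-- The complex hyperbolic Riemannian metric on `𝔹ⁿ`, up to a positive constant factor. -/
def hypMetric {n : ℕ} (p v w : Cn n) : ℝ :=
  (((1 - ∑ i, p i * conj (p i)) * (∑ i, v i * conj (w i)) +
    (∑ i, v i * conj (p i)) * (∑ i, p i * conj (w i))) /
      (1 - ∑ i, p i * conj (p i)) ^ 2).re

/-- `D` is a smooth distribution on `X`: a subspace of the tangent space at every point, locally
spanned by a smooth frame. -/
def IsSmoothDistribution {n : ℕ} (X : Set (Cn n)) (D : Cn n → Submodule ℝ (Cn n)) : Prop :=
  (∀ p ∈ X, D p ≤ tangentSp X p) ∧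
    ∃ r : ℕ, ∀ p ∈ X, ∃ U : Set (Cn n), IsOpen U ∧ p ∈ U ∧ ∃ ξ : Fin r → Cn n → Cn n,
      (∀ i, ContDiffOn ℝ ∞ (ξ i) U) ∧ ∀ x ∈ U ∩ X,
        LinearIndependent ℝ (fun i => ξ i x) ∧ D x = Submodule.span ℝ (Set.range fun i => ξ i x)

/-- `X ⊆ 𝔹ⁿ` is a CR submanifold of real dimension `q`: there is a smooth distribution `D` on `X`
that is holomorphic (invariant under the complex structure) and whose orthogonal complement in
`TX` is totally real (mapped by the complex structure into the normal bundle of `X`). -/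
def IsCRSubmanifold {n : ℕ} (q : ℕ) (X : Set (Cn n)) : Prop :=
  X ⊆ ball n ∧ IsSubmanifold q X ∧ ∃ D : Cn n → Submodule ℝ (Cn n), IsSmoothDistribution X D ∧
    ∀ p ∈ X, (∀ v ∈ D p, Complex.I • v ∈ D p) ∧
      ∀ v ∈ tangentSp X p, (∀ u ∈ D p, hypMetric p v u = 0) →
        ∀ u ∈ tangentSp X p, hypMetric p (Complex.I • v) u = 0

/-- `X` is totally real: no tangent space contains a complex line. -/
def IsTotallyReal {n : ℕ} (X : Set (Cn n)) : Prop :=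
  ∀ p ∈ X, ∀ v ∈ tangentSp X p, Complex.I • v ∈ tangentSp X p → v = 0

/-- All tangent spaces of `X` are complex subspaces. -/
def IsComplexSub {n : ℕ} (X : Set (Cn n)) : Prop :=
  ∀ p ∈ X, ∀ v ∈ tangentSp X p, Complex.I • v ∈ tangentSp X p

end BallForms

end

/-!
Up to normalisation, the term of `Θ_X` belonging to `γ` is
`ρ(γ⁻¹) e_j J(γ, z)ᵏ ∫_X (-⟨γ z, p⟩)⁻ᴺ (1 - |p|²)^{N/2} dp` with `N = (n + 1) k`, and relative
to the weight of the inner product the integrand has modulus `sech(τ(γ z, p) / 2) ^ N`.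
Since `X` has positive distance from the boundary of the fundamental domain `𝓕`, this `sech` is
at most some `q < 1` when `z ∈ 𝓕` and `γ ≠ 1`, so those terms together are exponentially
small in `k`; a packing argument bounds the sum over `γ`.

Estimating the term `γ = 1` by absolute values would only give `k ^ (n - 3/2)`. But `X` is a
union of discs on which `x₂` is fixed, and there the integrand is antiholomorphic in `z₁` up to a
radial weight. By the mean value property its average over the circle `|z₁| = r` is the value at
the centre `(0, x₂)` times `((1 - r² - x₂²) / (1 - x₂²)) ^ (N/2) ≤ exp (-N r² / 2)`. Hence each
disc contributes at most `2π / N` times its central value, and Cauchy–Schwarz along the segment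
of centres leaves a factor `k⁻²` against the growth `kⁿ` of the normalisation.
-/

noncomputable section

namespace BallForms

open Matrix MeasureTheory Filter
open scoped ContDiff ComplexConjugate Topology ENNReal

variable {n : ℕ}

/-! ### Euclidean geometry of the ball -/

/-- The squared Euclidean norm on `ℂⁿ`, whose own norm is the sup norm. -/
def nsq (z : Cn n) : ℝ := ∑ i, ‖z i‖ ^ 2

/-- The Euclidean norm on `ℂⁿ`. -/
def nrm (z : Cn n) : ℝ := Real.sqrt (nsq z)

/-- The height `√(1 - |z|²)` of a point of the ball. -/
def defect (z : Cn n) : ℝ := Real.sqrt (1 - nsq z)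

theorem nsq_nonneg (z : Cn n) : 0 ≤ nsq z := Finset.sum_nonneg fun _ _ => by positivity

theorem nrm_nonneg (z : Cn n) : 0 ≤ nrm z := Real.sqrt_nonneg _

theorem nrm_sq (z : Cn n) : nrm z ^ 2 = nsq z := Real.sq_sqrt (nsq_nonneg z)

theorem nsq_zero : nsq (0 : Cn n) = 0 := by simp [nsq]

theorem nsq_smul (c : ℂ) (z : Cn n) : nsq (c • z) = ‖c‖ ^ 2 * nsq z := by
  simp [nsq, mul_pow, Finset.mul_sum]

theorem mem_ball_iff {z : Cn n} : z ∈ ball n ↔ nsq z < 1 := Iff.rfl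

theorem mem_ball_iff_nrm {z : Cn n} : z ∈ ball n ↔ nrm z < 1 := by
  rw [mem_ball_iff, ← nrm_sq, sq_lt_one_iff₀ (nrm_nonneg z)]

theorem zero_mem_ball : (0 : Cn n) ∈ ball n := by simp [mem_ball_iff, nsq_zero]

theorem continuous_nsq : Continuous (nsq : Cn n → ℝ) := by unfold nsq; fun_prop

theorem continuous_nrm : Continuous (nrm : Cn n → ℝ) := continuous_nsq.sqrt

theorem continuous_defect : Continuous (defect : Cn n → ℝ) :=
  (continuous_const.sub continuous_nsq).sqrt

theorem isOpen_ball : IsOpen (ball n) := isOpen_lt continuous_nsq continuous_const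

theorem measurableSet_ball : MeasurableSet (ball n) := isOpen_ball.measurableSet

theorem norm_le_nrm (z : Cn n) : ‖z‖ ≤ nrm z :=
  (pi_norm_le_iff_of_nonneg (nrm_nonneg z)).2 fun i => Real.le_sqrt_of_sq_le <|
    Finset.single_le_sum (f := fun i => ‖z i‖ ^ 2) (fun _ _ => by positivity) (Finset.mem_univ i)

theorem isCompact_nrm_le (r : ℝ) : IsCompact {z : Cn n | nrm z ≤ r} :=
  (isCompact_closedBall (0 : Cn n) r).of_isClosed_subset
    (isClosed_le continuous_nrm continuous_const)
    fun z hz => mem_closedBall_zero_iff.2 ((norm_le_nrm z).trans hz)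

theorem volume_ball_lt_top : volume (ball n) < ⊤ :=
  (measure_mono fun _ hz => show nrm _ ≤ 1 from (mem_ball_iff_nrm.1 hz).le).trans_lt
    (isCompact_nrm_le 1).measure_lt_top

theorem defect_nonneg (z : Cn n) : 0 ≤ defect z := Real.sqrt_nonneg _

theorem defect_sq {z : Cn n} (hz : z ∈ ball n) : defect z ^ 2 = 1 - nsq z :=
  Real.sq_sqrt (by linarith [mem_ball_iff.1 hz])

theorem defect_pos {z : Cn n} (hz : z ∈ ball n) : 0 < defect z :=
  Real.sqrt_pos.2 (by linarith [mem_ball_iff.1 hz])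

theorem defect_le_one (z : Cn n) : defect z ≤ 1 :=
  Real.sqrt_le_one.2 (by linarith [nsq_nonneg z])

theorem norm_sum_mul_le (z w : Cn n) : ‖∑ i, z i * w i‖ ≤ nrm z * nrm w := by
  refine (norm_sum_le _ _).trans ?_
  simp only [norm_mul]
  exact Real.sum_mul_le_sqrt_mul_sqrt Finset.univ (fun i => ‖z i‖) fun i => ‖w i‖

theorem norm_sum_mul_conj_le (z w : Cn n) : ‖∑ i, z i * conj (w i)‖ ≤ nrm z * nrm w := by
  simpa [nrm, nsq] using norm_sum_mul_le z fun i => conj (w i)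

theorem sum_mul_conj_self (z : Cn n) : ∑ i, z i * conj (z i) = (nsq z : ℂ) := by
  simp [nsq, Complex.mul_conj, Complex.normSq_eq_norm_sq]

theorem nsq_sub (z w : Cn n) :
    nsq (z - w) = nsq z + nsq w - 2 * (∑ i, z i * conj (w i)).re := by
  simp only [nsq, Complex.re_sum, Finset.mul_sum, ← Finset.sum_add_distrib,
    ← Finset.sum_sub_distrib, Pi.sub_apply]
  refine Finset.sum_congr rfl fun i _ => ?_
  simp only [← Complex.normSq_eq_norm_sq, Complex.normSq_apply, Complex.sub_re, Complex.sub_im,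
    Complex.mul_re, Complex.conj_re, Complex.conj_im]
  ring

/-! ### The Hermitian form -/

theorem herm_zero_right (z : Cn n) : herm z 0 = -1 := by simp [herm]

theorem herm_zero_left (w : Cn n) : herm 0 w = -1 := by simp [herm]

theorem herm_self (z : Cn n) : herm z z = ((nsq z - 1 : ℝ) : ℂ) := by
  simp [herm, sum_mul_conj_self]

theorem conj_herm (z w : Cn n) : conj (herm z w) = herm w z := by
  simp [herm, mul_comm]

theorem norm_herm_comm (z w : Cn n) : ‖herm z w‖ = ‖herm w z‖ := by
  rw [← conj_herm, RCLike.norm_conj]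

theorem norm_herm_self {z : Cn n} (hz : z ∈ ball n) : ‖herm z z‖ = defect z ^ 2 := by
  rw [herm_self, Complex.norm_real, Real.norm_eq_abs, abs_of_neg (by linarith [mem_ball_iff.1 hz]),
    defect_sq hz, neg_sub]

theorem one_sub_nrm_mul_le_norm_herm (z w : Cn n) : 1 - nrm z * nrm w ≤ ‖herm z w‖ := by
  have reverse_triangle := norm_sub_norm_le (1 : ℂ) (∑ i, z i * conj (w i))
  rw [norm_one] at reverse_triangle
  rw [herm, norm_sub_rev]
  linarith [norm_sum_mul_conj_le z w]

theorem norm_herm_le_two {z w : Cn n} (hz : z ∈ ball n) (hw : w ∈ ball n) : ‖herm z w‖ ≤ 2 := by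
  have triangle := norm_sub_le (∑ i, z i * conj (w i)) 1
  rw [norm_one] at triangle
  have := mul_le_one₀ (mem_ball_iff_nrm.1 hz).le (nrm_nonneg w) (mem_ball_iff_nrm.1 hw).le
  rw [herm]
  linarith [norm_sum_mul_conj_le z w]

theorem defect_mul_add_le_norm_herm {z w : Cn n} (hz : z ∈ ball n) (hw : w ∈ ball n) :
    defect z * defect w + nsq (z - w) / 2 ≤ ‖herm z w‖ := by
  have re_le : (-herm z w).re ≤ ‖herm z w‖ := norm_neg (herm z w) ▸ Complex.re_le_norm _
  have re_eq : (-herm z w).re = (defect z ^ 2 + defect w ^ 2 + nsq (z - w)) / 2 := by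
    rw [defect_sq hz, defect_sq hw, nsq_sub]
    simp only [herm, neg_sub, Complex.sub_re, Complex.one_re]
    ring
  nlinarith [sq_nonneg (defect z - defect w)]

theorem norm_herm_pos {z w : Cn n} (hz : z ∈ ball n) (hw : w ∈ ball n) : 0 < ‖herm z w‖ := by
  have := defect_mul_add_le_norm_herm hz hw
  have := mul_pos (defect_pos hz) (defect_pos hw)
  linarith [nsq_nonneg (z - w)]

theorem herm_ne_zero {z w : Cn n} (hz : z ∈ ball n) (hw : w ∈ ball n) : herm z w ≠ 0 :=
  norm_pos_iff.1 (norm_herm_pos hz hw)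

theorem continuous_herm : Continuous fun x : Cn n × Cn n => herm x.1 x.2 := by
  unfold herm; fun_prop

theorem differentiable_herm_left (w : Cn n) : Differentiable ℂ fun z => herm z w := by
  unfold herm; fun_prop

/-- `1 / cosh (τ(z, w) / 2)` for the complex hyperbolic distance `τ`. A Bergman kernel power,
weighted by the invariant metric in both variables, has absolute value a power of this quantity. -/
def sechHalf (z w : Cn n) : ℝ := defect z * defect w / ‖herm z w‖

theorem sechHalf_nonneg (z w : Cn n) : 0 ≤ sechHalf z w :=
  div_nonneg (mul_nonneg (defect_nonneg z) (defect_nonneg w)) (norm_nonneg _)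

theorem sechHalf_pos {z w : Cn n} (hz : z ∈ ball n) (hw : w ∈ ball n) : 0 < sechHalf z w :=
  div_pos (mul_pos (defect_pos hz) (defect_pos hw)) (norm_herm_pos hz hw)

theorem sechHalf_comm (z w : Cn n) : sechHalf z w = sechHalf w z := by
  rw [sechHalf, sechHalf, mul_comm (defect z), norm_herm_comm]

theorem sechHalf_zero_right (z : Cn n) : sechHalf z 0 = defect z := by
  simp [sechHalf, herm_zero_right, defect, nsq_zero]

theorem measurable_sechHalf (w : Cn n) : Measurable fun z => sechHalf z w :=
  (continuous_defect.measurable.mul_const _).div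
    (continuous_herm.comp (Continuous.prodMk_left w)).norm.measurable

theorem measurable_sechHalf_uncurry : Measurable fun x : Cn n × Cn n => sechHalf x.1 x.2 :=
  (((continuous_defect.comp continuous_fst).mul
    (continuous_defect.comp continuous_snd)).measurable).div continuous_herm.norm.measurable

theorem continuousOn_sechHalf {w : Cn n} (hw : w ∈ ball n) :
    ContinuousOn (fun z => sechHalf z w) (ball n) :=
  (continuous_defect.mul_const _).continuousOn.div
    (continuous_herm.comp (Continuous.prodMk_left w)).norm.continuousOn
    fun _ hz => (norm_herm_pos hz hw).ne'

theorem sechHalf_le_one_sub {z w : Cn n} (hz : z ∈ ball n) (hw : w ∈ ball n) :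
    sechHalf z w ≤ 1 - nsq (z - w) / 4 := by
  have := norm_herm_le_two hz hw
  rw [sechHalf, div_le_iff₀ (norm_herm_pos hz hw)]
  nlinarith [defect_mul_add_le_norm_herm hz hw, nsq_nonneg (z - w)]

theorem sechHalf_le_one {z w : Cn n} (hz : z ∈ ball n) (hw : w ∈ ball n) : sechHalf z w ≤ 1 :=
  (sechHalf_le_one_sub hz hw).trans (by linarith [nsq_nonneg (z - w)])

theorem sechHalf_sq_le {z w : Cn n} {r : ℝ} (hr : r < 1) (hz : z ∈ ball n) (hw : nrm w ≤ r) :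
    sechHalf z w ^ 2 ≤ 2 / (1 - r) * defect z ^ 2 := by
  have w_mem : w ∈ ball n := mem_ball_iff_nrm.2 (hw.trans_lt hr)
  have herm_ge : 1 - nrm w ≤ ‖herm z w‖ :=
    (sub_le_sub_left (mul_le_of_le_one_left (nrm_nonneg w) (mem_ball_iff_nrm.1 hz).le) 1).trans
      (one_sub_nrm_mul_le_norm_herm z w)
  have w_defect : defect w ^ 2 = (1 - nrm w) * (1 + nrm w) := by
    rw [defect_sq w_mem, ← nrm_sq]; ring
  have one_sub_pos : 0 < 1 - nrm w := by linarith
  calc sechHalf z w ^ 2 = defect z ^ 2 * defect w ^ 2 / ‖herm z w‖ ^ 2 := by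
        rw [sechHalf, div_pow, mul_pow]
    _ ≤ defect z ^ 2 * ((1 - nrm w) * (1 + nrm w)) / (1 - nrm w) ^ 2 := by
        rw [w_defect]
        have := nrm_nonneg w
        gcongr
    _ = (1 + nrm w) / (1 - nrm w) * defect z ^ 2 := by field_simp
    _ ≤ 2 / (1 - r) * defect z ^ 2 := by
        gcongr
        linarith

theorem defect_sq_mul_le_sechHalf_sq {z w : Cn n} {r : ℝ} (hr : r < 1) (hz : z ∈ ball n)
    (hw : nrm w ≤ r) : (1 - r) / 4 * defect z ^ 2 ≤ sechHalf z w ^ 2 := by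
  have w_mem : w ∈ ball n := mem_ball_iff_nrm.2 (hw.trans_lt hr)
  have herm_le := norm_herm_le_two hz w_mem
  have w_defect : 1 - r ≤ defect w ^ 2 := by
    rw [defect_sq w_mem, ← nrm_sq]; nlinarith [nrm_nonneg w]
  calc (1 - r) / 4 * defect z ^ 2 = defect z ^ 2 * (1 - r) / 2 ^ 2 := by ring
    _ ≤ defect z ^ 2 * defect w ^ 2 / ‖herm z w‖ ^ 2 := by
        have := norm_herm_pos hz w_mem
        have : 0 ≤ 1 - r := by linarith
        gcongr
    _ = sechHalf z w ^ 2 := by rw [sechHalf, div_pow, mul_pow]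

theorem hypDist_eq {z w : Cn n} (hz : z ∈ ball n) (hw : w ∈ ball n) :
    hypDist z w = 2 * Real.arcosh (sechHalf z w)⁻¹ := by
  rw [hypDist, norm_herm_self hz, norm_herm_self hw, ← mul_pow, ← div_pow, Real.sqrt_sq, sechHalf,
    inv_div]
  exact div_nonneg (norm_nonneg _) (mul_nonneg (defect_nonneg z) (defect_nonneg w))

theorem hypDist_lt_iff {z w z' w' : Cn n} (hz : z ∈ ball n) (hw : w ∈ ball n)
    (hz' : z' ∈ ball n) (hw' : w' ∈ ball n) :
    hypDist z w < hypDist z' w' ↔ sechHalf z' w' < sechHalf z w := by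
  have one_le_inv {u v : Cn n} (hu : u ∈ ball n) (hv : v ∈ ball n) : 1 ≤ (sechHalf u v)⁻¹ :=
    (one_le_inv₀ (sechHalf_pos hu hv)).2 (sechHalf_le_one hu hv)
  rw [hypDist_eq hz hw, hypDist_eq hz' hw', mul_lt_mul_iff_right₀ two_pos,
    Real.arcosh_lt_arcosh (zero_lt_one.trans_le (one_le_inv hz hw))
      (zero_lt_one.trans_le (one_le_inv hz' hw')),
    inv_lt_inv₀ (sechHalf_pos hz hw) (sechHalf_pos hz' hw')]

/-! ### Bordered matrices -/

/-- The block matrix `[A, b; c, d]` with a single last row and column, the block form in which the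
fractional-linear action reads off numerators and denominators. -/
def bordered {K : Type*} (A : Matrix (Fin n) (Fin n) K) (b c : Fin n → K) (d : K) :
    Matrix (Fin (n + 1)) (Fin (n + 1)) K :=
  Matrix.of fun i j => Fin.lastCases (motive := fun _ => K)
    (Fin.lastCases (motive := fun _ => K) d c j)
    (fun i => Fin.lastCases (motive := fun _ => K) (b i) (A i) j) i

section Bordered

variable {K : Type*} (A : Matrix (Fin n) (Fin n) K) (b c : Fin n → K) (d : K) (i j : Fin n)

@[simp]
theorem bordered_castSucc_castSucc : bordered A b c d i.castSucc j.castSucc = A i j := by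
  simp [bordered]

@[simp]
theorem bordered_castSucc_last : bordered A b c d i.castSucc (Fin.last n) = b i := by
  simp [bordered]

@[simp]
theorem bordered_last_castSucc : bordered A b c d (Fin.last n) j.castSucc = c j := by
  simp [bordered]

@[simp]
theorem bordered_last_last : bordered A b c d (Fin.last n) (Fin.last n) = d := by
  simp [bordered]

theorem det_bordered {K : Type*} [Field K] (A : Matrix (Fin n) (Fin n) K) (b c : Fin n → K) {d : K}
    (hd : d ≠ 0) : (bordered A b c d).det = d * (A - d⁻¹ • vecMulVec b c).det := by
  let D : Matrix (Fin 1) (Fin 1) K := d • 1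
  let : Invertible D := ⟨d⁻¹ • 1, by simp [D, hd], by simp [D, hd]⟩
  have last_eq (i : Fin 1) : Fin.natAdd n i = Fin.last n := by
    rw [Subsingleton.elim i 0]; rfl
  have blocks : (bordered A b c d).submatrix finSumFinEquiv finSumFinEquiv =
      fromBlocks A (replicateCol (Fin 1) b) (replicateRow (Fin 1) c) D := by
    ext (i | i) (j | j) <;>
      simp [bordered, D, ← Fin.castSucc.eq_1, last_eq, Subsingleton.elim _ (0 : Fin 1)]
  have inv_D : ⅟D = d⁻¹ • 1 := rfl
  rw [← det_submatrix_equiv_self finSumFinEquiv, blocks, det_fromBlocks₂₂, inv_D,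
    vecMulVec_eq (Fin 1), Matrix.mul_smul, Matrix.smul_mul, Matrix.mul_one]
  congr 1
  simp [D]

end Bordered

theorem det_one_add_smul_vecMulVec {K : Type*} [Field K] (s : K) (u v : Fin n → K) :
    (1 + s • vecMulVec u v).det = 1 + s * ∑ i, u i * v i := by
  rw [← smul_vecMulVec, vecMulVec_eq (Fin 1), det_one_add_replicateCol_mul_replicateRow]
  simp [dotProduct, Finset.mul_sum, mul_comm, mul_left_comm]

/-! ### The fractional-linear action -/

/-- The denominator of the fractional-linear action. -/
def den (g : SU n) (z : Cn n) : ℂ :=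
  ∑ j, mat g (Fin.last n) (Fin.castSucc j) * z j + mat g (Fin.last n) (Fin.last n)

/-- The numerator of the fractional-linear action. -/
def num (g : SU n) (z : Cn n) : Cn n := fun i =>
  ∑ j, mat g i.castSucc (Fin.castSucc j) * z j + mat g i.castSucc (Fin.last n)

theorem act_apply (g : SU n) (z : Cn n) (i : Fin n) : act g z i = num g z i / den g z := rfl

theorem mat_mulVec_snoc (g : SU n) (z : Cn n) :
    mat g *ᵥ (Fin.snoc z 1 : Fin (n + 1) → ℂ) = Fin.snoc (num g z) (den g z) := by
  ext i
  cases i using Fin.lastCases <;>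
    simp [Matrix.mulVec, dotProduct, Fin.sum_univ_castSucc, den, num]

theorem mat_mul (g h : SU n) : mat (g * h) = mat g * mat h := rfl

theorem mat_one : mat (1 : SU n) = 1 := rfl

theorem det_mat (g : SU n) : (mat g).det = 1 := g.1.2

theorem mat_isometry (g : SU n) :
    (mat g)ᵀ * sigma n * (mat g).map (starRingEnd ℂ) = sigma n := g.2

theorem sigma_mul_sigma (n : ℕ) : sigma n * sigma n = 1 := by
  rw [sigma, Matrix.diagonal_mul_diagonal, ← Matrix.diagonal_one]
  congr 1
  ext i
  split_ifs <;> simp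

theorem transpose_mul_sigma_mul_apply (A B : Matrix (Fin (n + 1)) (Fin (n + 1)) ℂ)
    (i j : Fin (n + 1)) : (Aᵀ * sigma n * B) i j =
      ∑ k : Fin n, A k.castSucc i * B k.castSucc j - A (Fin.last n) i * B (Fin.last n) j := by
  simp [Matrix.mul_apply, sigma, Fin.sum_univ_castSucc, Fin.castSucc_ne_last,
    sub_eq_add_neg, Matrix.diagonal_apply]

theorem bordered_isometry {P : Matrix (Fin n) (Fin n) ℂ} {b : Cn n} {d : ℂ} (hP : P.IsHermitian)
    (hd : conj d = d) (h_square : P * P = 1 + vecMulVec b (star b)) (h_eigen : P *ᵥ b = d • b)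
    (h_norm : star b ⬝ᵥ b = d ^ 2 - 1) :
    (bordered P b (star b) d)ᵀ * sigma n * (bordered P b (star b) d).map (starRingEnd ℂ) =
      sigma n := by
  have conj_entry (i k : Fin n) : conj (P k i) = P i k := hP.apply i k
  have square (i j : Fin n) : ∑ k, P j k * P k i = (if i = j then 1 else 0) + b j * conj (b i) := by
    simpa [Matrix.mul_apply, Matrix.one_apply, vecMulVec_apply, eq_comm] using
      congrFun (congrFun h_square j) i
  have eigen (j : Fin n) : ∑ k, P j k * b k = d * b j := congrFun h_eigen j
  have conj_eigen (j : Fin n) : ∑ k, P k j * conj (b k) = d * conj (b j) := by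
    simpa [conj_entry, hd] using congrArg conj (eigen j)
  have norm_b : ∑ k, conj (b k) * b k = d ^ 2 - 1 := h_norm
  ext i j
  rw [transpose_mul_sigma_mul_apply]
  cases i using Fin.lastCases with
  | last =>
    cases j using Fin.lastCases with
    | last =>
      simp only [bordered_castSucc_last, bordered_last_last, Matrix.map_apply, hd, sigma,
        Matrix.diagonal_apply_eq, if_true, mul_comm (b _), norm_b]
      ring
    | cast j =>
      simp [conj_entry, sigma, (Fin.castSucc_ne_last _).symm, mul_comm (b _), eigen]
  | cast i =>
    cases j using Fin.lastCases with
    | last => simp [conj_eigen, sigma, Fin.castSucc_ne_last, hd, mul_comm d]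
    | cast j =>
      simp [conj_entry, sigma, Matrix.diagonal_apply, Fin.castSucc_ne_last, mul_comm (P _ i),
        square, mul_comm (conj _)]

theorem mat_conj_isometry (g : SU n) :
    (mat g).map (starRingEnd ℂ) * sigma n * (mat g)ᵀ = sigma n := by
  have right_inv : (mat g).map (starRingEnd ℂ) * sigma n * ((mat g)ᵀ * sigma n) = 1 :=
    mul_eq_one_comm.1 (by rw [← Matrix.mul_assoc, mat_isometry, sigma_mul_sigma])
  simpa [Matrix.mul_assoc, sigma_mul_sigma] using congrArg (· * sigma n) right_inv

theorem dotProduct_sigma_mulVec (z w : Cn n) (a b : ℂ) :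
    (Fin.snoc z a : Fin (n + 1) → ℂ) ⬝ᵥ
        (sigma n *ᵥ fun i => conj ((Fin.snoc w b : Fin (n + 1) → ℂ) i)) =
      ∑ i, z i * conj (w i) - a * conj b := by
  simp [sigma, Matrix.mulVec_diagonal, dotProduct, Fin.sum_univ_castSucc,
    Fin.castSucc_ne_last, sub_eq_add_neg]

theorem num_den_isometry (g : SU n) (z w : Cn n) :
    ∑ i, num g z i * conj (num g w i) - den g z * conj (den g w) = herm z w := by
  have conj_mulVec : (fun i => conj ((Fin.snoc (num g w) (den g w) : Fin (n + 1) → ℂ) i)) =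
      (mat g).map (starRingEnd ℂ) *ᵥ fun i => conj ((Fin.snoc w 1 : Fin (n + 1) → ℂ) i) := by
    rw [← mat_mulVec_snoc]
    ext i
    simp [Matrix.mulVec, dotProduct]
  rw [← dotProduct_sigma_mulVec, conj_mulVec, ← mat_mulVec_snoc, Matrix.mulVec_mulVec,
    Matrix.dotProduct_mulVec, ← Matrix.vecMul_transpose, Matrix.vecMul_vecMul,
    ← Matrix.dotProduct_mulVec, ← Matrix.mul_assoc, mat_isometry, dotProduct_sigma_mulVec, herm]
  simp

theorem den_zero (g : SU n) : den g 0 = mat g (Fin.last n) (Fin.last n) := by simp [den]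

theorem nsq_last_row (g : SU n) :
    nsq (fun j => mat g (Fin.last n) (Fin.castSucc j)) = ‖den g 0‖ ^ 2 - 1 := by
  have entry := congrFun (congrFun (mat_conj_isometry g) (Fin.last n)) (Fin.last n)
  rw [Matrix.mul_apply] at entry
  simp only [sigma, Matrix.mul_diagonal, Matrix.transpose_apply,
    Matrix.map_apply, Fin.sum_univ_castSucc, Fin.castSucc_ne_last, if_false, if_true,
    Matrix.diagonal_apply_eq, mul_one, mul_neg, neg_mul, Complex.conj_mul'] at entry
  have real_entry : nsq (fun j => mat g (Fin.last n) (Fin.castSucc j)) +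
      -‖mat g (Fin.last n) (Fin.last n)‖ ^ 2 = -1 := by
    unfold nsq; exact_mod_cast entry
  rw [den_zero]; linarith

theorem one_le_norm_den_zero (g : SU n) : 1 ≤ ‖den g 0‖ := by
  nlinarith [nsq_last_row g, nsq_nonneg fun j => mat g (Fin.last n) (Fin.castSucc j),
    norm_nonneg (den g 0)]

theorem norm_den_zero_mul_le (g : SU n) (z : Cn n) : ‖den g 0‖ * (1 - nrm z) ≤ ‖den g z‖ := by
  have linear_part : ‖∑ j, mat g (Fin.last n) (Fin.castSucc j) * z j‖ ≤ ‖den g 0‖ * nrm z := by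
    refine (norm_sum_mul_le _ z).trans (mul_le_mul_of_nonneg_right ?_ (nrm_nonneg z))
    rw [nrm, nsq_last_row]
    exact Real.sqrt_le_iff.2 ⟨norm_nonneg _, by linarith⟩
  have triangle := norm_sub_norm_le (den g 0)
    (-∑ j, mat g (Fin.last n) (Fin.castSucc j) * z j)
  rw [sub_neg_eq_add, norm_neg, den_zero, add_comm (mat g _ _), ← den, ← den_zero] at triangle
  linarith

theorem den_ne_zero (g : SU n) {z : Cn n} (hz : z ∈ ball n) : den g z ≠ 0 :=
  norm_pos_iff.1 <| (mul_pos (zero_lt_one.trans_le (one_le_norm_den_zero g))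
    (sub_pos.2 (mem_ball_iff_nrm.1 hz))).trans_le (norm_den_zero_mul_le g z)

theorem herm_act (g : SU n) {z w : Cn n} (hz : z ∈ ball n) (hw : w ∈ ball n) :
    herm (act g z) (act g w) = herm z w / (den g z * conj (den g w)) := by
  have conj_ne_zero : conj (den g w) ≠ 0 := (map_ne_zero _).2 (den_ne_zero g hw)
  rw [← num_den_isometry g z w, herm, sub_div,
    div_self (mul_ne_zero (den_ne_zero g hz) conj_ne_zero), Finset.sum_div]
  simp only [act_apply, map_div₀, div_mul_div_comm]

theorem one_sub_nsq_act (g : SU n) {z : Cn n} (hz : z ∈ ball n) :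
    1 - nsq (act g z) = (1 - nsq z) / ‖den g z‖ ^ 2 := by
  have herm_eq := herm_act g hz hz
  rw [Complex.mul_conj, Complex.normSq_eq_norm_sq, herm_self, herm_self,
    ← Complex.ofReal_div] at herm_eq
  rw [← neg_sub, Complex.ofReal_injective herm_eq, ← neg_div, neg_sub]

theorem act_mem_ball (g : SU n) {z : Cn n} (hz : z ∈ ball n) : act g z ∈ ball n := by
  rw [mem_ball_iff, ← sub_pos, one_sub_nsq_act g hz]
  exact div_pos (sub_pos.2 hz) (pow_pos (norm_pos_iff.2 (den_ne_zero g hz)) 2)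

theorem defect_act (g : SU n) {z : Cn n} (hz : z ∈ ball n) :
    defect (act g z) = defect z / ‖den g z‖ := by
  rw [defect, one_sub_nsq_act g hz, Real.sqrt_div' _ (by positivity),
    Real.sqrt_sq (norm_nonneg _), defect]

theorem snoc_act (g : SU n) {z : Cn n} (hz : z ∈ ball n) :
    (Fin.snoc (num g z) (den g z) : Fin (n + 1) → ℂ) =
      den g z • (Fin.snoc (act g z) 1 : Fin (n + 1) → ℂ) := by
  ext i
  cases i using Fin.lastCases <;> simp [act_apply, mul_div_cancel₀ _ (den_ne_zero g hz)]

theorem snoc_num_den_mul (g h : SU n) {z : Cn n} (hz : z ∈ ball n) :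
    (Fin.snoc (num (g * h) z) (den (g * h) z) : Fin (n + 1) → ℂ) =
      den h z • (Fin.snoc (num g (act h z)) (den g (act h z)) : Fin (n + 1) → ℂ) := by
  rw [← mat_mulVec_snoc, mat_mul, ← Matrix.mulVec_mulVec, mat_mulVec_snoc, snoc_act h hz,
    Matrix.mulVec_smul, mat_mulVec_snoc]

theorem den_mul (g h : SU n) {z : Cn n} (hz : z ∈ ball n) :
    den (g * h) z = den h z * den g (act h z) := by
  simpa using congrFun (snoc_num_den_mul g h hz) (Fin.last n)

theorem act_mul (g h : SU n) {z : Cn n} (hz : z ∈ ball n) :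
    act (g * h) z = act g (act h z) := by
  ext i
  have num_mul : num (g * h) z i = den h z * num g (act h z) i := by
    simpa using congrFun (snoc_num_den_mul g h hz) i.castSucc
  rw [act_apply, act_apply, num_mul, den_mul g h hz, mul_div_mul_left _ _ (den_ne_zero h hz)]

theorem snoc_num_den_one (z : Cn n) :
    (Fin.snoc (num 1 z) (den 1 z) : Fin (n + 1) → ℂ) = Fin.snoc z 1 := by
  rw [← mat_mulVec_snoc, mat_one, Matrix.one_mulVec]

theorem den_one (z : Cn n) : den 1 z = 1 := by
  simpa using congrFun (snoc_num_den_one z) (Fin.last n)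

theorem act_one (z : Cn n) : act 1 z = z := by
  ext i
  rw [act_apply, den_one, div_one]
  simpa using congrFun (snoc_num_den_one z) i.castSucc

theorem act_inv_act (g : SU n) {z : Cn n} (hz : z ∈ ball n) : act g⁻¹ (act g z) = z := by
  rw [← act_mul _ _ hz, inv_mul_cancel, act_one]

theorem act_act_inv (g : SU n) {z : Cn n} (hz : z ∈ ball n) : act g (act g⁻¹ z) = z := by
  rw [← act_mul _ _ hz, mul_inv_cancel, act_one]

theorem injOn_act (g : SU n) : Set.InjOn (act g) (ball n) := fun z hz w hw h => by
  rw [← act_inv_act g hz, h, act_inv_act g hw]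

theorem image_act_ball (g : SU n) : act g '' ball n = ball n :=
  Set.Subset.antisymm (Set.image_subset_iff.2 fun _ hz => act_mem_ball g hz) fun z hz =>
    ⟨act g⁻¹ z, act_mem_ball _ hz, act_act_inv g hz⟩

theorem sechHalf_act (g : SU n) {z w : Cn n} (hz : z ∈ ball n) (hw : w ∈ ball n) :
    sechHalf (act g z) (act g w) = sechHalf z w := by
  have := norm_ne_zero_iff.2 (den_ne_zero g hz)
  have := norm_ne_zero_iff.2 (den_ne_zero g hw)
  have := (norm_herm_pos hz hw).ne'
  rw [sechHalf, sechHalf, herm_act g hz hw, defect_act g hz, defect_act g hw, norm_div, norm_mul,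
    RCLike.norm_conj]
  field_simp

theorem sechHalf_act_left (g : SU n) {z w : Cn n} (hz : z ∈ ball n) (hw : w ∈ ball n) :
    sechHalf (act g z) w = sechHalf z (act g⁻¹ w) := by
  rw [← sechHalf_act g hz (act_mem_ball _ hw), act_act_inv g hw]

/-! ### Transitivity -/

section Boost

variable (z : Cn n)

/-- The transvection moving `0` to `z`: in the direction of `z` it is the hyperbolic rotation with
`cosh = (1 - |z|²)^(-1/2)`, and it fixes the orthogonal complement of `z`. -/
def boostMatrix : Matrix (Fin (n + 1)) (Fin (n + 1)) ℂ :=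
  let c : ℂ := ((defect z)⁻¹ : ℝ)
  bordered (1 + (c ^ 2 / (1 + c)) • vecMulVec z (star z)) (c • z) (c • star z) c

variable {z} (hz : z ∈ ball n)
include hz

theorem cosh_sq_mul : (((defect z)⁻¹ : ℝ) : ℂ) ^ 2 * (1 - (nsq z : ℂ)) = 1 := by
  have := (defect_pos hz).ne'
  rw [← Complex.ofReal_one, ← Complex.ofReal_sub, ← defect_sq hz]
  norm_cast
  field_simp

theorem one_add_cosh_ne_zero : 1 + (((defect z)⁻¹ : ℝ) : ℂ) ≠ 0 := by
  have := inv_pos.2 (defect_pos hz)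
  exact_mod_cast (by positivity : 1 + (defect z)⁻¹ ≠ 0)

theorem det_boostMatrix : (boostMatrix z).det = 1 := by
  have cosh_sq := cosh_sq_mul hz
  have denom := one_add_cosh_ne_zero hz
  have cosh_ne_zero : (((defect z)⁻¹ : ℝ) : ℂ) ≠ 0 :=
    Complex.ofReal_ne_zero.2 (inv_pos.2 (defect_pos hz)).ne'
  rw [boostMatrix, det_bordered _ _ _ cosh_ne_zero]
  generalize (((defect z)⁻¹ : ℝ) : ℂ) = c at *
  have rank_one : (1 + (c ^ 2 / (1 + c)) • vecMulVec z (star z)) -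
      c⁻¹ • vecMulVec (c • z) (c • star z) =
      1 + (c ^ 2 / (1 + c) - c) • vecMulVec z (star z) := by
    rw [smul_vecMulVec, vecMulVec_smul, smul_smul, smul_smul, inv_mul_cancel₀ cosh_ne_zero, one_mul,
      sub_smul, add_sub_assoc]
  rw [rank_one, det_one_add_smul_vecMulVec]
  simp only [Pi.star_apply, RCLike.star_def, sum_mul_conj_self]
  field_simp
  linear_combination cosh_sq

theorem boostMatrix_isometry :
    (boostMatrix z)ᵀ * sigma n * (boostMatrix z).map (starRingEnd ℂ) = sigma n := by
  have cosh_sq := cosh_sq_mul hz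
  have denom := one_add_cosh_ne_zero hz
  have conj_cosh : conj (((defect z)⁻¹ : ℝ) : ℂ) = (((defect z)⁻¹ : ℝ) : ℂ) :=
    Complex.conj_ofReal _
  have self_dot : star z ⬝ᵥ z = (nsq z : ℂ) := by
    rw [← sum_mul_conj_self, dotProduct_comm]; rfl
  have star_smul_cosh :
      (((defect z)⁻¹ : ℝ) : ℂ) • star z = star ((((defect z)⁻¹ : ℝ) : ℂ) • z) := by
    rw [star_smul, RCLike.star_def, conj_cosh]
  rw [boostMatrix, star_smul_cosh]
  generalize (((defect z)⁻¹ : ℝ) : ℂ) = c at *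
  refine bordered_isometry ?_ conj_cosh ?_ ?_ ?_
  · ext i j
    simp [Matrix.one_apply, vecMulVec_apply, conj_cosh, apply_ite conj, eq_comm, mul_comm]
  · rw [add_mul, one_mul, mul_add, mul_one, smul_mul_smul_comm, vecMulVec_mul_vecMulVec, self_dot,
      star_smul, vecMulVec_smul, smul_vecMulVec, vecMulVec_smul, RCLike.star_def,
      conj_cosh, smul_smul, smul_smul, add_assoc, ← add_smul, ← add_smul]
    congr 2
    field_simp
    linear_combination (-c ^ 2) * cosh_sq
  · rw [add_mulVec, one_mulVec, smul_mulVec, mulVec_smul, vecMulVec_mulVec, self_dot]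
    ext i
    simp only [op_smul_eq_smul, Complex.coe_smul, Pi.add_apply, Pi.smul_apply, smul_eq_mul,
      Complex.real_smul]
    field_simp
    linear_combination (-c * z i) * cosh_sq
  · rw [star_smul, smul_dotProduct, dotProduct_smul, self_dot, RCLike.star_def, conj_cosh]
    simp only [smul_eq_mul]
    linear_combination -cosh_sq

theorem exists_act_zero_eq : ∃ g : SU n, act g 0 = z := by
  refine ⟨⟨⟨boostMatrix z, det_boostMatrix hz⟩, boostMatrix_isometry hz⟩, ?_⟩
  ext i
  have : (defect z : ℂ) ≠ 0 := Complex.ofReal_ne_zero.2 (defect_pos hz).ne'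
  simp only [boostMatrix, Complex.ofReal_inv, act_apply, num, mat, bordered_castSucc_castSucc,
    Pi.zero_apply, mul_zero, Finset.sum_const_zero, bordered_castSucc_last, Pi.smul_apply, zero_add,
    den, bordered_last_castSucc, bordered_last_last, smul_eq_mul]
  field_simp

end Boost

/-! ### The Jacobian -/

/-- The derivative of `act g` at `z` as a matrix. -/
def actDeriv (g : SU n) (z : Cn n) : Matrix (Fin n) (Fin n) ℂ :=
  (den g z)⁻¹ • ((mat g).submatrix Fin.castSucc Fin.castSucc -
    (den g z)⁻¹ • vecMulVec (num g z) fun j => mat g (Fin.last n) j.castSucc)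

theorem hasFDerivAt_act (g : SU n) {z : Cn n} (hz : z ∈ ball n) :
    HasFDerivAt (act g) (Matrix.mulVecLin (actDeriv g z)).toContinuousLinearMap z := by
  rw [hasFDerivAt_pi']
  intro i
  have coord (j : Fin n) := hasFDerivAt_apply (𝕜 := ℂ) (F' := fun _ : Fin n => ℂ) j z
  have hnum : HasFDerivAt (fun y : Cn n => num g y i) _ z :=
    (HasFDerivAt.fun_sum (u := Finset.univ) fun j _ =>
      (coord j).const_mul (mat g i.castSucc j.castSucc)).add_const (mat g i.castSucc (Fin.last n))
  have hden : HasFDerivAt (fun y : Cn n => den g y) _ z :=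
    (HasFDerivAt.fun_sum (u := Finset.univ) fun j _ =>
      (coord j).const_mul (mat g (Fin.last n) j.castSucc)).add_const
        (mat g (Fin.last n) (Fin.last n))
  have act_eq : (fun y : Cn n => act g y i) = fun y => num g y i * (den g y)⁻¹ := by
    ext y; rw [act_apply, div_eq_mul_inv]
  rw [act_eq]
  refine (hnum.mul ((hasDerivAt_inv (den_ne_zero g hz)).comp_hasFDerivAt z hden)).congr_fderiv ?_
  ext v
  simp only [Function.comp_apply, _root_.add_apply, _root_.smul_apply, _root_.sum_apply,
    ContinuousLinearMap.proj_apply, smul_eq_mul, Finset.mul_sum, neg_mul, Finset.sum_neg_distrib,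
    mul_neg, actDeriv, map_smul, map_sub, ContinuousLinearMap.comp_smulₛₗ, map_inv₀,
    RingHom.id_apply, ContinuousLinearMap.comp_sub, _root_.sub_apply,
    ContinuousLinearMap.comp_apply, LinearMap.coe_toContinuousLinearMap', mulVecBilin_apply, mulVec,
    dotProduct, submatrix_apply, vecMulVec_apply, mul_sub]
  rw [neg_add_eq_sub]
  congr 1
  exact Finset.sum_congr rfl fun _ _ => by ring

theorem mat_mul_bordered (g : SU n) (z : Cn n) :
    mat g * bordered 1 z 0 1 = bordered ((mat g).submatrix Fin.castSucc Fin.castSucc) (num g z)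
      (fun j => mat g (Fin.last n) j.castSucc) (den g z) := by
  ext i j
  rw [Matrix.mul_apply, Fin.sum_univ_castSucc]
  cases i using Fin.lastCases <;> cases j using Fin.lastCases <;>
    simp [Matrix.one_apply, num, den]

theorem det_actDeriv (g : SU n) {z : Cn n} (hz : z ∈ ball n) :
    (actDeriv g z).det = ((den g z) ^ (n + 1))⁻¹ := by
  have schur := congrArg det (mat_mul_bordered g z)
  rw [det_mul, det_mat, det_bordered _ _ _ one_ne_zero, det_bordered _ _ _ (den_ne_zero g hz)]
    at schur
  simp only [vecMulVec_zero, smul_zero, sub_zero, det_one, mul_one] at schur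
  rw [actDeriv, det_smul, Fintype.card_fin, eq_inv_of_mul_eq_one_right schur.symm, ← inv_pow,
    pow_succ]

theorem jac_eq (g : SU n) {z : Cn n} (hz : z ∈ ball n) : jac g z = ((den g z) ^ (n + 1))⁻¹ := by
  rw [jac, (hasFDerivAt_act g hz).fderiv, ← det_actDeriv g hz, ContinuousLinearMap.det,
    LinearMap.coe_toContinuousLinearMap, ← Matrix.toLin'_apply', LinearMap.det_toLin']

theorem differentiableOn_act (g : SU n) : DifferentiableOn ℂ (act g) (ball n) :=
  fun _ hz => (hasFDerivAt_act g hz).differentiableAt.differentiableWithinAt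

theorem continuousOn_act (g : SU n) : ContinuousOn (act g) (ball n) :=
  (differentiableOn_act g).continuousOn

theorem differentiable_den (g : SU n) : Differentiable ℂ (den g) := by
  unfold den; fun_prop

theorem lintegral_act (g : SU n) (f : Cn n → ℝ≥0∞) :
    ∫⁻ z in ball n, ENNReal.ofReal ((‖den g z‖ ^ (2 * (n + 1)))⁻¹) * f (act g z) =
      ∫⁻ z in ball n, f z := by
  conv_rhs => rw [← image_act_ball g, lintegral_image_eq_lintegral_abs_det_fderiv_mul volume
    measurableSet_ball (fun z hz => ((hasFDerivAt_act g hz).restrictScalars ℝ).hasFDerivWithinAt)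
    (injOn_act g)]
  refine setLIntegral_congr_fun measurableSet_ball fun z hz => ?_
  have real_det := LinearMap.det_restrictScalars (R := ℝ) (S := ℂ) (f := (actDeriv g z).mulVecLin)
  rw [← Matrix.toLin'_apply', LinearMap.det_toLin', det_actDeriv g hz,
    Algebra.norm_complex_apply, Complex.normSq_eq_norm_sq, norm_inv, norm_pow, inv_pow,
    ← pow_mul, mul_comm (n + 1)] at real_det
  change _ = ENNReal.ofReal |LinearMap.det (((toLin' (actDeriv g z))).restrictScalars ℝ)| * _
  rw [real_det, abs_of_nonneg (by positivity)]

/-! ### The invariant volume -/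

/-- The invariant volume of the ball, normalised to have density `1` at the origin with respect to
the Euclidean volume, so that the measure `dV` of the theorem is `n!/πⁿ` times it. -/
def invVol (n : ℕ) : Measure (Cn n) :=
  (volume.restrict (ball n)).withDensity fun z => ENNReal.ofReal ((defect z ^ (2 * (n + 1)))⁻¹)

instance : SFinite (invVol n) :=
  inferInstanceAs (SFinite ((volume.restrict (ball n)).withDensity _))

theorem ae_invVol_mem_ball : ∀ᵐ z ∂invVol n, z ∈ ball n :=
  (withDensity_absolutelyContinuous _ _).ae_le (ae_restrict_mem measurableSet_ball)

theorem measurable_invVol_density :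
    Measurable fun z : Cn n => ENNReal.ofReal ((defect z ^ (2 * (n + 1)))⁻¹) :=
  (continuous_defect.measurable.pow_const _).inv.ennreal_ofReal

theorem setLIntegral_invVol {U : Set (Cn n)} (hU : MeasurableSet U) (hU_ball : U ⊆ ball n)
    (f : Cn n → ℝ≥0∞) : ∫⁻ z in U, f z ∂invVol n =
      ∫⁻ z in U, ENNReal.ofReal ((defect z ^ (2 * (n + 1)))⁻¹) * f z := by
  rw [invVol, setLIntegral_withDensity_eq_setLIntegral_mul_non_measurable _
    measurable_invVol_density _ hU (ae_of_all _ fun _ => ENNReal.ofReal_lt_top),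
    Measure.restrict_restrict_of_subset hU_ball]
  rfl

theorem lintegral_invVol (f : Cn n → ℝ≥0∞) : ∫⁻ z, f z ∂invVol n =
    ∫⁻ z in ball n, ENNReal.ofReal ((defect z ^ (2 * (n + 1)))⁻¹) * f z := by
  rw [← setLIntegral_invVol measurableSet_ball subset_rfl,
    Measure.restrict_eq_self_of_ae_mem ae_invVol_mem_ball]

theorem lintegral_invVol_act (g : SU n) (f : Cn n → ℝ≥0∞) :
    ∫⁻ z, f (act g z) ∂invVol n = ∫⁻ z, f z ∂invVol n := by
  rw [lintegral_invVol, lintegral_invVol f,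
    ← lintegral_act g fun z => ENNReal.ofReal ((defect z ^ (2 * (n + 1)))⁻¹) * f z]
  refine setLIntegral_congr_fun measurableSet_ball fun z hz => ?_
  have := norm_pos_iff.2 (den_ne_zero g hz)
  have := defect_pos hz
  rw [← mul_assoc, ← ENNReal.ofReal_mul (by positivity), defect_act g hz, div_pow]
  congr 2
  field_simp

theorem lintegral_sechHalf_pow {p : Cn n} (hp : p ∈ ball n) (N : ℕ) :
    ∫⁻ z, ENNReal.ofReal (sechHalf z p ^ N) ∂invVol n =
      ∫⁻ z, ENNReal.ofReal (defect z ^ N) ∂invVol n := by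
  obtain ⟨g, rfl⟩ := exists_act_zero_eq hp
  rw [← lintegral_invVol_act g]
  refine lintegral_congr_ae <| ae_invVol_mem_ball.mono fun z hz => ?_
  beta_reduce
  rw [sechHalf_act g hz zero_mem_ball, sechHalf_zero_right]

theorem lintegral_defect_pow :
    ∫⁻ z, ENNReal.ofReal (defect z ^ (2 * (n + 1))) ∂invVol n = volume (ball n) := by
  rw [lintegral_invVol, ← setLIntegral_one]
  refine setLIntegral_congr_fun measurableSet_ball fun z hz => ?_
  have := defect_pos hz
  rw [← ENNReal.ofReal_mul (by positivity), inv_mul_cancel₀ (by positivity), ENNReal.ofReal_one]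

theorem setLIntegral_invVol_act (g : SU n) {U : Set (Cn n)} (hU : MeasurableSet U)
    (hU_ball : U ⊆ ball n) (f : Cn n → ℝ≥0∞) :
    ∫⁻ z in U, f (act g z) ∂invVol n = ∫⁻ z in act g '' U, f z ∂invVol n := by
  have image_measurable : MeasurableSet (act g '' U) := hU.image_of_continuousOn_injOn
    ((continuousOn_act g).mono hU_ball) ((injOn_act g).mono hU_ball)
  rw [← lintegral_indicator image_measurable, ← lintegral_indicator hU,
    ← lintegral_invVol_act g ((act g '' U).indicator f)]
  refine lintegral_congr_ae <| ae_invVol_mem_ball.mono fun z hz => ?_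
  have mem_image : act g z ∈ act g '' U ↔ z ∈ U := (injOn_act g).mem_image_iff hU_ball hz
  by_cases h : z ∈ U <;> simp [mem_image, h]

/-! ### Wandering sets -/

/-- A set is wandering for `Γ` if its translates by the elements of `Γ` are pairwise disjoint. -/
def IsWandering (Γ : Subgroup (SU n)) (U : Set (Cn n)) : Prop :=
  ∀ g ∈ Γ, g ≠ 1 → ∀ z ∈ U, act g z ∉ U

theorem IsWandering.mono {Γ : Subgroup (SU n)} {U V : Set (Cn n)} (hU : IsWandering Γ U)
    (hVU : V ⊆ U) : IsWandering Γ V :=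
  fun g hg hg1 z hz hgz => hU g hg hg1 z (hVU hz) (hVU hgz)

theorem IsWandering.pairwise_disjoint {Γ : Subgroup (SU n)} {U : Set (Cn n)}
    (hU : IsWandering Γ U) (hU_ball : U ⊆ ball n) :
    Pairwise (Function.onFun Disjoint fun g : Γ => act g.1 '' U) := fun g h hgh => by
  rw [Function.onFun, Set.disjoint_left]
  rintro _ ⟨z, hz, rfl⟩ ⟨w, hw, hwz⟩
  have move : act (h.1⁻¹ * g.1) z = w := by
    rw [act_mul _ _ (hU_ball hz), ← hwz, act_inv_act _ (hU_ball hw)]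
  refine hU _ (h⁻¹ * g).2 (fun h1 => hgh ?_) z hz (move ▸ hw)
  exact (inv_mul_eq_one.1 (Subtype.ext h1 : h⁻¹ * g = 1)).symm

theorem IsWandering.tsum_setLIntegral_act_le {Γ : Subgroup (SU n)} {U : Set (Cn n)}
    (hU : IsWandering Γ U) (hU_meas : MeasurableSet U) (hU_ball : U ⊆ ball n)
    (f : Cn n → ℝ≥0∞) :
    ∑' g : Γ, ∫⁻ z in U, f (act g.1 z) ∂invVol n ≤ ∫⁻ z, f z ∂invVol n := by
  rw [ENNReal.tsum_eq_iSup_sum]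
  refine iSup_le fun s => ?_
  simp only [setLIntegral_invVol_act _ hU_meas hU_ball]
  rw [← lintegral_biUnion_finset ((hU.pairwise_disjoint hU_ball).set_pairwise _) fun g _ =>
    hU_meas.image_of_continuousOn_injOn ((continuousOn_act g.1).mono hU_ball)
      ((injOn_act g.1).mono hU_ball)]
  exact setLIntegral_le_lintegral _ _

theorem IsWandering.tsum_defect_act_pow_le {Γ : Subgroup (SU n)} {U : Set (Cn n)} {r : ℝ}
    (hU : IsWandering Γ U) (hU_meas : MeasurableSet U) (hr : r < 1) (hUr : ∀ w ∈ U, nrm w ≤ r)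
    {z : Cn n} (hz : z ∈ ball n) :
    (∑' g : Γ, ENNReal.ofReal (((1 - r) / 4 * defect (act g.1 z) ^ 2) ^ (n + 1))) * invVol n U ≤
      volume (ball n) := by
  have hU_ball : U ⊆ ball n := fun w hw => mem_ball_iff_nrm.2 ((hUr w hw).trans_lt hr)
  have term_le (g : Γ) :
      ENNReal.ofReal (((1 - r) / 4 * defect (act g.1 z) ^ 2) ^ (n + 1)) * invVol n U ≤
        ∫⁻ w in U, ENNReal.ofReal (sechHalf (act (g⁻¹ : Γ).1 w) z ^ (2 * (n + 1))) ∂invVol n := by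
    rw [← setLIntegral_const]
    refine setLIntegral_mono_ae' hU_meas (ae_of_all _ fun w hw => ENNReal.ofReal_le_ofReal ?_)
    rw [sechHalf_comm, InvMemClass.coe_inv, ← sechHalf_act_left g.1 hz (hU_ball hw), pow_mul]
    have := sub_nonneg.2 hr.le
    gcongr
    exact defect_sq_mul_le_sechHalf_sq hr (act_mem_ball g.1 hz) (hUr w hw)
  calc _ = ∑' g : Γ, ENNReal.ofReal (((1 - r) / 4 * defect (act g.1 z) ^ 2) ^ (n + 1)) *
        invVol n U := ENNReal.tsum_mul_right.symm
    _ ≤ ∑' g : Γ, ∫⁻ w in U, ENNReal.ofReal (sechHalf (act (g⁻¹ : Γ).1 w) z ^ (2 * (n + 1)))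
        ∂invVol n := ENNReal.tsum_le_tsum term_le
    _ = ∑' g : Γ, ∫⁻ w in U, ENNReal.ofReal (sechHalf (act g.1 w) z ^ (2 * (n + 1))) ∂invVol n :=
      (Equiv.inv Γ).tsum_eq fun g : Γ =>
        ∫⁻ w in U, ENNReal.ofReal (sechHalf (act g.1 w) z ^ (2 * (n + 1))) ∂invVol n
    _ ≤ volume (ball n) := by
      rw [← lintegral_defect_pow, ← lintegral_sechHalf_pow hz]
      exact hU.tsum_setLIntegral_act_le hU_meas hU_ball _

theorem invVol_pos_of_isOpen {U : Set (Cn n)} (hU : IsOpen U) (hU_ball : U ⊆ ball n)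
    (hU_nonempty : U.Nonempty) : 0 < invVol n U := by
  rw [← setLIntegral_one, setLIntegral_invVol hU.measurableSet hU_ball, setLIntegral_pos_iff
    (measurable_invVol_density.mul_const 1), Set.inter_eq_right.2]
  · exact hU.measure_pos volume hU_nonempty
  · intro z hz
    have := defect_pos (hU_ball hz)
    simp only [Function.mem_support, mul_one, ENNReal.ofReal_eq_zero, ne_eq, not_le]
    positivity

/-- The volume argument behind the convergence of Poincaré series: the translates of a wandering
open set are disjoint, and on it `sechHalf` is comparable to `defect`. -/
theorem IsWandering.exists_sum_defect_act_pow_le {Γ : Subgroup (SU n)} {U : Set (Cn n)}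
    (hU : IsWandering Γ U) (hU_open : IsOpen U) (hU_ball : U ⊆ ball n) (hU_nonempty : U.Nonempty) :
    ∃ S : ℝ, ∀ z ∈ ball n, ∀ s : Finset Γ, ∑ g ∈ s, defect (act g.1 z) ^ (2 * (n + 1)) ≤ S := by
  obtain ⟨w, hw⟩ := hU_nonempty
  obtain ⟨r, hwr, hr⟩ := exists_between (mem_ball_iff_nrm.1 (hU_ball hw))
  have hV_open : IsOpen (U ∩ {z | nrm z < r}) :=
    hU_open.inter (isOpen_lt continuous_nrm continuous_const)
  have vol_pos := invVol_pos_of_isOpen hV_open (fun z hz => hU_ball hz.1) ⟨w, hw, hwr⟩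
  have scale_pos : 0 < ((1 - r) / 4) ^ (n + 1) := by
    have := sub_pos.2 hr
    positivity
  refine ⟨(volume (ball n) / invVol n (U ∩ {z | nrm z < r})).toReal / ((1 - r) / 4) ^ (n + 1),
    fun z hz s => ?_⟩
  have bound := (hU.mono Set.inter_subset_left).tsum_defect_act_pow_le
    hV_open.measurableSet hr (fun z hz => hz.2.le) hz
  rw [le_div_iff₀' scale_pos, Finset.mul_sum]
  refine (ENNReal.ofReal_le_iff_le_toReal
    (ENNReal.div_ne_top volume_ball_lt_top.ne vol_pos.ne')).1 ?_
  rw [ENNReal.ofReal_sum_of_nonneg fun g _ =>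
    mul_nonneg scale_pos.le (pow_nonneg (defect_nonneg _) _)]
  simp only [mul_pow, ← pow_mul] at bound
  refine (ENNReal.sum_le_tsum s).trans ?_
  rw [ENNReal.le_div_iff_mul_le (Or.inl vol_pos.ne') (Or.inr volume_ball_lt_top.ne)]
  exact bound

/-- `Γ` is of convergence type: its Poincaré series of exponent `2(n+1)` converges at the origin. -/
def IsConvergenceType (Γ : Subgroup (SU n)) : Prop :=
  Summable fun g : Γ => defect (act g.1 0) ^ (2 * (n + 1))

theorem IsWandering.isConvergenceType {Γ : Subgroup (SU n)} {U : Set (Cn n)}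
    (hU : IsWandering Γ U) (hU_open : IsOpen U) (hU_ball : U ⊆ ball n) (hU_nonempty : U.Nonempty) :
    IsConvergenceType Γ := by
  obtain ⟨S, hS⟩ := hU.exists_sum_defect_act_pow_le hU_open hU_ball hU_nonempty
  exact summable_of_sum_le (fun g => pow_nonneg (defect_nonneg _) _) (hS 0 zero_mem_ball)

theorem IsConvergenceType.countable {Γ : Subgroup (SU n)} (hΓ : IsConvergenceType Γ) :
    Countable Γ := by
  rw [← Set.countable_univ_iff]
  refine (Summable.countable_support hΓ).mono fun g _ => ?_
  exact pow_ne_zero _ (defect_pos (act_mem_ball g.1 zero_mem_ball)).ne'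

theorem dirichlet_subset_ball (Γ : Subgroup (SU n)) (p₀ : Cn n) : dirichlet Γ p₀ ⊆ ball n :=
  fun _ hz => hz.1

theorem mem_dirichlet_iff {Γ : Subgroup (SU n)} {p₀ z : Cn n} (hp₀ : p₀ ∈ ball n)
    (hz : z ∈ ball n) :
    z ∈ dirichlet Γ p₀ ↔ ∀ g ∈ Γ, g ≠ 1 → sechHalf z (act g p₀) < sechHalf z p₀ :=
  (and_iff_right hz).trans <| forall₃_congr fun g _ _ =>
    hypDist_lt_iff hz hp₀ hz (act_mem_ball g hp₀)

theorem isWandering_dirichlet (Γ : Subgroup (SU n)) {p₀ : Cn n} (hp₀ : p₀ ∈ ball n) :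
    IsWandering Γ (dirichlet Γ p₀) := by
  intro g hg hg1 z hz hgz
  have closer := (mem_dirichlet_iff hp₀ hz.1).1 hz g⁻¹ (Γ.inv_mem hg) (inv_ne_one.2 hg1)
  have closer' := (mem_dirichlet_iff hp₀ hgz.1).1 hgz g hg hg1
  rw [sechHalf_act g hz.1 hp₀, sechHalf_act_left g hz.1 hp₀] at closer'
  exact closer.asymm closer'

theorem measurableSet_dirichlet (Γ : Subgroup (SU n)) [Countable Γ] {p₀ : Cn n}
    (hp₀ : p₀ ∈ ball n) : MeasurableSet (dirichlet Γ p₀) := by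
  have eq_iInter : dirichlet Γ p₀ =
      ball n ∩ ⋂ g : Γ, ⋂ _ : g.1 ≠ 1, {z | sechHalf z (act g.1 p₀) < sechHalf z p₀} := by
    ext z
    by_cases hz : z ∈ ball n
    · simp [mem_dirichlet_iff hp₀ hz, hz]
    · simp [dirichlet, hz]
  rw [eq_iInter]
  exact measurableSet_ball.inter <| MeasurableSet.iInter fun g => MeasurableSet.iInter fun _ =>
    measurableSet_lt (measurable_sechHalf _) (measurable_sechHalf _)

/-! ### The Bergman kernel and its normalising constant -/

/-- The constant `n!/πⁿ` of the Bergman kernel. -/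
def kappa (n : ℕ) : ℝ := n.factorial / Real.pi ^ n

theorem kappa_pos (n : ℕ) : 0 < kappa n := by
  have := Real.pi_pos
  unfold kappa
  positivity

theorem kernel_eq (z w : Cn n) : kernel z w = kappa n * ((-herm z w) ^ (n + 1))⁻¹ := by
  simp [kernel, kappa]

theorem kernel_self {z : Cn n} (hz : z ∈ ball n) :
    kernel z z = ((kappa n * (defect z ^ (2 * (n + 1)))⁻¹ : ℝ) : ℂ) := by
  rw [kernel_eq, herm_self, pow_mul, defect_sq hz, ← Complex.ofReal_neg, neg_sub]
  push_cast
  rfl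

/-- The Euclidean integral of `(1 - |z|²)^((n+1)l)`, which normalises the kernel of weight
`k = l + 1`. -/
def weightedVol (n l : ℕ) : ℝ := ∫ z in ball n, defect z ^ (2 * ((n + 1) * l))

theorem integrableOn_defect_pow (N : ℕ) : IntegrableOn (fun z : Cn n => defect z ^ N) (ball n) :=
  Measure.integrableOn_of_bounded (M := 1) volume_ball_lt_top.ne
    (continuous_defect.pow N).aestronglyMeasurable <| ae_of_all _ fun z => by
      rw [norm_pow, Real.norm_of_nonneg (defect_nonneg z)]
      exact pow_le_one₀ (defect_nonneg z) (defect_le_one z)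

theorem ofReal_weightedVol (n l : ℕ) : ENNReal.ofReal (weightedVol n l) =
    ∫⁻ z, ENNReal.ofReal (defect z ^ (2 * ((n + 1) * (l + 1)))) ∂invVol n := by
  rw [weightedVol, ofReal_integral_eq_lintegral_ofReal (integrableOn_defect_pow _)
    (ae_of_all _ fun z => pow_nonneg (defect_nonneg z) _), lintegral_invVol]
  refine setLIntegral_congr_fun measurableSet_ball fun z hz => ?_
  have := defect_pos hz
  rw [← ENNReal.ofReal_mul (by positivity)]
  congr 1
  field_simp
  ring

theorem kernelConst_eq (n l : ℕ) :
    kernelConst n (l + 1) = (((kappa n * weightedVol n l)⁻¹ : ℝ) : ℂ) := by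
  have kappa_ne : (kappa n : ℂ) ≠ 0 := by exact_mod_cast (kappa_pos n).ne'
  have kernel_zero_left (w : Cn n) : kernel 0 w = kappa n := by simp [kernel_eq, herm_zero_left]
  have kernel_zero_right (w : Cn n) : kernel w 0 = kappa n := by simp [kernel_eq, herm_zero_right]
  have integral_eq : ∫ w in ball n, kernel 0 w ^ (l + 1) * kernel w 0 ^ (l + 1) *
      (kernel w w ^ (l + 1))⁻¹ * kernel w w = ((kappa n ^ (l + 2) * weightedVol n l : ℝ) : ℂ) := by
    rw [weightedVol, ← integral_const_mul, ← integral_complex_ofReal]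
    refine setIntegral_congr_fun measurableSet_ball fun w hw => ?_
    have defect_pow_ne : (defect w : ℂ) ^ (2 * (n + 1)) ≠ 0 := by
      exact_mod_cast (pow_pos (defect_pos hw) _).ne'
    rw [kernel_zero_left, kernel_zero_right, kernel_self hw, ← mul_assoc 2 (n + 1), pow_mul _ _ l]
    push_cast
    rw [mul_pow, inv_pow]
    field_simp
    ring
  rw [kernelConst, integral_eq, kernel_zero_left]
  push_cast
  rw [mul_inv, pow_succ (kappa n : ℂ) (l + 1)]
  field_simp

theorem volume_real_metricBall_zero {r : ℝ} (hr : 0 < r) :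
    volume.real (Metric.ball (0 : Cn n) r) = (Real.pi * r ^ 2) ^ n := by
  rw [Measure.real, volume_pi_ball _ hr]
  simp [Complex.volume_ball, hr.le, mul_comm]

theorem nsq_le_of_mem_metricBall {r : ℝ} {z : Cn n} (hz : z ∈ Metric.ball (0 : Cn n) r) :
    nsq z ≤ n * r ^ 2 := by
  calc nsq z ≤ ∑ _i : Fin n, r ^ 2 := Finset.sum_le_sum fun i _ =>
        pow_le_pow_left₀ (norm_nonneg _)
          ((norm_le_pi_norm z i).trans (mem_ball_zero_iff.1 hz).le) 2
    _ = n * r ^ 2 := by simp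

theorem half_le_defect_pow {z : Cn n} (hz : z ∈ ball n) {M : ℕ} (h : M * nsq z ≤ 1 / 2) :
    1 / 2 ≤ defect z ^ (2 * M) := by
  have bernoulli : 1 + M * (-nsq z) ≤ (1 + -nsq z) ^ M :=
    one_add_mul_le_pow (by linarith [mem_ball_iff.1 hz]) M
  rw [pow_mul, defect_sq hz, sub_eq_add_neg]
  linarith

/-- On the polydisc of radius `r` with `r² = 1 / (2(n+1)²(l+1))` the weight is at least `1/2`. -/
theorem le_weightedVol (n l : ℕ) :
    (Real.pi / (2 * (n + 1) ^ 2 * (l + 1))) ^ n / 2 ≤ weightedVol n l := by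
  set r : ℝ := Real.sqrt (1 / (2 * (n + 1) ^ 2 * (l + 1)))
  have r_pos : 0 < r := by positivity
  have r_sq : r ^ 2 = 1 / (2 * (n + 1) ^ 2 * (l + 1)) := Real.sq_sqrt (by positivity)
  have weight_mul_nsq_le {z : Cn n} (hz : z ∈ Metric.ball (0 : Cn n) r) :
      ((n + 1) * (l + 1)) * nsq z ≤ 1 / 2 := by
    calc ((n + 1) * (l + 1)) * nsq z ≤ ((n + 1) * (l + 1)) * ((n + 1) * r ^ 2) := by
          gcongr
          nlinarith [nsq_le_of_mem_metricBall hz, sq_nonneg r]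
      _ = 1 / 2 := by rw [r_sq]; field_simp
  have polydisc_subset : Metric.ball (0 : Cn n) r ⊆ ball n := fun z hz => by
    have one_le : (1 : ℝ) ≤ (n + 1) * (l + 1) := by exact_mod_cast Nat.succ_le_of_lt (by positivity)
    rw [mem_ball_iff]
    nlinarith [weight_mul_nsq_le hz, nsq_nonneg z]
  calc (Real.pi / (2 * (n + 1) ^ 2 * (l + 1))) ^ n / 2
      = ∫ _ in Metric.ball (0 : Cn n) r, (1 / 2 : ℝ) := by
        rw [setIntegral_const, volume_real_metricBall_zero r_pos, r_sq, smul_eq_mul]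
        ring
    _ ≤ ∫ z in Metric.ball (0 : Cn n) r, defect z ^ (2 * ((n + 1) * l)) :=
        setIntegral_mono_on (integrableOn_const measure_ball_lt_top.ne)
          ((integrableOn_defect_pow _).mono_set polydisc_subset) Metric.isOpen_ball.measurableSet
          fun z hz => half_le_defect_pow (polydisc_subset hz) <| by
            push_cast
            nlinarith [weight_mul_nsq_le hz, nsq_nonneg z]
    _ ≤ weightedVol n l := setIntegral_mono_set (integrableOn_defect_pow _)
        (ae_of_all _ fun z => pow_nonneg (defect_nonneg z) _) polydisc_subset.eventuallyLE

theorem weightedVol_pos (n l : ℕ) : 0 < weightedVol n l :=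
  lt_of_lt_of_le (by positivity) (le_weightedVol n l)

/-! ### Holomorphic sums and integrals -/

section Holomorphic

variable {E F : Type*} [NormedAddCommGroup E] [NormedSpace ℂ E] [NormedAddCommGroup F]
  [NormedSpace ℂ F]

theorem norm_fderiv_le_of_norm_le_on_ball {f : E → F} {x y : E} {ε C : ℝ} (hε : 0 < ε)
    (hf : DifferentiableOn ℂ f (Metric.ball x ε)) (hC : ∀ w ∈ Metric.ball x ε, ‖f w‖ ≤ C)
    (hy : y ∈ Metric.ball x (ε / 2)) : ‖fderiv ℂ f y‖ ≤ 2 * C / (ε / 2) := by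
  have sub_ball : Metric.ball y (ε / 2) ⊆ Metric.ball x ε :=
    Metric.ball_subset_ball' (by linarith [Metric.mem_ball.1 hy])
  refine Complex.norm_fderiv_le_div_of_mapsTo_ball (hf.mono sub_ball) (fun w hw => ?_) (half_pos hε)
  rw [mem_closedBall_iff_norm]
  linarith [norm_sub_le (f w) (f y), hC w (sub_ball hw),
    hC y (sub_ball (Metric.mem_ball_self (half_pos hε)))]

theorem differentiableOn_tsum_of_locally_bounded {ι : Type*} [CompleteSpace F] {f : ι → E → F}
    {U : Set E} (hU : IsOpen U) (hf : ∀ i, DifferentiableOn ℂ (f i) U)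
    (h_bound : ∀ x ∈ U, ∃ V ∈ 𝓝 x, ∃ u : ι → ℝ, Summable u ∧ ∀ i, ∀ y ∈ V, ‖f i y‖ ≤ u i) :
    DifferentiableOn ℂ (fun x => ∑' i, f i x) U := by
  intro x hx
  obtain ⟨V, hV, u, hu, hfu⟩ := h_bound x hx
  obtain ⟨ε, hε, hball⟩ := Metric.mem_nhds_iff.1 (inter_mem (hU.mem_nhds hx) hV)
  have half_ball : Metric.ball x (ε / 2) ⊆ Metric.ball x ε := Metric.ball_subset_ball (by linarith)
  have mem_half_ball : x ∈ Metric.ball x (ε / 2) := Metric.mem_ball_self (half_pos hε)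
  let _ : NormedSpace ℝ E := NormedSpace.restrictScalars ℝ ℂ E
  exact (hasFDerivAt_tsum_of_isPreconnected (f := f) (f' := fun i => fderiv ℂ (f i))
    ((hu.mul_left 2).div_const (ε / 2)) Metric.isOpen_ball
    (convex_ball x (ε / 2)).isPreconnected
    (fun i y hy => ((hf i).differentiableAt
      (hU.mem_nhds (hball (half_ball hy)).1)).hasFDerivAt)
    (fun i y hy => norm_fderiv_le_of_norm_le_on_ball hε
      ((hf i).mono fun w hw => (hball hw).1) (fun w hw => hfu i w (hball hw).2) hy)
    mem_half_ball (Summable.of_norm_bounded hu fun i => hfu i x (mem_of_mem_nhds hV))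
    mem_half_ball).differentiableAt.differentiableWithinAt

variable {ι X : Type*} [Finite ι] {mX : MeasurableSpace X} {μ : Measure X}

theorem aestronglyMeasurable_of_apply_single [DecidableEq ι] {L : X → (ι → ℂ) →L[ℂ] F}
    (hL : ∀ i, AEStronglyMeasurable (fun a => L a (Pi.single i 1)) μ) :
    AEStronglyMeasurable L μ := by
  cases nonempty_fintype ι
  have L_eq : L = fun a => ∑ i, ContinuousLinearMap.smulRightL ℂ (ι → ℂ) F
      (ContinuousLinearMap.proj i) (L a (Pi.single i 1)) := by
    ext a v
    conv_lhs => rw [pi_eq_sum_univ' v, map_sum]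
    simp
  rw [L_eq]
  refine Finset.aestronglyMeasurable_fun_sum _ fun i _ => ?_
  exact ((ContinuousLinearMap.smulRightL ℂ (ι → ℂ) F _).continuous).comp_aestronglyMeasurable (hL i)

theorem aestronglyMeasurable_fderiv_param {f : (ι → ℂ) → X → F} {z : ι → ℂ}
    (hf_meas : ∀ᶠ w in 𝓝 z, AEStronglyMeasurable (f w) μ)
    (hf : ∀ᵐ a ∂μ, DifferentiableAt ℂ (fun w => f w a) z) :
    AEStronglyMeasurable (fun a => fderiv ℂ (fun w => f w a) z) μ := by
  classical
  cases nonempty_fintype ι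
  refine aestronglyMeasurable_of_apply_single fun i => ?_
  have scale_atTop : Tendsto (fun N : ℕ => ‖(N : ℂ)‖) atTop atTop := by
    simpa using tendsto_natCast_atTop_atTop
  have points_tendsto :
      Tendsto (fun N : ℕ => z + (N : ℂ)⁻¹ • (Pi.single i 1 : ι → ℂ)) atTop (𝓝 z) := by
    simpa using tendsto_const_nhds.add
      ((tendsto_inv₀_cobounded.comp (tendsto_norm_atTop_iff_cobounded.1 scale_atTop)).smul_const
        (Pi.single i 1 : ι → ℂ))
  obtain ⟨N₀, hN₀⟩ := eventually_atTop.1 (points_tendsto.eventually hf_meas)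
  refine aestronglyMeasurable_of_tendsto_ae atTop (f := fun N a => ((N + N₀ : ℕ) : ℂ) •
    (f (z + ((N + N₀ : ℕ) : ℂ)⁻¹ • Pi.single i 1) a - f z a)) (fun N => ?_) ?_
  · exact ((hN₀ _ le_add_self).sub hf_meas.self_of_nhds).const_smul _
  · filter_upwards [hf] with a ha
    exact ha.hasFDerivAt.lim _ (scale_atTop.comp (tendsto_add_atTop_nat N₀))

theorem differentiableOn_integral_of_locally_bounded [IsFiniteMeasure μ]
    {f : (ι → ℂ) → X → F} {U : Set (ι → ℂ)} (hU : IsOpen U)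
    (hf_meas : ∀ z ∈ U, AEStronglyMeasurable (f z) μ)
    (hf : ∀ᵐ a ∂μ, DifferentiableOn ℂ (fun z => f z a) U)
    (h_bound : ∀ z ∈ U, ∃ V ∈ 𝓝 z, ∃ C : ℝ, ∀ᵐ a ∂μ, ∀ w ∈ V, ‖f w a‖ ≤ C) :
    DifferentiableOn ℂ (fun z => ∫ a, f z a ∂μ) U := by
  cases nonempty_fintype ι
  intro z hz
  obtain ⟨V, hV, C, hC⟩ := h_bound z hz
  obtain ⟨ε, hε, hball⟩ := Metric.mem_nhds_iff.1 (inter_mem (hU.mem_nhds hz) hV)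
  have half_ball : Metric.ball z (ε / 2) ⊆ Metric.ball z ε := Metric.ball_subset_ball (by linarith)
  have meas_near : ∀ᶠ w in 𝓝 z, AEStronglyMeasurable (f w) μ :=
    eventually_of_mem (hU.mem_nhds hz) hf_meas
  exact (hasFDerivAt_integral_of_dominated_of_fderiv_le (𝕜 := ℂ)
    (F' := fun w a => fderiv ℂ (fun z => f z a) w) (bound := fun _ => 2 * C / (ε / 2))
    (Metric.ball_mem_nhds z (half_pos hε)) meas_near
    (.of_bound (hf_meas z hz) C (hC.mono fun a ha => ha z (mem_of_mem_nhds hV)))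
    (aestronglyMeasurable_fderiv_param meas_near
      (hf.mono fun a ha => ha.differentiableAt (hU.mem_nhds hz)))
    (by
      filter_upwards [hf, hC] with a ha haC w hw
      exact norm_fderiv_le_of_norm_le_on_ball hε (ha.mono fun v hv => (hball hv).1)
        (fun v hv => haC v (hball hv).2) hw)
    (integrable_const _)
    (by
      filter_upwards [hf] with a ha w hw
      exact (ha.differentiableAt (hU.mem_nhds (hball (half_ball hw)).1)).hasFDerivAt)
    ).differentiableAt.differentiableWithinAt

end Holomorphic

/-! ### Poincaré series -/

/-- The `g`-th term `(-⟨gz, p⟩)^{-N} J(g, z)^{N/(n+1)}` of the Poincaré series of weight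
`k = N/(n+1)`, normalised to have modulus `(sechHalf (gz) p / defect z)^N`. -/
def peak (N : ℕ) (p : Cn n) (g : SU n) (z : Cn n) : ℂ :=
  (defect p / (den g z * -herm (act g z) p)) ^ N

theorem norm_peak_mul_defect_pow (N : ℕ) (p : Cn n) (g : SU n) {z : Cn n} (hz : z ∈ ball n) :
    ‖peak N p g z‖ * defect z ^ N = sechHalf (act g z) p ^ N := by
  rw [peak, norm_pow, ← mul_pow, norm_div, norm_mul, norm_neg, Complex.norm_real,
    Real.norm_of_nonneg (defect_nonneg p), sechHalf, defect_act g hz]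
  congr 1
  ring

theorem den_mul_neg_herm_act_ne_zero (g : SU n) {z p : Cn n} (hz : z ∈ ball n) (hp : p ∈ ball n) :
    den g z * -herm (act g z) p ≠ 0 :=
  mul_ne_zero (den_ne_zero g hz) (neg_ne_zero.2 (herm_ne_zero (act_mem_ball g hz) hp))

theorem differentiableOn_peak (N : ℕ) {p : Cn n} (hp : p ∈ ball n) (g : SU n) :
    DifferentiableOn ℂ (peak N p g) (ball n) := by
  have differentiableOn_denominator :
      DifferentiableOn ℂ (fun z => den g z * -herm (act g z) p) (ball n) :=
    (differentiable_den g).differentiableOn.mul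
      ((differentiable_herm_left p).comp_differentiableOn (differentiableOn_act g)).neg
  unfold peak
  simp only [div_eq_mul_inv]
  exact ((differentiableOn_denominator.fun_inv fun z hz =>
    den_mul_neg_herm_act_ne_zero g hz hp).const_mul _).fun_pow N

theorem continuousOn_peak (N : ℕ) (g : SU n) {z : Cn n} (hz : z ∈ ball n) :
    ContinuousOn (fun p => peak N p g z) (ball n) := by
  refine ((Complex.continuous_ofReal.comp continuous_defect).continuousOn.div ?_ fun p hp =>
    den_mul_neg_herm_act_ne_zero g hz hp).pow N
  exact (continuous_const.mul
    (continuous_herm.comp (continuous_const.prodMk continuous_id)).neg).continuousOn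

theorem peak_act (N : ℕ) (p : Cn n) (g h : SU n) {z : Cn n} (hz : z ∈ ball n) :
    peak N p g (act h z) = den h z ^ N * peak N p (g * h) z := by
  have := den_ne_zero h hz
  rw [peak, peak, den_mul g h hz, act_mul g h hz, ← mul_pow]
  congr 1
  field_simp

theorem defect_act_le {R : ℝ} (hR : R < 1) (g : SU n) {z : Cn n} (hz : nrm z ≤ R) :
    defect (act g z) ≤ defect (act g 0) / (1 - R) := by
  have hz_ball : z ∈ ball n := mem_ball_iff_nrm.2 (hz.trans_lt hR)
  have den_le : ‖den g 0‖ * (1 - R) ≤ ‖den g z‖ :=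
    (norm_den_zero_mul_le g z).trans' (by gcongr)
  have den_zero_pos : 0 < ‖den g 0‖ := zero_lt_one.trans_le (one_le_norm_den_zero g)
  have : 0 < 1 - R := sub_pos.2 hR
  rw [defect_act g hz_ball, defect_act g zero_mem_ball, defect, defect, nsq_zero, div_div]
  gcongr
  simpa using nsq_nonneg z

theorem one_sub_le_defect {R : ℝ} (hR : R < 1) {z : Cn n} (hz : nrm z ≤ R) :
    1 - R ≤ defect z := by
  have := nrm_nonneg z
  refine Real.le_sqrt_of_sq_le ?_
  rw [← nrm_sq]
  nlinarith

theorem sechHalf_pow_le {N : ℕ} (hN : 2 * (n + 1) ≤ N) {z p : Cn n} {r : ℝ} (hr : r < 1)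
    (hz : z ∈ ball n) (hp : nrm p ≤ r) :
    sechHalf z p ^ N ≤ (2 / (1 - r)) ^ (n + 1) * defect z ^ (2 * (n + 1)) :=
  calc sechHalf z p ^ N ≤ sechHalf z p ^ (2 * (n + 1)) :=
        pow_le_pow_of_le_one (sechHalf_nonneg z p)
          (sechHalf_le_one hz (mem_ball_iff_nrm.2 (hp.trans_lt hr))) hN
    _ ≤ (2 / (1 - r) * defect z ^ 2) ^ (n + 1) := by
        rw [pow_mul]
        gcongr
        exact sechHalf_sq_le hr hz hp
    _ = (2 / (1 - r)) ^ (n + 1) * defect z ^ (2 * (n + 1)) := by rw [mul_pow, pow_mul]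

theorem exists_norm_peak_le {N : ℕ} (hN : 2 * (n + 1) ≤ N) {r R : ℝ} (hr : r < 1) (hR : R < 1) :
    ∃ C : ℝ, ∀ p : Cn n, nrm p ≤ r → ∀ z : Cn n, nrm z ≤ R → ∀ g : SU n,
      ‖peak N p g z‖ ≤ C * defect (act g 0) ^ (2 * (n + 1)) := by
  refine ⟨(2 / (1 - r)) ^ (n + 1) / (1 - R) ^ (2 * (n + 1)) / (1 - R) ^ N, fun p hp z hz g => ?_⟩
  have hz_ball : z ∈ ball n := mem_ball_iff_nrm.2 (hz.trans_lt hR)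
  have : 0 < 1 - R := sub_pos.2 hR
  have : 0 < 1 - r := sub_pos.2 hr
  rw [div_mul_eq_mul_div, le_div_iff₀ (by positivity)]
  calc ‖peak N p g z‖ * (1 - R) ^ N ≤ ‖peak N p g z‖ * defect z ^ N := by
        gcongr
        exact one_sub_le_defect hR hz
    _ = sechHalf (act g z) p ^ N := norm_peak_mul_defect_pow N p g hz_ball
    _ ≤ (2 / (1 - r)) ^ (n + 1) * defect (act g z) ^ (2 * (n + 1)) :=
        sechHalf_pow_le hN hr (act_mem_ball g hz_ball) hp
    _ ≤ (2 / (1 - r)) ^ (n + 1) * (defect (act g 0) / (1 - R)) ^ (2 * (n + 1)) := by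
        gcongr
        · exact defect_nonneg _
        · exact defect_act_le hR g hz
    _ = (2 / (1 - r)) ^ (n + 1) / (1 - R) ^ (2 * (n + 1)) * defect (act g 0) ^ (2 * (n + 1)) := by
        rw [div_pow (defect _), mul_div_assoc', div_mul_eq_mul_div]

theorem integrable_peak {ν : Measure (Cn n)} [IsFiniteMeasure ν] {r : ℝ}
    (hν : ∀ᵐ p ∂ν, nrm p ≤ r) (hr : r < 1) {N : ℕ} (hN : 2 * (n + 1) ≤ N) (g : SU n) {z : Cn n}
    (hz : z ∈ ball n) : Integrable (fun p => peak N p g z) ν := by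
  obtain ⟨C, hC⟩ := exists_norm_peak_le hN hr (mem_ball_iff_nrm.1 hz)
  refine .of_bound ?_ (C * defect (act g 0) ^ (2 * (n + 1)))
    (hν.mono fun p hp => hC p hp z le_rfl g)
  rw [← Measure.restrict_eq_self_of_ae_mem hν]
  exact ((continuousOn_peak N g hz).mono fun p (hp : nrm p ≤ r) =>
    mem_ball_iff_nrm.2 (hp.trans_lt hr))
    |>.aestronglyMeasurable (isCompact_nrm_le r).isClosed.measurableSet

section ThetaSeries

variable {m : ℕ} {Γ : Subgroup (SU n)} (ρ : Γ →* unitaryGroup (Fin m) ℂ) (j : Fin m)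

/-- The vector `ρ(g⁻¹) e_j`. -/
def repColumn (g : Γ) : Fin m → ℂ := (ρ g⁻¹).1 *ᵥ Pi.single j 1

theorem norm_repColumn_le (g : Γ) : ‖repColumn ρ j g‖ ≤ 1 :=
  (pi_norm_le_iff_of_nonneg zero_le_one).2 fun i => by
    simpa [repColumn] using entry_norm_bound_of_unitary (ρ g⁻¹).2 i j

theorem repColumn_one : repColumn ρ j 1 = Pi.single j 1 := by
  rw [repColumn, inv_one, map_one, OneMemClass.coe_one, one_mulVec]

theorem mulVec_repColumn_mul (g h : Γ) :
    (ρ h).1 *ᵥ repColumn ρ j (g * h) = repColumn ρ j g := by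
  rw [repColumn, repColumn, mulVec_mulVec, ← Submonoid.coe_mul, ← map_mul, _root_.mul_inv_rev,
    mul_inv_cancel_left]

/-- The function `Θ_p^{(j;k)} K(p,p)^{-k/2}`, with `N = (n+1)k`, up to a constant depending on `n`
and `k` only. -/
def thetaSeries (N : ℕ) (z p : Cn n) : Fin m → ℂ := ∑' g : Γ, peak N p g.1 z • repColumn ρ j g

theorem norm_peak_smul_repColumn_le (N : ℕ) (z p : Cn n) (g : Γ) :
    ‖peak N p g.1 z • repColumn ρ j g‖ ≤ ‖peak N p g.1 z‖ := by
  rw [norm_smul]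
  exact mul_le_of_le_one_right (norm_nonneg _) (norm_repColumn_le ρ j g)

variable {ρ j}

theorem thetaSeries_act (N : ℕ) (h : Γ) {z : Cn n} (hz : z ∈ ball n) (p : Cn n) :
    thetaSeries ρ j N (act h.1 z) p = den h.1 z ^ N • (ρ h).1 *ᵥ thetaSeries ρ j N z p := by
  let rotate : (Fin m → ℂ) ≃L[ℂ] (Fin m → ℂ) :=
    (Matrix.UnitaryGroup.toLinearEquiv (ρ h)).toContinuousLinearEquiv
  have rotate_apply (v : Fin m → ℂ) : rotate v = (ρ h).1 *ᵥ v := rfl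
  rw [thetaSeries, thetaSeries, ← rotate_apply, rotate.map_tsum, ← tsum_const_smul'']
  conv_rhs => rw [← (Equiv.mulRight h).tsum_eq]
  refine tsum_congr fun g => ?_
  rw [peak_act N p g.1 h.1 hz, rotate_apply, Equiv.coe_mulRight, mulVec_smul,
    mulVec_repColumn_mul, smul_smul]
  rfl

variable {N : ℕ} {r : ℝ}

theorem exists_norm_peak_smul_le_on_nhds (hN : 2 * (n + 1) ≤ N) (hr : r < 1) {z : Cn n}
    (hz : z ∈ ball n) : ∃ V ∈ 𝓝 z, ∃ C : ℝ, ∀ p : Cn n, nrm p ≤ r → ∀ w ∈ V, ∀ g : Γ,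
      ‖peak N p g.1 w • repColumn ρ j g‖ ≤ C * defect (act g.1 0) ^ (2 * (n + 1)) := by
  obtain ⟨R, hzR, hR⟩ := exists_between (mem_ball_iff_nrm.1 hz)
  obtain ⟨C, hC⟩ := exists_norm_peak_le (n := n) hN hr hR
  exact ⟨{w | nrm w < R}, (isOpen_lt continuous_nrm continuous_const).mem_nhds hzR, C,
    fun p hp w hw g => (norm_peak_smul_repColumn_le ρ j N w p g).trans (hC p hp w hw.le g)⟩

variable (hΓ : IsConvergenceType Γ)
include hΓ

theorem summable_peak_smul (hN : 2 * (n + 1) ≤ N) {z p : Cn n} (hz : z ∈ ball n)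
    (hp : p ∈ ball n) : Summable fun g : Γ => peak N p g.1 z • repColumn ρ j g := by
  obtain ⟨V, hV, C, hC⟩ := exists_norm_peak_smul_le_on_nhds hN (mem_ball_iff_nrm.1 hp) hz
    (ρ := ρ) (j := j)
  exact .of_norm_bounded (hΓ.mul_left C) (hC p le_rfl z (mem_of_mem_nhds hV))

theorem differentiableOn_thetaSeries (hN : 2 * (n + 1) ≤ N) {p : Cn n} (hp : p ∈ ball n) :
    DifferentiableOn ℂ (fun z => thetaSeries ρ j N z p) (ball n) := by
  refine differentiableOn_tsum_of_locally_bounded isOpen_ball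
    (fun g => (differentiableOn_peak N hp g.1).smul_const _) fun z hz => ?_
  obtain ⟨V, hV, C, hC⟩ := exists_norm_peak_smul_le_on_nhds hN (mem_ball_iff_nrm.1 hp) hz
    (ρ := ρ) (j := j)
  exact ⟨V, hV, _, hΓ.mul_left C, fun g w hw => hC p le_rfl w hw g⟩

theorem exists_norm_thetaSeries_le_on_nhds (hN : 2 * (n + 1) ≤ N) (hr : r < 1) {z : Cn n}
    (hz : z ∈ ball n) : ∃ V ∈ 𝓝 z, ∃ C : ℝ, ∀ p : Cn n, nrm p ≤ r → ∀ w ∈ V,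
      ‖thetaSeries ρ j N w p‖ ≤ C := by
  obtain ⟨V, hV, C, hC⟩ := exists_norm_peak_smul_le_on_nhds hN hr hz (ρ := ρ) (j := j)
  exact ⟨V, hV, _, fun p hp w hw =>
    tsum_of_norm_bounded (hΓ.mul_left C).hasSum (hC p hp w hw)⟩

theorem continuousOn_thetaSeries (hN : 2 * (n + 1) ≤ N) (hr : r < 1) {z : Cn n}
    (hz : z ∈ ball n) : ContinuousOn (thetaSeries ρ j N z) {p | nrm p ≤ r} := by
  obtain ⟨V, hV, C, hC⟩ := exists_norm_peak_smul_le_on_nhds hN hr hz (ρ := ρ) (j := j)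
  refine continuousOn_tsum (fun g => ?_) (hΓ.mul_left C)
    fun g p hp => hC p hp z (mem_of_mem_nhds hV) g
  exact ((continuousOn_peak N g.1 hz).mono fun p hp =>
    mem_ball_iff_nrm.2 (hp.trans_lt hr)).smul continuousOn_const

variable {ν : Measure (Cn n)} (hν : ∀ᵐ p ∂ν, nrm p ≤ r)
include hν

theorem aestronglyMeasurable_thetaSeries (hN : 2 * (n + 1) ≤ N) (hr : r < 1) {z : Cn n}
    (hz : z ∈ ball n) : AEStronglyMeasurable (thetaSeries ρ j N z) ν := by
  rw [← Measure.restrict_eq_self_of_ae_mem hν]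
  exact (continuousOn_thetaSeries hΓ hN hr hz).aestronglyMeasurable
    (isCompact_nrm_le r).isClosed.measurableSet

variable [IsFiniteMeasure ν]

theorem integrable_thetaSeries (hN : 2 * (n + 1) ≤ N) (hr : r < 1) {z : Cn n}
    (hz : z ∈ ball n) : Integrable (thetaSeries ρ j N z) ν := by
  obtain ⟨V, hV, C, hC⟩ := exists_norm_thetaSeries_le_on_nhds hΓ hN hr hz (ρ := ρ) (j := j)
  exact .of_bound (aestronglyMeasurable_thetaSeries hΓ hν hN hr hz) C
    (hν.mono fun p hp => hC p hp z (mem_of_mem_nhds hV))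

theorem differentiableOn_integral_thetaSeries (hN : 2 * (n + 1) ≤ N) (hr : r < 1) :
    DifferentiableOn ℂ (fun z => ∫ p, thetaSeries ρ j N z p ∂ν) (ball n) := by
  refine differentiableOn_integral_of_locally_bounded isOpen_ball
    (fun z hz => aestronglyMeasurable_thetaSeries hΓ hν hN hr hz)
    (hν.mono fun p hp =>
      differentiableOn_thetaSeries hΓ hN (mem_ball_iff_nrm.2 (hp.trans_lt hr))) fun z hz => ?_
  obtain ⟨V, hV, C, hC⟩ := exists_norm_thetaSeries_le_on_nhds hΓ hN hr hz (ρ := ρ) (j := j)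
  exact ⟨V, hV, C, hν.mono hC⟩

theorem integral_thetaSeries_act (hN : 2 * (n + 1) ≤ N) (hr : r < 1) (h : Γ) {z : Cn n}
    (hz : z ∈ ball n) : ∫ p, thetaSeries ρ j N (act h.1 z) p ∂ν =
      den h.1 z ^ N • (ρ h).1 *ᵥ ∫ p, thetaSeries ρ j N z p ∂ν := by
  simp only [thetaSeries_act N h hz]
  rw [integral_smul]
  congr 1
  exact (Matrix.mulVecLin (ρ h).1).toContinuousLinearMap.integral_comp_comm
    (integrable_thetaSeries hΓ hν hN hr hz)

end ThetaSeries

/-! ### The series of the theorem -/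

section ThetaSubmanifold

variable {m : ℕ} {Γ : Subgroup (SU n)} {ρ : Γ →* unitaryGroup (Fin m) ℂ} {j : Fin m}

theorem thetaTerm_eq (k : ℕ) {z p : Cn n} (hz : z ∈ ball n) (hp : p ∈ ball n) (g : Γ) :
    thetaTerm Γ ρ j k z p g = (kappa n ^ k * (defect p ^ ((n + 1) * k))⁻¹) •
      (peak ((n + 1) * k) p g.1 z • repColumn ρ j g) := by
  have defect_ne : (defect p : ℂ) ≠ 0 := by exact_mod_cast (defect_pos hp).ne'
  have single_eq (c : ℂ) : (Pi.single j c : Fin m → ℂ) = c • Pi.single j 1 := by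
    rw [← Pi.single_smul, smul_eq_mul, mul_one]
  rw [thetaTerm, single_eq, mulVec_smul, ← repColumn, smul_smul, jac_eq g.1 hz, kernel_eq,
    ← Complex.coe_smul, smul_smul, peak]
  congr 1
  push_cast
  simp only [div_pow, mul_pow, inv_pow, ← pow_mul]
  field_simp

theorem summable_thetaTerm (hΓ : IsConvergenceType Γ) {k : ℕ} (hk : 2 ≤ k) {z p : Cn n}
    (hz : z ∈ ball n) (hp : p ∈ ball n) : Summable (thetaTerm Γ ρ j k z p) := by
  refine Summable.congr ?_ fun g => (thetaTerm_eq k hz hp g).symm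
  exact (summable_peak_smul hΓ (by nlinarith) hz hp).const_smul _

/-- The constant relating `Θ_p^{(j;k)} K(p,p)^{-k/2}`, for `k = l + 1`, to `thetaSeries`. -/
def thetaScale (n l : ℕ) : ℝ := kappa n ^ (((l : ℝ) + 1) / 2 - 1) / weightedVol n l

theorem kappa_mul_thetaScale_sq (n l : ℕ) :
    kappa n * thetaScale n l ^ 2 = kappa n ^ l / weightedVol n l ^ 2 := by
  have kappa_pos := kappa_pos n
  have rpow_sq : (kappa n ^ (((l : ℝ) + 1) / 2 - 1)) ^ 2 = kappa n ^ ((l : ℝ) - 1) := by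
    rw [← Real.rpow_natCast, ← Real.rpow_mul kappa_pos.le]
    congr 1
    push_cast
    ring
  rw [thetaScale, div_pow, rpow_sq, Real.rpow_sub_one kappa_pos.ne', Real.rpow_natCast]
  field_simp

theorem re_kernel_self_rpow (k : ℕ) {p : Cn n} (hp : p ∈ ball n) :
    (kernel p p).re ^ (-(k : ℝ) / 2) = kappa n ^ (-(k : ℝ) / 2) * defect p ^ ((n + 1) * k) := by
  have defect_pos := defect_pos hp
  rw [kernel_self hp, Complex.ofReal_re, Real.mul_rpow (kappa_pos n).le (by positivity),
    ← Real.rpow_natCast, ← Real.rpow_natCast, ← Real.rpow_neg defect_pos.le,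
    ← Real.rpow_mul defect_pos.le]
  congr 2
  push_cast
  ring

theorem thetaIntegrand_eq (l : ℕ) {z p : Cn n} (hz : z ∈ ball n) (hp : p ∈ ball n) :
    thetaIntegrand Γ ρ j (l + 1) z p =
      thetaScale n l • thetaSeries ρ j ((n + 1) * (l + 1)) z p := by
  have kappa_pos := kappa_pos n
  have defect_pos := defect_pos hp
  have weightedVol_pos := weightedVol_pos n l
  rw [thetaIntegrand, thetaPoint, kernelConst_eq, re_kernel_self_rpow _ hp, Complex.coe_smul]
  simp only [thetaTerm_eq _ hz hp]
  rw [tsum_const_smul'', ← thetaSeries, smul_smul, smul_smul]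
  congr 1
  have rpow_eq : kappa n ^ (((l : ℝ) + 1) / 2 - 1) =
      kappa n ^ (-((l : ℝ) + 1) / 2) * kappa n ^ (l + 1) / kappa n := by
    rw [← Real.rpow_natCast, ← Real.rpow_add kappa_pos, ← Real.rpow_sub_one kappa_pos.ne']
    congr 1
    push_cast
    ring
  rw [thetaScale, rpow_eq]
  push_cast
  field_simp

variable {r : ℝ} {ν : Measure (Cn n)}

theorem thetaSub_eq (hr : r < 1) (hν : ∀ᵐ p ∂ν, nrm p ≤ r) (l : ℕ) {z : Cn n}
    (hz : z ∈ ball n) : thetaSub Γ ρ j (l + 1) ν z =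
      thetaScale n l • ∫ p, thetaSeries ρ j ((n + 1) * (l + 1)) z p ∂ν := by
  rw [thetaSub, ← integral_smul]
  exact integral_congr_ae <| hν.mono fun p hp =>
    thetaIntegrand_eq l hz (mem_ball_iff_nrm.2 (hp.trans_lt hr))

theorem innerDensity_thetaSub (hr : r < 1) (hν : ∀ᵐ p ∂ν, nrm p ≤ r) (l : ℕ) {z : Cn n}
    (hz : z ∈ ball n) :
    innerDensity (l + 1) (thetaSub Γ ρ j (l + 1) ν) (thetaSub Γ ρ j (l + 1) ν) z =
      (((kappa n * weightedVol n l ^ 2)⁻¹ * ((defect z ^ (2 * (n + 1)))⁻¹ *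
        (nsq (∫ p, thetaSeries ρ j ((n + 1) * (l + 1)) z p ∂ν) *
          defect z ^ (2 * ((n + 1) * (l + 1))))) : ℝ) : ℂ) := by
  have kappa_pos := kappa_pos n
  have defect_pos := defect_pos hz
  have weightedVol_pos := weightedVol_pos n l
  rw [innerDensity, sum_mul_conj_self, kernel_self hz, thetaSub_eq hr hν l hz]
  norm_cast
  have nsq_smul_eq (c : ℝ) (v : Cn m) : nsq (c • v) = c ^ 2 * nsq v := by
    rw [← Complex.coe_smul, nsq_smul, Complex.norm_real, Real.norm_eq_abs, sq_abs]
  have scale_eq : thetaScale n l ^ 2 = kappa n ^ l / weightedVol n l ^ 2 / kappa n := by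
    rw [← kappa_mul_thetaScale_sq, mul_div_cancel_left₀ _ kappa_pos.ne']
  rw [nsq_smul_eq, scale_eq, mul_pow, inv_pow, ← pow_mul, ← mul_assoc 2]
  field_simp
  ring

variable [IsFiniteMeasure ν]

theorem integrable_thetaIntegrand (hΓ : IsConvergenceType Γ) (hr : r < 1)
    (hν : ∀ᵐ p ∂ν, nrm p ≤ r) {l : ℕ} (hl : 1 ≤ l) {z : Cn n} (hz : z ∈ ball n) :
    Integrable (thetaIntegrand Γ ρ j (l + 1) z) ν := by
  have weight_le : 2 * (n + 1) ≤ (n + 1) * (l + 1) := by nlinarith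
  refine (integrable_congr ?_).1
    ((integrable_thetaSeries (ρ := ρ) (j := j) hΓ hν weight_le hr hz).smul (thetaScale n l))
  exact hν.mono fun p hp =>
    (thetaIntegrand_eq l hz (mem_ball_iff_nrm.2 (hp.trans_lt hr))).symm

theorem isAutomorphicForm_thetaSub (hΓ : IsConvergenceType Γ) (hr : r < 1)
    (hν : ∀ᵐ p ∂ν, nrm p ≤ r) {l : ℕ} (hl : 1 ≤ l) :
    IsAutomorphicForm Γ ρ (l + 1) (thetaSub Γ ρ j (l + 1) ν) := by
  have weight_le : 2 * (n + 1) ≤ (n + 1) * (l + 1) := by nlinarith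
  refine ⟨((differentiableOn_integral_thetaSeries hΓ hν weight_le hr).const_smul
    (thetaScale n l)).congr fun z hz => thetaSub_eq hr hν l hz, fun g z hz => ?_⟩
  have den_ne := den_ne_zero g.1 hz
  rw [thetaSub_eq hr hν l hz, thetaSub_eq hr hν l (act_mem_ball g.1 hz),
    integral_thetaSeries_act hΓ hν weight_le hr g hz, jac_eq g.1 hz, mulVec_smul,
    smul_comm (thetaScale n l), smul_smul, inv_pow, ← pow_mul,
    inv_mul_cancel₀ (pow_ne_zero _ den_ne), one_smul]

end ThetaSubmanifold

/-! ### The terms other than the identity -/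

theorem setDist_le_hypDist {A B : Set (Cn n)} {z w : Cn n} (hz : z ∈ A) (hw : w ∈ B) :
    setDist A B ≤ ENNReal.ofReal (hypDist z w) :=
  (iInf₂_le z hz).trans (iInf₂_le w hw)

theorem tendsto_hypDist_nhdsWithin {w : Cn n} (hw : w ∈ ball n) :
    Tendsto (fun z => hypDist z w) (𝓝[ball n] w) (𝓝 0) := by
  have sechHalf_self : sechHalf w w = 1 := by
    rw [sechHalf, norm_herm_self hw, sq, div_self (mul_pos (defect_pos hw) (defect_pos hw)).ne']
  have continuousOn_inv : ContinuousOn (fun z => (sechHalf z w)⁻¹) (ball n) :=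
    (continuousOn_sechHalf hw).inv₀ fun z hz => (sechHalf_pos hz hw).ne'
  have one_le_inv : Set.MapsTo (fun z => (sechHalf z w)⁻¹) (ball n) (Set.Ici 1) := fun z hz =>
    (one_le_inv₀ (sechHalf_pos hz hw)).2 (sechHalf_le_one hz hw)
  have tendsto_arcosh : ContinuousWithinAt (fun z => 2 * Real.arcosh (sechHalf z w)⁻¹) (ball n) w :=
    ((Real.continuousOn_arcosh.comp continuousOn_inv one_le_inv).const_smul (2 : ℝ)) w hw
  rw [ContinuousWithinAt, sechHalf_self, inv_one, Real.arcosh_zero, mul_zero] at tendsto_arcosh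
  exact tendsto_arcosh.congr' <| eventually_mem_nhdsWithin.mono fun z hz => (hypDist_eq hz hw).symm

theorem closure_subset_interior_of_setDist_pos {X F : Set (Cn n)} (hX : closure X ⊆ ball n)
    (hXF : X ⊆ F) (hd : 0 < setDist X (frontier F ∩ ball n)) : closure X ⊆ interior F := by
  intro x hx
  by_contra hx_interior
  have x_frontier : x ∈ frontier F ∩ ball n := ⟨⟨closure_mono hXF hx, hx_interior⟩, hX hx⟩
  have tendsto_zero := ENNReal.tendsto_ofReal <|
    (tendsto_hypDist_nhdsWithin (hX hx)).mono_left (nhdsWithin_mono x (subset_closure.trans hX))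
  rw [ENNReal.ofReal_zero] at tendsto_zero
  have : (𝓝[X] x).NeBot := mem_closure_iff_nhdsWithin_neBot.1 hx
  exact hd.not_ge <| ge_of_tendsto tendsto_zero <|
    eventually_mem_nhdsWithin.mono fun z hz => setDist_le_hypDist hz x_frontier

theorem exists_sechHalf_le_of_notMem {K F : Set (Cn n)} (hK : IsCompact K) (hK_ball : K ⊆ ball n)
    (hKF : K ⊆ interior F) :
    ∃ q : ℝ, 0 ≤ q ∧ q < 1 ∧ ∀ p ∈ K, ∀ z ∈ ball n, z ∉ F → sechHalf z p ≤ q := by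
  obtain ⟨ε, hε, thickening_subset⟩ := hK.exists_thickening_subset_open isOpen_interior hKF
  refine ⟨max 0 (1 - ε ^ 2 / 4), le_max_left _ _, max_lt one_pos (by linarith [pow_pos hε 2]),
    fun p hp z hz hzF => ?_⟩
  have eps_le : ε ≤ nrm (z - p) := by
    rw [← not_lt]
    refine fun hlt => hzF (interior_subset (thickening_subset ?_))
    exact Metric.mem_thickening_iff.2 ⟨p, hp, (dist_eq_norm z p).trans_lt
      ((norm_le_nrm _).trans_lt hlt)⟩
  have eps_sq_le : ε ^ 2 ≤ nsq (z - p) := by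
    rw [← nrm_sq]
    gcongr
  exact (sechHalf_le_one_sub hz (hK_ball hp)).trans (le_max_of_le_right (by linarith))

theorem IsConvergenceType.summable_defect_act {Γ : Subgroup (SU n)} (hΓ : IsConvergenceType Γ)
    {z : Cn n} (hz : z ∈ ball n) : Summable fun g : Γ => defect (act g.1 z) ^ (2 * (n + 1)) := by
  refine .of_nonneg_of_le (fun g => pow_nonneg (defect_nonneg _) _) (fun g => ?_)
    (hΓ.div_const ((1 - nrm z) ^ (2 * (n + 1))))
  rw [← div_pow]
  exact pow_le_pow_left₀ (defect_nonneg _) (defect_act_le (mem_ball_iff_nrm.1 hz) g.1 le_rfl) _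

/-- The Poincaré series `∑_γ (1 - |γz|²)^{n+1}` majorising all the theta series. -/
def poincareSum (Γ : Subgroup (SU n)) (z : Cn n) : ℝ :=
  ∑' g : Γ, defect (act g.1 z) ^ (2 * (n + 1))

theorem poincareSum_nonneg (Γ : Subgroup (SU n)) (z : Cn n) : 0 ≤ poincareSum Γ z :=
  tsum_nonneg fun _ => pow_nonneg (defect_nonneg _) _

theorem aemeasurable_ofReal_defect_act_pow (g : SU n) {F : Set (Cn n)} (hF_meas : MeasurableSet F)
    (hF_ball : F ⊆ ball n) (N : ℕ) :
    AEMeasurable (fun z => ENNReal.ofReal (defect (act g z) ^ N)) ((invVol n).restrict F) :=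
  ((continuous_defect.measurable.pow_const N).ennreal_ofReal).comp_aemeasurable
    (((continuousOn_act g).mono hF_ball).aemeasurable hF_meas)

theorem ofReal_poincareSum {Γ : Subgroup (SU n)} (hΓ : IsConvergenceType Γ) {z : Cn n}
    (hz : z ∈ ball n) : ENNReal.ofReal (poincareSum Γ z) =
      ∑' g : Γ, ENNReal.ofReal (defect (act g.1 z) ^ (2 * (n + 1))) :=
  ENNReal.ofReal_tsum_of_nonneg (fun _ => pow_nonneg (defect_nonneg _) _)
    (hΓ.summable_defect_act hz)

theorem IsConvergenceType.aemeasurable_ofReal_poincareSum {Γ : Subgroup (SU n)}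
    (hΓ : IsConvergenceType Γ) {F : Set (Cn n)} (hF_meas : MeasurableSet F) (hF_ball : F ⊆ ball n) :
    AEMeasurable (fun z => ENNReal.ofReal (poincareSum Γ z)) ((invVol n).restrict F) := by
  have := hΓ.countable
  refine (AEMeasurable.tsum (L := .unconditional Γ) fun g : Γ =>
    aemeasurable_ofReal_defect_act_pow g.1 hF_meas hF_ball (2 * (n + 1))).congr ?_
  exact (ae_restrict_mem hF_meas).mono fun z hz => (ofReal_poincareSum hΓ (hF_ball hz)).symm

theorem IsWandering.setLIntegral_poincareSum_le {Γ : Subgroup (SU n)} {F : Set (Cn n)}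
    (hF : IsWandering Γ F) (hF_meas : MeasurableSet F) (hF_ball : F ⊆ ball n)
    (hΓ : IsConvergenceType Γ) :
    ∫⁻ z in F, ENNReal.ofReal (poincareSum Γ z) ∂invVol n ≤ volume (ball n) := by
  have := hΓ.countable
  calc ∫⁻ z in F, ENNReal.ofReal (poincareSum Γ z) ∂invVol n
      = ∫⁻ z in F, ∑' g : Γ, ENNReal.ofReal (defect (act g.1 z) ^ (2 * (n + 1))) ∂invVol n :=
        setLIntegral_congr_fun hF_meas fun z hz => ofReal_poincareSum hΓ (hF_ball hz)
    _ = ∑' g : Γ, ∫⁻ z in F, ENNReal.ofReal (defect (act g.1 z) ^ (2 * (n + 1))) ∂invVol n :=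
        lintegral_tsum fun g : Γ => aemeasurable_ofReal_defect_act_pow g.1 hF_meas hF_ball _
    _ ≤ ∫⁻ z, ENNReal.ofReal (defect z ^ (2 * (n + 1))) ∂invVol n :=
        hF.tsum_setLIntegral_act_le hF_meas hF_ball fun z =>
          ENNReal.ofReal (defect z ^ (2 * (n + 1)))
    _ = volume (ball n) := lintegral_defect_pow

theorem IsWandering.setLIntegral_poincareSum_sq_le {Γ : Subgroup (SU n)} {F : Set (Cn n)}
    (hF : IsWandering Γ F) (hF_meas : MeasurableSet F) (hF_ball : F ⊆ ball n)
    (hΓ : IsConvergenceType Γ) {S : ℝ} (hS : ∀ z ∈ F, poincareSum Γ z ≤ S) :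
    ∫⁻ z in F, ENNReal.ofReal (poincareSum Γ z ^ 2) ∂invVol n ≤
      ENNReal.ofReal S * volume (ball n) :=
  calc ∫⁻ z in F, ENNReal.ofReal (poincareSum Γ z ^ 2) ∂invVol n
      ≤ ∫⁻ z in F, ENNReal.ofReal S * ENNReal.ofReal (poincareSum Γ z) ∂invVol n :=
        setLIntegral_mono' hF_meas fun z hz => by
          rw [sq, ENNReal.ofReal_mul (poincareSum_nonneg Γ z)]
          gcongr
          exact hS z hz
    _ ≤ ENNReal.ofReal S * volume (ball n) := by
        rw [lintegral_const_mul' _ _ ENNReal.ofReal_ne_top]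
        gcongr
        exact hF.setLIntegral_poincareSum_le hF_meas hF_ball hΓ

theorem norm_peak_mul_defect_pow_le {r q : ℝ} (hr : r < 1) {z p : Cn n} (hz : z ∈ ball n)
    (hp : nrm p ≤ r) {g : SU n} (hq : sechHalf (act g z) p ≤ q) (M : ℕ) :
    ‖peak (M + 2 * (n + 1)) p g z‖ * defect z ^ (M + 2 * (n + 1)) ≤
      q ^ M * ((2 / (1 - r)) ^ (n + 1) * defect (act g z) ^ (2 * (n + 1))) := by
  have q_pow_nonneg : 0 ≤ q ^ M := pow_nonneg ((sechHalf_nonneg _ _).trans hq) M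
  have := sechHalf_nonneg (act g z) p
  rw [norm_peak_mul_defect_pow _ p g hz, pow_add]
  gcongr
  exact sechHalf_pow_le le_rfl hr (act_mem_ball g hz) hp

section OffDiagonal

variable {m : ℕ} {Γ : Subgroup (SU n)} {ρ : Γ →* unitaryGroup (Fin m) ℂ} {j : Fin m}
  {F : Set (Cn n)} {r q : ℝ}

theorem IsWandering.norm_thetaSeries_sub_mul_le (hF : IsWandering Γ F) (hΓ : IsConvergenceType Γ)
    (hr : r < 1) (hq₀ : 0 ≤ q) {z p : Cn n} (hzF : z ∈ F) (hz : z ∈ ball n) (hp : nrm p ≤ r)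
    (hq : ∀ w ∈ ball n, w ∉ F → sechHalf w p ≤ q) (M : ℕ) :
    ‖thetaSeries ρ j (M + 2 * (n + 1)) z p -
        peak (M + 2 * (n + 1)) p 1 z • Pi.single j 1‖ * defect z ^ (M + 2 * (n + 1)) ≤
      q ^ M * ((2 / (1 - r)) ^ (n + 1) * poincareSum Γ z) := by
  classical
  have defect_pow_pos : 0 < defect z ^ (M + 2 * (n + 1)) := pow_pos (defect_pos hz) _
  have : 0 ≤ (2 / (1 - r)) ^ (n + 1) := by
    have := sub_pos.2 hr
    positivity
  have summable_terms : Summable fun g : Γ => peak (M + 2 * (n + 1)) p g.1 z • repColumn ρ j g :=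
    summable_peak_smul hΓ (by omega) hz (mem_ball_iff_nrm.2 (hp.trans_lt hr))
  rw [thetaSeries, summable_terms.tsum_eq_add_tsum_ite 1, OneMemClass.coe_one, repColumn_one,
    add_sub_cancel_left, ← le_div_iff₀ defect_pow_pos, poincareSum, ← tsum_mul_left,
    ← tsum_mul_left, ← tsum_div_const]
  refine tsum_of_norm_bounded (((hΓ.summable_defect_act hz).mul_left _).mul_left _
    |>.div_const _).hasSum fun g => ?_
  split_ifs with hg
  · have := defect_nonneg (act g.1 z)
    rw [norm_zero]
    positivity
  · refine (norm_peak_smul_repColumn_le ρ j _ z p g).trans ((le_div_iff₀ defect_pow_pos).2 ?_)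
    exact norm_peak_mul_defect_pow_le hr hz hp (hq _ (act_mem_ball g.1 hz)
      (hF g.1 g.2 (fun h => hg (Subtype.ext h)) z hzF)) M

variable {ν : Measure (Cn n)} [IsFiniteMeasure ν]

theorem IsWandering.norm_integral_thetaSeries_sub_mul_le (hF : IsWandering Γ F)
    (hΓ : IsConvergenceType Γ) (hr : r < 1) (hq₀ : 0 ≤ q) {z : Cn n} (hzF : z ∈ F)
    (hz : z ∈ ball n) (hν : ∀ᵐ p ∂ν, nrm p ≤ r)
    (hq : ∀ᵐ p ∂ν, ∀ w ∈ ball n, w ∉ F → sechHalf w p ≤ q) (M : ℕ) :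
    ‖∫ p, thetaSeries ρ j (M + 2 * (n + 1)) z p ∂ν -
        (∫ p, peak (M + 2 * (n + 1)) p 1 z ∂ν) • Pi.single j 1‖ * defect z ^ (M + 2 * (n + 1)) ≤
      q ^ M * ((2 / (1 - r)) ^ (n + 1) * ν.real Set.univ * poincareSum Γ z) := by
  have defect_pow_pos : 0 < defect z ^ (M + 2 * (n + 1)) := pow_pos (defect_pos hz) _
  rw [← integral_smul_const, ← integral_sub
    (integrable_thetaSeries hΓ hν (by omega) hr hz)
    ((integrable_peak hν hr (by omega) 1 hz).smul_const _), ← le_div_iff₀ defect_pow_pos]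
  refine (norm_integral_le_of_norm_le_const (C := q ^ M * ((2 / (1 - r)) ^ (n + 1) *
    poincareSum Γ z) / defect z ^ (M + 2 * (n + 1))) ?_).trans_eq (by ring)
  filter_upwards [hν, hq] with p hp hqp
  exact (le_div_iff₀ defect_pow_pos).2
    (hF.norm_thetaSeries_sub_mul_le hΓ hr hq₀ hzF hz hp hqp M)

theorem nsq_smul_single_add_le (a : ℂ) (v : Cn m) :
    nsq (a • Pi.single j 1 + v) ≤ 2 * ‖a‖ ^ 2 + 2 * m * ‖v‖ ^ 2 := by
  have nsq_single : nsq (Pi.single j 1 : Cn m) = 1 := by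
    rw [nsq, Finset.sum_eq_single j] <;> simp +contextual
  have nsq_le : nsq v ≤ m * ‖v‖ ^ 2 := by
    refine (Finset.sum_le_card_nsmul _ _ (‖v‖ ^ 2) fun i _ => ?_).trans_eq (by simp)
    gcongr
    exact norm_le_pi_norm v i
  have nsq_add_le (u : Cn m) : nsq (u + v) ≤ 2 * (nsq u + nsq v) := by
    rw [nsq, nsq, nsq, ← Finset.sum_add_distrib, Finset.mul_sum]
    refine Finset.sum_le_sum fun i _ => ?_
    exact (pow_le_pow_left₀ (norm_nonneg _) (norm_add_le _ _) 2).trans add_sq_le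
  refine (nsq_add_le _).trans ?_
  rw [nsq_smul, nsq_single]
  linarith

theorem IsWandering.nsq_integral_thetaSeries_mul_le (hF : IsWandering Γ F)
    (hΓ : IsConvergenceType Γ) (hr : r < 1) (hq₀ : 0 ≤ q) {z : Cn n} (hzF : z ∈ F)
    (hz : z ∈ ball n) (hν : ∀ᵐ p ∂ν, nrm p ≤ r)
    (hq : ∀ᵐ p ∂ν, ∀ w ∈ ball n, w ∉ F → sechHalf w p ≤ q) (M : ℕ) :
    nsq (∫ p, thetaSeries ρ j (M + 2 * (n + 1)) z p ∂ν) * defect z ^ (2 * (M + 2 * (n + 1))) ≤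
      2 * (m * ((2 / (1 - r)) ^ (n + 1) * ν.real Set.univ) ^ 2 * (q ^ M) ^ 2 *
          poincareSum Γ z ^ 2 +
        (‖∫ p, peak (M + 2 * (n + 1)) p 1 z ∂ν‖ * defect z ^ (M + 2 * (n + 1))) ^ 2) := by
  set N := M + 2 * (n + 1)
  set main := ∫ p, peak N p 1 z ∂ν
  set error := ∫ p, thetaSeries ρ j N z p ∂ν - main • Pi.single j 1
  have error_sq_le := pow_le_pow_left₀ (mul_nonneg (norm_nonneg _) (pow_nonneg (defect_nonneg z) _))
    (hF.norm_integral_thetaSeries_sub_mul_le (ρ := ρ) (j := j) hΓ hr hq₀ hzF hz hν hq M) 2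
  have nsq_le := nsq_smul_single_add_le (j := j) main error
  rw [add_sub_cancel] at nsq_le
  calc _ ≤ (2 * ‖main‖ ^ 2 + 2 * m * ‖error‖ ^ 2) * defect z ^ (2 * N) :=
        mul_le_mul_of_nonneg_right nsq_le (pow_nonneg (defect_nonneg z) _)
    _ = 2 * (m * (‖error‖ * defect z ^ N) ^ 2 + (‖main‖ * defect z ^ N) ^ 2) := by ring
    _ ≤ 2 * (m * (q ^ M * ((2 / (1 - r)) ^ (n + 1) * ν.real Set.univ * poincareSum Γ z)) ^ 2 +
          (‖main‖ * defect z ^ N) ^ 2) := by gcongr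
    _ = _ := by ring

theorem IsWandering.exists_setLIntegral_nsq_integral_thetaSeries_le (hF : IsWandering Γ F)
    (hF_meas : MeasurableSet F) (hF_ball : F ⊆ ball n) (hΓ : IsConvergenceType Γ) {S : ℝ}
    (hS : ∀ z ∈ F, poincareSum Γ z ≤ S) (hr : r < 1) (hq₀ : 0 ≤ q) (hν : ∀ᵐ p ∂ν, nrm p ≤ r)
    (hq : ∀ᵐ p ∂ν, ∀ w ∈ ball n, w ∉ F → sechHalf w p ≤ q) :
    ∃ B : ℝ, 0 ≤ B ∧ ∀ M N : ℕ, N = M + 2 * (n + 1) →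
      ∫⁻ z in F, ENNReal.ofReal (nsq (∫ p, thetaSeries ρ j N z p ∂ν) * defect z ^ (2 * N))
        ∂invVol n ≤
      2 * (ENNReal.ofReal (B * (q ^ M) ^ 2) +
        ∫⁻ z, ENNReal.ofReal ((‖∫ p, peak N p 1 z ∂ν‖ * defect z ^ N) ^ 2) ∂invVol n) := by
  let b : ℝ := m * ((2 / (1 - r)) ^ (n + 1) * ν.real Set.univ) ^ 2
  have : 0 ≤ b := by positivity
  refine ⟨b * (max S 0 * volume.real (ball n)), by positivity, ?_⟩
  rintro M N rfl
  set N := M + 2 * (n + 1)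
  set main : Cn n → ℝ := fun z => (‖∫ p, peak N p 1 z ∂ν‖ * defect z ^ N) ^ 2
  have poincareSum_sq_le : ∫⁻ z in F, ENNReal.ofReal (poincareSum Γ z ^ 2) ∂invVol n ≤
      ENNReal.ofReal (max S 0 * volume.real (ball n)) := by
    rw [ENNReal.ofReal_mul (le_max_right _ _), ofReal_measureReal volume_ball_lt_top.ne]
    exact hF.setLIntegral_poincareSum_sq_le hF_meas hF_ball hΓ fun z hz =>
      (hS z hz).trans (le_max_left _ _)
  have aemeasurable_error : AEMeasurable (fun z => ENNReal.ofReal (b * (q ^ M) ^ 2) *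
      ENNReal.ofReal (poincareSum Γ z ^ 2)) ((invVol n).restrict F) := by
    simp only [ENNReal.ofReal_pow (poincareSum_nonneg Γ _)]
    exact ((hΓ.aemeasurable_ofReal_poincareSum hF_meas hF_ball).pow_const 2).const_mul _
  calc _ ≤ ∫⁻ z in F, 2 * (ENNReal.ofReal (b * (q ^ M) ^ 2) *
          ENNReal.ofReal (poincareSum Γ z ^ 2) + ENNReal.ofReal (main z)) ∂invVol n :=
        setLIntegral_mono' hF_meas fun z hz => by
          rw [← ENNReal.ofReal_mul (by positivity), ← ENNReal.ofReal_add (by positivity)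
            (sq_nonneg _), ← ENNReal.ofReal_ofNat 2, ← ENNReal.ofReal_mul zero_le_two]
          exact ENNReal.ofReal_le_ofReal (hF.nsq_integral_thetaSeries_mul_le hΓ hr hq₀ hz
            (hF_ball hz) hν hq M)
    _ = 2 * (ENNReal.ofReal (b * (q ^ M) ^ 2) *
          ∫⁻ z in F, ENNReal.ofReal (poincareSum Γ z ^ 2) ∂invVol n +
          ∫⁻ z in F, ENNReal.ofReal (main z) ∂invVol n) := by
        rw [lintegral_const_mul' _ _ ENNReal.ofNat_ne_top, lintegral_add_left' aemeasurable_error,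
          lintegral_const_mul' _ _ ENNReal.ofReal_ne_top]
    _ ≤ 2 * (ENNReal.ofReal (b * (q ^ M) ^ 2) * ENNReal.ofReal (max S 0 * volume.real (ball n)) +
          ∫⁻ z, ENNReal.ofReal (main z) ∂invVol n) := by
        gcongr
        exact Measure.restrict_le_self
    _ = _ := by
        rw [← ENNReal.ofReal_mul (by positivity), mul_right_comm]

end OffDiagonal

/-! ### The half ball -/

/-- The set of parameters `(z₁, x₂)` of the half ball `X`. -/
def halfBallParam (α : ℝ) : Set (ℂ × ℝ) :=
  {w : ℂ × ℝ | w.1.re ^ 2 + w.1.im ^ 2 + w.2 ^ 2 < α ^ 2 ∧ 0 < w.2}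

/-- The parametrisation `embed n` of the half ball as a real linear map. -/
def embedL (n : ℕ) : ℂ × ℝ →ₗ[ℝ] Cn n where
  toFun := embed n
  map_add' v w := by ext i; simp only [embed, Pi.add_apply]; split_ifs <;> simp
  map_smul' c w := by ext i; simp only [embed, Pi.smul_apply]; split_ifs <;> simp

theorem mem_halfBallParam {α : ℝ} {w : ℂ × ℝ} :
    w ∈ halfBallParam α ↔ ‖w.1‖ ^ 2 + w.2 ^ 2 < α ^ 2 ∧ 0 < w.2 := by
  rw [← Complex.normSq_eq_norm_sq, Complex.normSq_apply, ← sq, ← sq]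
  exact Iff.rfl

theorem isOpen_halfBallParam (α : ℝ) : IsOpen (halfBallParam α) :=
  .inter (isOpen_lt (f := fun w : ℂ × ℝ => w.1.re ^ 2 + w.1.im ^ 2 + w.2 ^ 2) (by fun_prop)
    continuous_const) (isOpen_lt continuous_const continuous_snd)

theorem measurableSet_halfBallParam (α : ℝ) : MeasurableSet (halfBallParam α) :=
  (isOpen_halfBallParam α).measurableSet

theorem halfBallParam_subset_univ_prod {α : ℝ} (hα : 0 < α) :
    halfBallParam α ⊆ Set.univ ×ˢ Set.Ioo 0 α := fun w hw => by
  obtain ⟨norm_sq_lt, pos⟩ := mem_halfBallParam.1 hw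
  exact ⟨Set.mem_univ _, pos, lt_of_pow_lt_pow_left₀ 2 hα.le (by linarith [sq_nonneg ‖w.1‖])⟩

theorem volume_halfBallParam_lt_top {α : ℝ} (hα : 0 < α) : volume (halfBallParam α) < ⊤ := by
  refine (measure_mono (t := Metric.closedBall 0 α) fun w hw => ?_).trans_lt
    measure_closedBall_lt_top
  have lt_alpha := (halfBallParam_subset_univ_prod hα hw).2.2
  obtain ⟨norm_sq_lt, pos⟩ := mem_halfBallParam.1 hw
  rw [mem_closedBall_zero_iff, Prod.norm_def, max_le_iff, Real.norm_of_nonneg pos.le]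
  exact ⟨(lt_of_pow_lt_pow_left₀ 2 hα.le (by linarith [sq_nonneg w.2])).le, lt_alpha.le⟩

theorem mul_mem_halfBallParam {α : ℝ} {w : ℂ × ℝ} (hw : w ∈ halfBallParam α) {u : ℂ}
    (hu : ‖u‖ ≤ 1) : (u * w.1, w.2) ∈ halfBallParam α := by
  obtain ⟨norm_sq_lt, pos⟩ := mem_halfBallParam.1 hw
  refine mem_halfBallParam.2 ⟨lt_of_le_of_lt ?_ norm_sq_lt, pos⟩
  gcongr
  rw [norm_mul]
  exact mul_le_of_le_one_left (norm_nonneg _) hu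

theorem embed_injective (hn : 2 ≤ n) : Function.Injective (embed n) := fun v w h => by
  have first := congrFun h ⟨0, by omega⟩
  have second := congrFun h ⟨1, by omega⟩
  simp only [embed, if_true, one_ne_zero, if_false, Complex.ofReal_inj] at first second
  exact Prod.ext first second

theorem isClosedEmbedding_embed (hn : 2 ≤ n) : Topology.IsClosedEmbedding (embed n) :=
  LinearMap.isClosedEmbedding_of_injective (f := embedL n)
    (LinearMap.ker_eq_bot.2 (embed_injective hn))

theorem continuous_embed : Continuous (embed n) :=
  LinearMap.continuous_of_finiteDimensional (embedL n)

section HalfBall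

variable (hn : 2 ≤ n)
include hn

theorem sum_embed (w : ℂ × ℝ) {A : Type*} [AddCommMonoid A] (f : Fin n → ℂ → A)
    (hf : ∀ i, f i 0 = 0) :
    ∑ i, f i (embed n w i) = f ⟨0, by omega⟩ w.1 + f ⟨1, by omega⟩ (w.2 : ℂ) := by
  rw [Finset.sum_eq_add_of_mem (⟨0, by omega⟩ : Fin n) ⟨1, by omega⟩ (Finset.mem_univ _)
    (Finset.mem_univ _) (by simp)]
  · simp [embed]
  · rintro i - ⟨ne_zero, ne_one⟩
    simp [embed, mt Fin.ext ne_zero, mt Fin.ext ne_one, hf]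

theorem nsq_embed (w : ℂ × ℝ) : nsq (embed n w) = ‖w.1‖ ^ 2 + w.2 ^ 2 := by
  rw [nsq, sum_embed hn w (fun _ x => ‖x‖ ^ 2) (by simp)]
  simp

theorem neg_herm_embed (z : Cn n) (w : ℂ × ℝ) :
    -herm z (embed n w) = 1 - z ⟨0, by omega⟩ * conj w.1 - z ⟨1, by omega⟩ * w.2 := by
  rw [herm, sum_embed hn w (fun i x => z i * conj x) (by simp), Complex.conj_ofReal]
  ring

variable {α : ℝ}

theorem ae_halfBallMeasure_of_forall {P : Cn n → Prop} (hP : ∀ w ∈ halfBallParam α, P (embed n w)) :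
    ∀ᵐ p ∂halfBallMeasure n α, P p := by
  rw [halfBallMeasure, (isClosedEmbedding_embed hn).measurableEmbedding.ae_map_iff]
  exact (ae_restrict_mem (measurableSet_halfBallParam α)).mono hP

theorem integral_halfBallMeasure {E : Type*} [NormedAddCommGroup E] [NormedSpace ℝ E]
    (f : Cn n → E) :
    ∫ p, f p ∂halfBallMeasure n α = ∫ w in halfBallParam α, f (embed n w) :=
  (isClosedEmbedding_embed hn).measurableEmbedding.integral_map f

variable (hα : 0 < α)
include hα

theorem nrm_embed_le {w : ℂ × ℝ} (hw : w ∈ halfBallParam α) : nrm (embed n w) ≤ α :=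
  Real.sqrt_le_iff.2 ⟨hα.le, (nsq_embed hn w).trans_le (mem_halfBallParam.1 hw).1.le⟩

theorem one_sub_nrm_le_norm_herm_embed (hα₁ : α < 1) (z : Cn n) {w : ℂ × ℝ}
    (hw : w ∈ halfBallParam α) : 1 - nrm z ≤ ‖herm z (embed n w)‖ := by
  refine le_trans ?_ (one_sub_nrm_mul_le_norm_herm _ _)
  have := mul_le_of_le_one_right (nrm_nonneg z) ((nrm_embed_le hn hα hw).trans hα₁.le)
  linarith

theorem mem_halfBall_iff (hα₁ : α < 1) {z : Cn n} :
    z ∈ halfBall n hn α ↔ ∃ w ∈ halfBallParam α, embed n w = z := by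
  constructor
  · rintro ⟨-, norm_lt, re_pos, im_eq_zero, eq_zero⟩
    refine ⟨(z ⟨0, by omega⟩, (z ⟨1, by omega⟩).re), ⟨norm_lt, re_pos⟩, ?_⟩
    ext i
    simp only [embed]
    split_ifs with hi_zero hi_one
    · exact congrArg z (Fin.ext hi_zero.symm)
    · rw [show i = ⟨1, by omega⟩ from Fin.ext hi_one]
      exact Complex.ext rfl im_eq_zero.symm
    · exact (eq_zero i (by omega)).symm
  · rintro ⟨w, hw, rfl⟩
    refine ⟨mem_ball_iff_nrm.2 ((nrm_embed_le hn hα hw).trans_lt hα₁), ?_⟩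
    refine ⟨by simpa [embed] using hw.1, by simpa [embed] using hw.2, by simp [embed],
      fun i hi => ?_⟩
    rw [embed, if_neg (by omega), if_neg (by omega)]

theorem halfBall_nonempty (hα₁ : α < 1) : (halfBall n hn α).Nonempty := by
  refine ⟨_, (mem_halfBall_iff hn hα hα₁).2 ⟨(0, α / 2), mem_halfBallParam.2 ⟨?_, half_pos hα⟩,
    rfl⟩⟩
  rw [norm_zero]
  linarith [pow_pos hα 2]

theorem nrm_le_of_mem_closure_halfBall (hα₁ : α < 1) {z : Cn n}
    (hz : z ∈ closure (halfBall n hn α)) : nrm z ≤ α := by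
  refine closure_minimal (fun p hp => ?_) (isCompact_nrm_le α).isClosed hz
  obtain ⟨w, hw, rfl⟩ := (mem_halfBall_iff hn hα hα₁).1 hp
  exact nrm_embed_le hn hα hw

end HalfBall

theorem isFiniteMeasure_halfBallMeasure {α : ℝ} (hα : 0 < α) :
    IsFiniteMeasure (halfBallMeasure n α) := by
  have : IsFiniteMeasure (volume.restrict (halfBallParam α)) :=
    ⟨by simpa using volume_halfBallParam_lt_top hα⟩
  exact Measure.isFiniteMeasure_map (volume.restrict (halfBallParam α)) (embed n)

/-! ### Averaging over rotations -/

theorem integral_apply_zero_eq_of_forall_circle {X : Type*} [MeasurableSpace X] {μ : Measure X}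
    [IsFiniteMeasure μ] {G : ℂ → X → ℂ} {c : ℂ} {C : ℝ} (hG_meas : Measurable (Function.uncurry G))
    (hG_diff : ∀ᵐ x ∂μ, DiffContOnCl ℂ (fun u => G u x) (Metric.ball 0 1))
    (hG_le : ∀ᵐ x ∂μ, ∀ u : ℂ, ‖u‖ ≤ 1 → ‖G u x‖ ≤ C)
    (hG_int : ∀ u : Circle, ∫ x, G u x ∂μ = c) : ∫ x, G 0 x ∂μ = c := by
  have two_pi_ne_zero : 2 * Real.pi ≠ 0 := by positivity
  have : IsFiniteMeasure (volume.restrict (Set.uIoc 0 (2 * Real.pi))) := ⟨by simp [Set.uIoc]⟩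
  have integrable_circle : Integrable (Function.uncurry fun (θ : ℝ) x => G (circleMap 0 1 θ) x)
      ((volume.restrict (Set.uIoc 0 (2 * Real.pi))).prod μ) := by
    refine Integrable.of_bound (C := C) ?_ ?_
    · exact (hG_meas.comp (((continuous_circleMap 0 1).measurable.comp measurable_fst).prodMk
        measurable_snd)).aestronglyMeasurable
    · exact (Measure.quasiMeasurePreserving_snd.ae hG_le).mono fun x hx => hx _ (by simp)
  have mean_value : ∀ᵐ x ∂μ, ∫ θ in (0 : ℝ)..2 * Real.pi, G (circleMap 0 1 θ) x =
      (2 * Real.pi) • G 0 x := hG_diff.mono fun x hx => by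
    rw [← abs_one] at hx
    rw [← hx.circleAverage, Real.circleAverage_def, smul_inv_smul₀ two_pi_ne_zero]
  have circle_int (θ : ℝ) : ∫ x, G (circleMap 0 1 θ) x ∂μ = c := by
    rw [← hG_int (Circle.exp θ), Circle.coe_exp, circleMap_zero, Complex.ofReal_one, one_mul]
  have swap := intervalIntegral_integral_swap integrable_circle
  simp only [circle_int] at swap
  rw [integral_congr_ae mean_value, integral_smul, intervalIntegral.integral_const,
    sub_zero] at swap
  exact (smul_right_injective ℂ two_pi_ne_zero swap).symm

theorem setIntegral_halfBallParam_mul_circle {E : Type*} [NormedAddCommGroup E] [NormedSpace ℝ E]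
    (α : ℝ) (u : Circle) (f : ℂ × ℝ → E) :
    ∫ w in halfBallParam α, f (u * w.1, w.2) = ∫ w in halfBallParam α, f w := by
  let rotate : ℂ × ℝ ≃ₜ ℂ × ℝ := (rotation u).toHomeomorph.prodCongr (Homeomorph.refl ℝ)
  have rotate_apply (w : ℂ × ℝ) : rotate w = (u * w.1, w.2) := rfl
  have rotate_preserving : MeasurePreserving rotate volume volume :=
    (rotation u).measurePreserving.prod (MeasurePreserving.id volume)
  have preimage_rotate : rotate ⁻¹' halfBallParam α = halfBallParam α := by
    ext w
    rw [Set.mem_preimage, mem_halfBallParam, mem_halfBallParam, rotate_apply, norm_mul,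
      Circle.norm_coe, one_mul]
  have := rotate_preserving.setIntegral_preimage_emb rotate.measurableEmbedding f (halfBallParam α)
  rwa [preimage_rotate] at this

theorem peak_one (N : ℕ) (p z : Cn n) : peak N p 1 z = (defect p / -herm z p) ^ N := by
  rw [peak, den_one, act_one, one_mul]

/-- For `|u| = 1` this is `peak N p 1 z` at the point `p` obtained from `embed n w` by rotating the
first coordinate by `ū`. It extends holomorphically to the disc `|u| ≤ 1` because `herm z p` is
conjugate linear in `p`; the value at `u = 0` is therefore the average over all rotations. -/
def rotatedPeak (N : ℕ) (z : Cn n) (u : ℂ) (w : ℂ × ℝ) : ℂ :=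
  (defect (embed n w) / -herm z (embed n (conj u * w.1, w.2))) ^ N

section RotatedPeak

variable (N : ℕ) {z : Cn n}

theorem measurable_rotatedPeak : Measurable (Function.uncurry (rotatedPeak N z)) := by
  have continuous_den : Continuous fun x : ℂ × ℂ × ℝ =>
      -herm z (embed n (conj x.1 * x.2.1, x.2.2)) :=
    (continuous_herm.comp (continuous_const.prodMk (continuous_embed.comp (by fun_prop)))).neg
  exact ((Complex.continuous_ofReal.comp (continuous_defect.comp
    (continuous_embed.comp continuous_snd))).measurable.div continuous_den.measurable).pow_const N

variable (hn : 2 ≤ n) {α : ℝ}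
include hn

theorem setIntegral_rotatedPeak_circle (u : Circle) :
    ∫ w in halfBallParam α, rotatedPeak N z u w = ∫ p, peak N p 1 z ∂halfBallMeasure n α := by
  rw [integral_halfBallMeasure hn, ← setIntegral_halfBallParam_mul_circle α u]
  refine integral_congr_ae (.of_forall fun w => ?_)
  have conj_mul_mul : conj (u : ℂ) * (u * w.1) = w.1 := by
    rw [← mul_assoc, mul_comm (conj _), Complex.mul_conj, Circle.normSq_coe, Complex.ofReal_one,
      one_mul]
  have defect_eq : defect (embed n (u * w.1, w.2)) = defect (embed n w) := by
    rw [defect, defect, nsq_embed hn, nsq_embed hn, norm_mul, Circle.norm_coe, one_mul]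
  simp only [rotatedPeak, peak_one, conj_mul_mul, defect_eq]

variable (hα : 0 < α) (hα₁ : α < 1) {w : ℂ × ℝ} (hw : w ∈ halfBallParam α)
include hα hα₁ hw

theorem one_sub_nrm_le_norm_neg_herm_embed_conj_mul {u : ℂ} (hu : ‖u‖ ≤ 1) :
    1 - nrm z ≤ ‖-herm z (embed n (conj u * w.1, w.2))‖ := by
  rw [norm_neg]
  exact one_sub_nrm_le_norm_herm_embed hn hα hα₁ z
    (mul_mem_halfBallParam hw ((RCLike.norm_conj u).trans_le hu))

variable (hz : z ∈ ball n)
include hz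

theorem norm_rotatedPeak_le {u : ℂ} (hu : ‖u‖ ≤ 1) :
    ‖rotatedPeak N z u w‖ ≤ (1 / (1 - nrm z)) ^ N := by
  have gap_pos : 0 < 1 - nrm z := sub_pos.2 (mem_ball_iff_nrm.1 hz)
  rw [rotatedPeak, norm_pow, norm_div, Complex.norm_real, Real.norm_of_nonneg (defect_nonneg _)]
  exact pow_le_pow_left₀ (div_nonneg (defect_nonneg _) (norm_nonneg _))
    (div_le_div₀ zero_le_one (defect_le_one _) gap_pos
      (one_sub_nrm_le_norm_neg_herm_embed_conj_mul hn hα hα₁ hw hu)) N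

theorem diffContOnCl_rotatedPeak :
    DiffContOnCl ℂ (fun u => rotatedPeak N z u w) (Metric.ball 0 1) := by
  refine DifferentiableOn.diffContOnCl fun u hu => ?_
  have norm_le_one : ‖u‖ ≤ 1 := by simpa using Metric.closure_ball_subset_closedBall hu
  have den_ne_zero : -herm z (embed n (conj u * w.1, w.2)) ≠ 0 :=
    norm_pos_iff.1 ((sub_pos.2 (mem_ball_iff_nrm.1 hz)).trans_le
      (one_sub_nrm_le_norm_neg_herm_embed_conj_mul hn hα hα₁ hw norm_le_one))
  have differentiable_den : Differentiable ℂ fun u => -herm z (embed n (conj u * w.1, w.2)) := by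
    simp only [neg_herm_embed hn, map_mul, Complex.conj_conj]
    fun_prop
  exact (((differentiableAt_const _).div (differentiable_den u) den_ne_zero).pow
    N).differentiableWithinAt

end RotatedPeak

theorem integral_peak_halfBallMeasure (hn : 2 ≤ n) {α : ℝ} (hα : 0 < α) (hα₁ : α < 1) (N : ℕ)
    {z : Cn n} (hz : z ∈ ball n) : ∫ p, peak N p 1 z ∂halfBallMeasure n α =
      ∫ w in halfBallParam α, rotatedPeak N z 0 w := by
  have : IsFiniteMeasure (volume.restrict (halfBallParam α)) :=
    ⟨by simpa using volume_halfBallParam_lt_top hα⟩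
  have param_mem := ae_restrict_mem (μ := volume) (measurableSet_halfBallParam α)
  exact (integral_apply_zero_eq_of_forall_circle (measurable_rotatedPeak N)
    (param_mem.mono fun w hw => diffContOnCl_rotatedPeak N hn hα hα₁ hw hz)
    (param_mem.mono fun w hw u hu => norm_rotatedPeak_le N hn hα hα₁ hw hz hu)
    (setIntegral_rotatedPeak_circle N hn)).symm

/-! ### The term of the identity -/

theorem defect_embed_div_le (hn : 2 ≤ n) {w : ℂ × ℝ} (hw : embed n (0, w.2) ∈ ball n) :
    defect (embed n w) / defect (embed n (0, w.2)) ≤ Real.exp (-(1 / 2) * ‖w.1‖ ^ 2) := by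
  have exp_eq_sqrt : Real.exp (-(1 / 2) * ‖w.1‖ ^ 2) = √(Real.exp (-‖w.1‖ ^ 2)) := by
    rw [Real.sqrt_eq_rpow, ← Real.exp_mul]
    congr 1
    ring
  have sq_lt_one : w.2 ^ 2 < 1 := by
    rwa [mem_ball_iff, nsq_embed hn, norm_zero, zero_pow two_ne_zero, zero_add] at hw
  rw [div_le_iff₀ (defect_pos hw), exp_eq_sqrt, defect, defect, nsq_embed hn, nsq_embed hn,
    ← Real.sqrt_mul (Real.exp_pos _).le, norm_zero, zero_pow two_ne_zero, zero_add]
  refine Real.sqrt_le_sqrt ?_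
  calc 1 - (‖w.1‖ ^ 2 + w.2 ^ 2) ≤ (-‖w.1‖ ^ 2 + 1) * (1 - w.2 ^ 2) := by
        linarith [mul_nonneg (sq_nonneg ‖w.1‖) (sq_nonneg w.2)]
    _ ≤ Real.exp (-‖w.1‖ ^ 2) * (1 - w.2 ^ 2) :=
        mul_le_mul_of_nonneg_right (Real.add_one_le_exp _) (sub_nonneg.2 sq_lt_one.le)

theorem norm_rotatedPeak_zero_mul_le (hn : 2 ≤ n) (N : ℕ) (z : Cn n) {w : ℂ × ℝ}
    (hw : embed n (0, w.2) ∈ ball n) :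
    ‖rotatedPeak N z 0 w‖ * defect z ^ N ≤
      Real.exp (-(N / 2) * ‖w.1‖ ^ 2) * sechHalf z (embed n (0, w.2)) ^ N := by
  have axis_defect_pos := defect_pos hw
  have exp_pow : Real.exp (-(N / 2) * ‖w.1‖ ^ 2) = Real.exp (-(1 / 2) * ‖w.1‖ ^ 2) ^ N := by
    rw [← Real.exp_nat_mul]
    congr 1
    ring
  have factor : defect (embed n w) / ‖herm z (embed n (0, w.2))‖ * defect z =
      defect (embed n w) / defect (embed n (0, w.2)) * sechHalf z (embed n (0, w.2)) := by
    rw [sechHalf]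
    field_simp
  rw [rotatedPeak, map_zero, zero_mul, norm_pow, norm_div, norm_neg, Complex.norm_real,
    Real.norm_of_nonneg (defect_nonneg _), ← mul_pow, factor, exp_pow, mul_pow]
  have := sechHalf_nonneg z (embed n (0, w.2))
  have := defect_nonneg (embed n w)
  gcongr
  exact defect_embed_div_le hn hw

theorem lintegral_exp_neg_mul_norm_sq {b : ℝ} (hb : 0 < b) :
    ∫⁻ ζ : ℂ, ENNReal.ofReal (Real.exp (-b * ‖ζ‖ ^ 2)) = ENNReal.ofReal (Real.pi / b) := by
  have integral_eq := GaussianFourier.integral_rexp_neg_mul_sq_norm (V := ℂ) hb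
  rw [Complex.finrank_real_complex, Nat.cast_ofNat, div_self two_ne_zero, Real.rpow_one]
    at integral_eq
  rw [← integral_eq, ofReal_integral_eq_lintegral_ofReal
    (.of_integral_ne_zero (integral_eq.trans_ne (by positivity)))
    (.of_forall fun _ => (Real.exp_pos _).le)]

theorem measurable_sechHalf_axis_uncurry :
    Measurable fun x : Cn n × ℝ => sechHalf x.1 (embed n (0, x.2)) := by
  have measurable_axis : Measurable fun x : Cn n × ℝ => embed n (0, x.2) :=
    (continuous_embed.comp (by fun_prop)).measurable
  have measurable_comp := measurable_sechHalf_uncurry.comp (measurable_fst.prodMk measurable_axis)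
  exact measurable_comp

theorem measurable_sechHalf_axis (z : Cn n) :
    Measurable fun t : ℝ => sechHalf z (embed n (0, t)) :=
  Measurable.of_uncurry_left (f := fun z (t : ℝ) => sechHalf z (embed n (0, t)))
    measurable_sechHalf_axis_uncurry

theorem embed_axis_mem_ball (hn : 2 ≤ n) {α : ℝ} (hα₁ : α < 1) {t : ℝ} (ht : t ∈ Set.Ioo 0 α) :
    embed n (0, t) ∈ ball n := by
  rw [mem_ball_iff, nsq_embed hn, norm_zero, zero_pow two_ne_zero, zero_add]
  exact pow_lt_one₀ ht.1.le (ht.2.trans hα₁) two_ne_zero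

theorem ofReal_norm_integral_peak_mul_le (hn : 2 ≤ n) {α : ℝ} (hα : 0 < α) (hα₁ : α < 1) {N : ℕ}
    (hN : 0 < N) {z : Cn n} (hz : z ∈ ball n) :
    ENNReal.ofReal (‖∫ p, peak N p 1 z ∂halfBallMeasure n α‖ * defect z ^ N) ≤
      ENNReal.ofReal (2 * Real.pi / N) *
        ∫⁻ t in Set.Ioo 0 α, ENNReal.ofReal (sechHalf z (embed n (0, t)) ^ N) := by
  calc ENNReal.ofReal (‖∫ p, peak N p 1 z ∂halfBallMeasure n α‖ * defect z ^ N)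
      ≤ ∫⁻ w in halfBallParam α, ENNReal.ofReal (‖rotatedPeak N z 0 w‖ * defect z ^ N) := by
        simp only [ENNReal.ofReal_mul (norm_nonneg _)]
        rw [integral_peak_halfBallMeasure hn hα hα₁ N hz,
          lintegral_mul_const' _ _ ENNReal.ofReal_ne_top]
        gcongr
        simpa only [ofReal_norm] using enorm_integral_le_lintegral_enorm _
    _ ≤ ∫⁻ w in halfBallParam α, ENNReal.ofReal (Real.exp (-(N / 2) * ‖w.1‖ ^ 2)) *
          ENNReal.ofReal (sechHalf z (embed n (0, w.2)) ^ N) :=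
        setLIntegral_mono' (measurableSet_halfBallParam α) fun w hw => by
          rw [← ENNReal.ofReal_mul (Real.exp_pos _).le]
          exact ENNReal.ofReal_le_ofReal (norm_rotatedPeak_zero_mul_le hn N z
            (embed_axis_mem_ball hn hα₁ (halfBallParam_subset_univ_prod hα hw).2))
    _ ≤ ∫⁻ w in Set.univ ×ˢ Set.Ioo 0 α, ENNReal.ofReal (Real.exp (-(N / 2) * ‖w.1‖ ^ 2)) *
          ENNReal.ofReal (sechHalf z (embed n (0, w.2)) ^ N) :=
        lintegral_mono_set (halfBallParam_subset_univ_prod hα)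
    _ = (∫⁻ ζ : ℂ, ENNReal.ofReal (Real.exp (-(N / 2) * ‖ζ‖ ^ 2))) *
          ∫⁻ t in Set.Ioo 0 α, ENNReal.ofReal (sechHalf z (embed n (0, t)) ^ N) := by
        rw [Measure.volume_eq_prod, ← Measure.prod_restrict, lintegral_prod_mul
          (f := fun ζ : ℂ => ENNReal.ofReal (Real.exp (-(N / 2) * ‖ζ‖ ^ 2)))
          (g := fun t => ENNReal.ofReal (sechHalf z (embed n (0, t)) ^ N)), Measure.restrict_univ]
        · exact (Continuous.measurable (by fun_prop)).ennreal_ofReal.aemeasurable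
        · exact ((measurable_sechHalf_axis z).pow_const N).ennreal_ofReal.aemeasurable
    _ = _ := by
        rw [lintegral_exp_neg_mul_norm_sq (by positivity), div_div_eq_mul_div, mul_comm Real.pi]

theorem sq_lintegral_le {X : Type*} [MeasurableSpace X] {μ : Measure X} {f : X → ℝ≥0∞}
    (hf : AEMeasurable f μ) : (∫⁻ x, f x ∂μ) ^ 2 ≤ μ Set.univ * ∫⁻ x, f x ^ 2 ∂μ := by
  have holder := ENNReal.lintegral_mul_le_Lp_mul_Lq μ Real.HolderConjugate.two_two
    (f := fun _ => 1) aemeasurable_const hf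
  simp only [Pi.mul_apply, one_mul, ENNReal.rpow_two, one_pow, lintegral_one] at holder
  refine (pow_le_pow_left' holder 2).trans_eq ?_
  have rpow_half_sq (x : ℝ≥0∞) : (x ^ (1 / 2 : ℝ)) ^ 2 = x := by
    rw [← ENNReal.rpow_two, ← ENNReal.rpow_mul, one_div_mul_cancel two_ne_zero, ENNReal.rpow_one]
  rw [mul_pow, rpow_half_sq, rpow_half_sq]

theorem lintegral_sq_norm_integral_peak_le (hn : 2 ≤ n) {α : ℝ} (hα : 0 < α) (hα₁ : α < 1) {N : ℕ}
    (hN : 0 < N) :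
    ∫⁻ z, ENNReal.ofReal ((‖∫ p, peak N p 1 z ∂halfBallMeasure n α‖ * defect z ^ N) ^ 2)
        ∂invVol n ≤
      ENNReal.ofReal ((2 * Real.pi * α / N) ^ 2) *
        ∫⁻ z, ENNReal.ofReal (defect z ^ (2 * N)) ∂invVol n := by
  have pointwise {z : Cn n} (hz : z ∈ ball n) :
      ENNReal.ofReal ((‖∫ p, peak N p 1 z ∂halfBallMeasure n α‖ * defect z ^ N) ^ 2) ≤
        ENNReal.ofReal (2 * Real.pi / N) ^ 2 * (ENNReal.ofReal α *
          ∫⁻ t in Set.Ioo 0 α, ENNReal.ofReal (sechHalf z (embed n (0, t)) ^ (2 * N))) := by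
    have cauchy_schwarz := sq_lintegral_le (μ := volume.restrict (Set.Ioo 0 α))
      ((measurable_sechHalf_axis z).pow_const N).ennreal_ofReal.aemeasurable
    simp only [Measure.restrict_apply_univ, Real.volume_Ioo, sub_zero,
      ← ENNReal.ofReal_pow (pow_nonneg (sechHalf_nonneg _ _) N), ← pow_mul, mul_comm N]
      at cauchy_schwarz
    rw [ENNReal.ofReal_pow (mul_nonneg (norm_nonneg _) (pow_nonneg (defect_nonneg _) _))]
    refine (pow_le_pow_left' (ofReal_norm_integral_peak_mul_le hn hα hα₁ hN hz) 2).trans ?_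
    rw [mul_pow]
    gcongr
  calc _ ≤ ∫⁻ z, ENNReal.ofReal (2 * Real.pi / N) ^ 2 * (ENNReal.ofReal α *
          ∫⁻ t in Set.Ioo 0 α, ENNReal.ofReal (sechHalf z (embed n (0, t)) ^ (2 * N))) ∂invVol n :=
        lintegral_mono_ae (ae_invVol_mem_ball.mono fun z hz => pointwise hz)
    _ = ENNReal.ofReal (2 * Real.pi / N) ^ 2 * (ENNReal.ofReal α * ∫⁻ t in Set.Ioo 0 α,
          ∫⁻ z, ENNReal.ofReal (sechHalf z (embed n (0, t)) ^ (2 * N)) ∂invVol n) := by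
        rw [lintegral_const_mul' _ _ (by finiteness), lintegral_const_mul' _ _ (by finiteness),
          lintegral_lintegral_swap (measurable_sechHalf_axis_uncurry.pow_const
            (2 * N)).ennreal_ofReal.aemeasurable]
    _ = ENNReal.ofReal (2 * Real.pi / N) ^ 2 * (ENNReal.ofReal α * ∫⁻ _ in Set.Ioo 0 α,
          ∫⁻ z, ENNReal.ofReal (defect z ^ (2 * N)) ∂invVol n) := by
        rw [setLIntegral_congr_fun measurableSet_Ioo fun t ht =>
          lintegral_sechHalf_pow (embed_axis_mem_ball hn hα₁ ht) (2 * N)]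
    _ = _ := by
        rw [setLIntegral_const, Real.volume_Ioo, sub_zero, ← ENNReal.ofReal_pow (by positivity),
          mul_comm (lintegral _ _), ← mul_assoc, ← mul_assoc, ← ENNReal.ofReal_mul (by positivity),
          ← ENNReal.ofReal_mul (by positivity)]
        congr 2
        ring

/-! ### The norm estimate -/

theorem IsWandering.isConvergenceType_of_interior_nonempty {Γ : Subgroup (SU n)} {F : Set (Cn n)}
    (hF : IsWandering Γ F) (hF_ball : F ⊆ ball n) (hF_interior : (interior F).Nonempty) :
    IsConvergenceType Γ :=
  (hF.mono interior_subset).isConvergenceType isOpen_interior (interior_subset.trans hF_ball)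
    hF_interior

theorem IsWandering.exists_poincareSum_le {Γ : Subgroup (SU n)} {F : Set (Cn n)}
    (hF : IsWandering Γ F) (hF_ball : F ⊆ ball n) (hF_interior : (interior F).Nonempty) :
    ∃ S : ℝ, ∀ z ∈ ball n, poincareSum Γ z ≤ S := by
  obtain ⟨S, hS⟩ := (hF.mono interior_subset).exists_sum_defect_act_pow_le isOpen_interior
    (interior_subset.trans hF_ball) hF_interior
  exact ⟨S, fun z hz => Real.tsum_le_of_sum_le (fun g => pow_nonneg (defect_nonneg _) _) (hS z hz)⟩

theorem aestronglyMeasurable_innerDensity {m : ℕ} (k : ℕ) {f g : Cn n → Fin m → ℂ}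
    (hf : ContinuousOn f (ball n)) (hg : ContinuousOn g (ball n)) :
    AEStronglyMeasurable (innerDensity k f g) (volume.restrict (ball n)) := by
  have measurable_kernel : Measurable fun z : Cn n => kernel z z := by
    simp only [kernel_eq]
    exact ((continuous_herm.comp (continuous_id.prodMk continuous_id)).neg.pow
      _).measurable.inv.const_mul _
  have continuousOn_sum : ContinuousOn (fun z => ∑ i, f z i * conj (g z i)) (ball n) :=
    continuousOn_finsetSum _ fun i _ => ((continuous_apply i).comp_continuousOn hf).mul
      (Complex.continuous_conj.comp_continuousOn ((continuous_apply i).comp_continuousOn hg))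
  exact ((continuousOn_sum.aestronglyMeasurable measurableSet_ball).mul
    (measurable_kernel.pow_const k).inv.aestronglyMeasurable).mul
    measurable_kernel.aestronglyMeasurable

theorem lintegral_enorm_innerDensity_thetaSub {m : ℕ} {Γ : Subgroup (SU n)}
    {ρ : Γ →* unitaryGroup (Fin m) ℂ} {j : Fin m} {r : ℝ} {ν : Measure (Cn n)} {F : Set (Cn n)}
    (hF_meas : MeasurableSet F) (hF_ball : F ⊆ ball n) (hr : r < 1) (hν : ∀ᵐ p ∂ν, nrm p ≤ r)
    (l : ℕ) :
    ∫⁻ z in F, ‖innerDensity (l + 1) (thetaSub Γ ρ j (l + 1) ν) (thetaSub Γ ρ j (l + 1) ν) z‖ₑ =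
      ENNReal.ofReal ((kappa n * weightedVol n l ^ 2)⁻¹) *
        ∫⁻ z in F, ENNReal.ofReal (nsq (∫ p, thetaSeries ρ j ((n + 1) * (l + 1)) z p ∂ν) *
          defect z ^ (2 * ((n + 1) * (l + 1)))) ∂invVol n := by
  have kappa_pos := kappa_pos n
  have weightedVol_pos := weightedVol_pos n l
  rw [setLIntegral_invVol hF_meas hF_ball, ← lintegral_const_mul' _ _ ENNReal.ofReal_ne_top]
  refine setLIntegral_congr_fun hF_meas fun z hz => ?_
  have defect_pos := defect_pos (hF_ball hz)
  have nsq_nonneg := nsq_nonneg (∫ p, thetaSeries ρ j ((n + 1) * (l + 1)) z p ∂ν)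
  rw [innerDensity_thetaSub hr hν l (hF_ball hz), ← ofReal_norm, Complex.norm_real,
    Real.norm_of_nonneg (by positivity), ENNReal.ofReal_mul (by positivity),
    ENNReal.ofReal_mul (by positivity)]

theorem IsWandering.exists_lintegral_enorm_innerDensity_thetaSub_le {m : ℕ} {Γ : Subgroup (SU n)}
    {ρ : Γ →* unitaryGroup (Fin m) ℂ} {j : Fin m} {r q : ℝ} {ν : Measure (Cn n)}
    [IsFiniteMeasure ν] {F : Set (Cn n)} (hF : IsWandering Γ F) (hF_meas : MeasurableSet F)
    (hF_ball : F ⊆ ball n) (hF_interior : (interior F).Nonempty) (hr : r < 1) (hq₀ : 0 ≤ q)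
    (hq₁ : q < 1) (hν : ∀ᵐ p ∂ν, nrm p ≤ r)
    (hq : ∀ᵐ p ∂ν, ∀ w ∈ ball n, w ∉ F → sechHalf w p ≤ q) :
    ∃ B θ : ℝ, 0 ≤ B ∧ 0 ≤ θ ∧ θ < 1 ∧ ∀ i : ℕ,
      ∫⁻ z in F, ‖innerDensity (i + 2) (thetaSub Γ ρ j (i + 2) ν)
        (thetaSub Γ ρ j (i + 2) ν) z‖ₑ ≤
      ENNReal.ofReal ((kappa n * weightedVol n (i + 1) ^ 2)⁻¹) * (2 * (ENNReal.ofReal (B * θ ^ i) +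
        ∫⁻ z, ENNReal.ofReal ((‖∫ p, peak ((n + 1) * (i + 2)) p 1 z ∂ν‖ *
          defect z ^ ((n + 1) * (i + 2))) ^ 2) ∂invVol n)) := by
  obtain ⟨S, hS⟩ := hF.exists_poincareSum_le hF_ball hF_interior
  obtain ⟨B, hB, lintegral_le⟩ :=
    hF.exists_setLIntegral_nsq_integral_thetaSeries_le (ρ := ρ) (j := j) hF_meas hF_ball
      (hF.isConvergenceType_of_interior_nonempty hF_ball hF_interior)
      (fun z hz => hS z (hF_ball hz)) hr hq₀ hν hq
  refine ⟨B, q ^ (2 * (n + 1)), hB, by positivity, pow_lt_one₀ hq₀ hq₁ (by omega), fun i => ?_⟩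
  rw [lintegral_enorm_innerDensity_thetaSub hF_meas hF_ball hr hν (i + 1)]
  gcongr
  refine (lintegral_le ((n + 1) * i) ((n + 1) * (i + 2)) (by ring)).trans_eq ?_
  rw [← pow_mul, ← pow_mul, show (n + 1) * i * 2 = 2 * (n + 1) * i by ring]

/-- The constant `c` in the lower bound `weightedVol n l ≥ c (l + 1)⁻ⁿ`. -/
def volConst (n : ℕ) : ℝ := (Real.pi / (2 * (n + 1) ^ 2)) ^ n / 2

theorem volConst_pos (n : ℕ) : 0 < volConst n := by
  have := Real.pi_pos
  unfold volConst
  positivity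

theorem inv_weightedVol_le (n l : ℕ) : (weightedVol n l)⁻¹ ≤ (l + 1) ^ n / volConst n := by
  have volConst_pos := volConst_pos n
  have lower_bound : volConst n / (l + 1) ^ n ≤ weightedVol n l := by
    convert le_weightedVol n l using 1
    rw [volConst, div_right_comm, ← div_pow, div_div]
  rw [← inv_div]
  exact inv_anti₀ (by positivity) lower_bound

/-- The constant `C` of the norm estimate `(Θ, Θ) ≤ C kⁿ⁻²`. -/
def normConst (n : ℕ) (α : ℝ) : ℝ := 8 * Real.pi ^ 2 * α ^ 2 / (kappa n * volConst n) + 1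

theorem normConst_pos (n : ℕ) (α : ℝ) : 0 < normConst n α := by
  have := kappa_pos n
  have := volConst_pos n
  unfold normConst
  positivity

theorem tendsto_pow_div_weightedVol_sq {θ : ℝ} (hθ₀ : 0 ≤ θ) (hθ₁ : θ < 1) :
    Tendsto (fun i : ℕ => θ ^ i / weightedVol n (i + 1) ^ 2) atTop (𝓝 0) := by
  have tendsto_zero := (tendsto_pow_const_mul_const_pow_of_abs_lt_one (2 * n)
    ((abs_of_nonneg hθ₀).trans_lt hθ₁)).const_mul ((3 ^ n / volConst n) ^ 2)
  rw [mul_zero] at tendsto_zero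
  refine squeeze_zero' (.of_forall fun i => by positivity) ?_ tendsto_zero
  filter_upwards [eventually_ge_atTop 1] with i hi
  have volConst_pos := volConst_pos n
  have shift_le : ((i + 1 : ℕ) : ℝ) + 1 ≤ 3 * i := by exact_mod_cast (by omega : i + 1 + 1 ≤ 3 * i)
  have inv_vol_le : (weightedVol n (i + 1))⁻¹ ≤ (3 * i) ^ n / volConst n :=
    (inv_weightedVol_le n (i + 1)).trans (by gcongr)
  have inv_vol_nonneg := inv_nonneg.2 (weightedVol_pos n (i + 1)).le
  calc θ ^ i / weightedVol n (i + 1) ^ 2 = θ ^ i * (weightedVol n (i + 1))⁻¹ ^ 2 := by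
        rw [inv_pow, div_eq_mul_inv]
    _ ≤ θ ^ i * ((3 * i) ^ n / volConst n) ^ 2 := by gcongr
    _ = _ := by ring

theorem main_term_le (n i : ℕ) (α : ℝ) :
    (kappa n * weightedVol n (i + 1) ^ 2)⁻¹ *
        (2 * ((2 * Real.pi * α / ((n + 1) * (i + 2) : ℕ)) ^ 2 * weightedVol n (i + 1))) ≤
      8 * Real.pi ^ 2 * α ^ 2 / (kappa n * volConst n) * ((i + 2 : ℕ) : ℝ) ^ ((n : ℝ) - 2) := by
  have kappa_pos := kappa_pos n
  have volConst_pos := volConst_pos n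
  have weightedVol_pos := weightedVol_pos n (i + 1)
  have inv_vol_le := inv_weightedVol_le n (i + 1)
  have weight_le : ((i + 2 : ℕ) : ℝ) ≤ ((n + 1) * (i + 2) : ℕ) := by
    exact_mod_cast Nat.le_mul_of_pos_left _ n.succ_pos
  set k : ℝ := ((i + 2 : ℕ) : ℝ) with hk
  have k_pos : 0 < k := by positivity
  rw [show ((i + 1 : ℕ) : ℝ) + 1 = k by rw [hk]; push_cast; ring] at inv_vol_le
  calc _ = 8 * Real.pi ^ 2 * α ^ 2 * (kappa n)⁻¹ * (1 / (((n + 1) * (i + 2) : ℕ) : ℝ) ^ 2) *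
        (weightedVol n (i + 1))⁻¹ := by field_simp; ring
    _ ≤ 8 * Real.pi ^ 2 * α ^ 2 * (kappa n)⁻¹ * (1 / k ^ 2) * (k ^ n / volConst n) := by gcongr
    _ = _ := by
        rw [Real.rpow_sub k_pos, Real.rpow_natCast, Real.rpow_two]
        field_simp

theorem eventually_le_normConst_mul_rpow (hn : 2 ≤ n) (α B : ℝ) {θ : ℝ} (hθ₀ : 0 ≤ θ)
    (hθ₁ : θ < 1) :
    ∀ᶠ i : ℕ in atTop, (kappa n * weightedVol n (i + 1) ^ 2)⁻¹ * (2 * (B * θ ^ i +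
        (2 * Real.pi * α / ((n + 1) * (i + 2) : ℕ)) ^ 2 * weightedVol n (i + 1))) ≤
      normConst n α * ((i + 2 : ℕ) : ℝ) ^ ((n : ℝ) - 2) := by
  have error_tendsto :=
    (tendsto_pow_div_weightedVol_sq (n := n) hθ₀ hθ₁).const_mul (2 * B / kappa n)
  rw [mul_zero] at error_tendsto
  filter_upwards [error_tendsto.eventually_le_const one_pos] with i error_le
  have one_le_rpow : 1 ≤ ((i + 2 : ℕ) : ℝ) ^ ((n : ℝ) - 2) :=
    Real.one_le_rpow (by exact_mod_cast (by omega : 1 ≤ i + 2))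
      (sub_nonneg.2 (by exact_mod_cast hn))
  calc _ = 2 * B / kappa n * (θ ^ i / weightedVol n (i + 1) ^ 2) +
        (kappa n * weightedVol n (i + 1) ^ 2)⁻¹ *
          (2 * ((2 * Real.pi * α / ((n + 1) * (i + 2) : ℕ)) ^ 2 * weightedVol n (i + 1))) := by
        ring
    _ ≤ ((i + 2 : ℕ) : ℝ) ^ ((n : ℝ) - 2) + 8 * Real.pi ^ 2 * α ^ 2 / (kappa n * volConst n) *
          ((i + 2 : ℕ) : ℝ) ^ ((n : ℝ) - 2) :=
        add_le_add (error_le.trans one_le_rpow) (main_term_le n i α)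
    _ = _ := by
        rw [normConst]
        ring

theorem ae_halfBallMeasure_nrm_le (hn : 2 ≤ n) {α : ℝ} (hα : 0 < α) :
    ∀ᵐ p ∂halfBallMeasure n α, nrm p ≤ α :=
  ae_halfBallMeasure_of_forall hn fun _ => nrm_embed_le hn hα

section HalfBallNorm

variable (hn : 2 ≤ n) {α : ℝ} (hα : 0 < α) (hα₁ : α < 1)
include hn hα hα₁

theorem closure_halfBall_subset_ball : closure (halfBall n hn α) ⊆ ball n := fun _ hz =>
  mem_ball_iff_nrm.2 ((nrm_le_of_mem_closure_halfBall hn hα hα₁ hz).trans_lt hα₁)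

theorem exists_ae_halfBallMeasure_sechHalf_le {F : Set (Cn n)}
    (hX : closure (halfBall n hn α) ⊆ interior F) :
    ∃ q : ℝ, 0 ≤ q ∧ q < 1 ∧
      ∀ᵐ p ∂halfBallMeasure n α, ∀ w ∈ ball n, w ∉ F → sechHalf w p ≤ q := by
  have isCompact_closure : IsCompact (closure (halfBall n hn α)) :=
    (isCompact_nrm_le α).of_isClosed_subset isClosed_closure fun _ hz =>
      nrm_le_of_mem_closure_halfBall hn hα hα₁ hz
  obtain ⟨q, hq₀, hq₁, hq⟩ := exists_sechHalf_le_of_notMem isCompact_closure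
    (closure_halfBall_subset_ball hn hα hα₁) hX
  exact ⟨q, hq₀, hq₁, ae_halfBallMeasure_of_forall hn fun w hw =>
    hq _ (subset_closure ((mem_halfBall_iff hn hα hα₁).2 ⟨w, hw, rfl⟩))⟩

variable {m : ℕ} {Γ : Subgroup (SU n)} (ρ : Γ →* unitaryGroup (Fin m) ℂ) (j : Fin m)
  {F : Set (Cn n)} (hF : IsWandering Γ F) (hF_meas : MeasurableSet F) (hF_ball : F ⊆ ball n)
  (hX : closure (halfBall n hn α) ⊆ interior F)
include hF hF_meas hF_ball hX

theorem eventually_lintegral_enorm_innerDensity_halfBall_le :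
    ∀ᶠ i : ℕ in atTop,
      ∫⁻ z in F, ‖innerDensity (i + 2) (thetaSub Γ ρ j (i + 2) (halfBallMeasure n α))
        (thetaSub Γ ρ j (i + 2) (halfBallMeasure n α)) z‖ₑ ≤
      ENNReal.ofReal (normConst n α * ((i + 2 : ℕ) : ℝ) ^ ((n : ℝ) - 2)) := by
  have := isFiniteMeasure_halfBallMeasure (n := n) hα
  obtain ⟨q, hq₀, hq₁, hq⟩ := exists_ae_halfBallMeasure_sechHalf_le hn hα hα₁ hX
  obtain ⟨B, θ, hB, hθ₀, hθ₁, lintegral_le⟩ :=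
    hF.exists_lintegral_enorm_innerDensity_thetaSub_le (ρ := ρ) (j := j) hF_meas hF_ball
      (((halfBall_nonempty hn hα hα₁).mono subset_closure).mono hX) hα₁ hq₀ hq₁
      (ae_halfBallMeasure_nrm_le hn hα) hq
  filter_upwards [eventually_le_normConst_mul_rpow hn α B hθ₀ hθ₁] with i le_normConst
  have kappa_pos := kappa_pos n
  have weightedVol_pos := weightedVol_pos n (i + 1)
  have peak_term_le := lintegral_sq_norm_integral_peak_le hn hα hα₁
    (by positivity : 0 < (n + 1) * (i + 2))
  rw [← ofReal_weightedVol, ← ENNReal.ofReal_mul (by positivity)] at peak_term_le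
  refine le_trans ?_ (ENNReal.ofReal_le_ofReal le_normConst)
  rw [ENNReal.ofReal_mul (p := (_ : ℝ)⁻¹) (by positivity), ENNReal.ofReal_mul two_pos.le,
    ENNReal.ofReal_ofNat, ENNReal.ofReal_add (by positivity) (by positivity)]
  exact (lintegral_le i).trans (by gcongr)

theorem eventually_integrableOn_innerDensity_halfBall :
    ∀ᶠ k : ℕ in atTop,
      IntegrableOn (innerDensity k (thetaSub Γ ρ j k (halfBallMeasure n α))
        (thetaSub Γ ρ j k (halfBallMeasure n α))) F ∧
      ‖∫ z in F, innerDensity k (thetaSub Γ ρ j k (halfBallMeasure n α))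
        (thetaSub Γ ρ j k (halfBallMeasure n α)) z‖ ≤
        normConst n α * (k : ℝ) ^ ((n : ℝ) - 2) := by
  have := isFiniteMeasure_halfBallMeasure (n := n) hα
  have hΓ := hF.isConvergenceType_of_interior_nonempty hF_ball
    (((halfBall_nonempty hn hα hα₁).mono subset_closure).mono hX)
  rw [← map_add_atTop_eq_nat 2, eventually_map]
  filter_upwards [eventually_lintegral_enorm_innerDensity_halfBall_le hn hα hα₁ ρ j hF hF_meas
    hF_ball hX] with i lintegral_le
  have continuousOn_thetaSub := (isAutomorphicForm_thetaSub (ρ := ρ) (j := j) hΓ hα₁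
    (ae_halfBallMeasure_nrm_le hn hα) (Nat.le_add_left 1 i)).1.continuousOn
  refine ⟨⟨(aestronglyMeasurable_innerDensity _ continuousOn_thetaSub
    continuousOn_thetaSub).mono_set hF_ball, lintegral_le.trans_lt ENNReal.ofReal_lt_top⟩, ?_⟩
  have normConst_pos := normConst_pos n α
  rw [← ENNReal.ofReal_le_ofReal_iff (by positivity), ofReal_norm]
  exact (enorm_integral_le_lintegral_enorm _).trans lintegral_le

end HalfBallNorm

theorem not_isEquivalent_of_le_rpow {f : ℕ → ℝ} {C a b c : ℝ} (hab : a < b) (hc : c ≠ 0)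
    (hf : ∀ᶠ k : ℕ in atTop, |f k| ≤ C * (k : ℝ) ^ a) :
    ¬ Asymptotics.IsEquivalent atTop f fun k : ℕ => c * (k : ℝ) ^ b := by
  intro f_equiv
  have rpow_pos : ∀ᶠ k : ℕ in atTop, 0 < (k : ℝ) ^ b := by
    filter_upwards [eventually_gt_atTop 0] with k hk
    positivity
  have f_isBigO : f =O[atTop] fun k : ℕ => (k : ℝ) ^ a := by
    refine Asymptotics.IsBigO.of_bound C (hf.mono fun k hk => ?_)
    rwa [Real.norm_eq_abs, Real.norm_of_nonneg (by positivity)]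
  have rpow_isLittleO : (fun k : ℕ => (k : ℝ) ^ a) =o[atTop] fun k : ℕ => (k : ℝ) ^ b := by
    refine Asymptotics.isLittleO_of_tendsto'
      (rpow_pos.mono fun k hk h => absurd h hk.ne') ?_
    refine ((tendsto_rpow_neg_atTop (sub_pos.2 hab)).comp
      (tendsto_natCast_atTop_atTop (R := ℝ))).congr' ?_
    filter_upwards [eventually_gt_atTop 0] with k hk
    rw [Function.comp_apply, neg_sub, Real.rpow_sub (by exact_mod_cast hk)]
  have self_isLittleO : (fun k : ℕ => c * (k : ℝ) ^ b) =o[atTop] fun k : ℕ => c * (k : ℝ) ^ b :=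
    (f_equiv.symm.isBigO.trans f_isBigO).trans_isLittleO
      (rpow_isLittleO.trans_isBigO (Asymptotics.isBigO_self_const_mul hc _ _))
  exact Asymptotics.isLittleO_irrefl
    (rpow_pos.mono fun k hk => mul_ne_zero hc hk.ne').frequently self_isLittleO

/-! ### Open subsets of real subspaces -/

section InterSubmodule

variable {U : Set (Cn n)} (hU : IsOpen U) (W : Submodule ℝ (Cn n))
include hU

theorem isSubmanifold_inter_submodule : IsSubmanifold (Module.finrank ℝ W) (U ∩ W) :=
  fun _ hp => ⟨OpenPartialHomeomorph.ofSet U hU, hp.1, contDiffOn_id, contDiffOn_id, W, rfl,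
    by simp⟩

theorem tangentSp_inter_submodule {p : Cn n} (hp : p ∈ U ∩ W) : tangentSp (U ∩ W) p = W := by
  rw [tangentSp, Set.inter_comm, tangentConeAt_inter_nhds (hU.mem_nhds hp.1)]
  refine le_antisymm (Submodule.span_le.2 fun v hv => ?_) fun v hv => Submodule.subset_span ?_
  · obtain ⟨ι, l, _, c, d, -, add_mem, tendsto_smul⟩ := exists_fun_of_mem_tangentConeAt hv
    refine W.closed_of_finiteDimensional.mem_of_tendsto tendsto_smul (add_mem.mono fun i hi => ?_)
    exact W.smul_mem _ ((W.add_mem_iff_right hp.2).1 hi)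
  · exact mem_tangentConeAt_of_add_smul_mem (l := 𝓝[≠] (0 : ℝ)) (c := id) tendsto_id
      (.of_forall fun c => W.add_mem hp.2 (W.smul_mem c hv))

end InterSubmodule

/-! ### The half ball as a CR submanifold -/

/-- The open subset of the ball in which the half ball is cut out by the subspace `ℂ × ℝ` of
`ℂⁿ`. -/
def halfBallOpen (n : ℕ) (hn : 2 ≤ n) (α : ℝ) : Set (Cn n) :=
  ball n ∩ {z | (z ⟨0, by omega⟩).re ^ 2 + (z ⟨0, by omega⟩).im ^ 2 + (z ⟨1, by omega⟩).re ^ 2 <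
    α ^ 2} ∩ {z | 0 < (z ⟨1, by omega⟩).re}

theorem isOpen_halfBallOpen (n : ℕ) (hn : 2 ≤ n) (α : ℝ) : IsOpen (halfBallOpen n hn α) := by
  refine (isOpen_ball.inter (isOpen_lt ?_ continuous_const)).inter
    (isOpen_lt continuous_const ?_) <;> fun_prop

theorem finrank_range_embedL (hn : 2 ≤ n) :
    Module.finrank ℝ (LinearMap.range (embedL n)) = 3 := by
  rw [LinearMap.finrank_range_of_inj (embed_injective hn)]
  simp [Complex.finrank_real_complex]

section HalfBallTangent

variable (hn : 2 ≤ n) {α : ℝ} (hα : 0 < α) (hα₁ : α < 1)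
include hα hα₁

theorem halfBall_eq_inter :
    halfBall n hn α = halfBallOpen n hn α ∩ LinearMap.range (embedL n) := by
  ext z
  constructor
  · intro hz
    obtain ⟨w, -, hw⟩ := (mem_halfBall_iff hn hα hα₁).1 hz
    exact ⟨⟨⟨hz.1, hz.2.1⟩, hz.2.2.1⟩, w, hw⟩
  · rintro ⟨⟨⟨-, norm_lt⟩, re_pos⟩, w, rfl⟩
    exact (mem_halfBall_iff hn hα hα₁).2
      ⟨w, ⟨by simpa [embedL, embed] using norm_lt, by simpa [embedL, embed] using re_pos⟩, rfl⟩

theorem isSubmanifold_halfBall : IsSubmanifold 3 (halfBall n hn α) := by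
  rw [halfBall_eq_inter hn hα hα₁, ← finrank_range_embedL hn]
  exact isSubmanifold_inter_submodule (isOpen_halfBallOpen n hn α) _

theorem tangentSp_halfBall {p : Cn n} (hp : p ∈ halfBall n hn α) :
    tangentSp (halfBall n hn α) p = LinearMap.range (embedL n) := by
  rw [halfBall_eq_inter hn hα hα₁] at hp ⊢
  exact tangentSp_inter_submodule (isOpen_halfBallOpen n hn α) _ hp

theorem not_isTotallyReal_halfBall : ¬ IsTotallyReal (halfBall n hn α) := by
  intro totally_real
  obtain ⟨p, hp⟩ := halfBall_nonempty hn hα hα₁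
  have eq_zero := totally_real p hp (embedL n (1, 0))
  rw [tangentSp_halfBall hn hα hα₁ hp] at eq_zero
  have I_smul_eq : embedL n (Complex.I, 0) = Complex.I • embedL n (1, 0) := by
    ext i
    simp [embedL, embed]
  simpa [embedL, embed] using
    congrFun (eq_zero ⟨_, rfl⟩ ⟨_, I_smul_eq⟩) ⟨0, by omega⟩

theorem not_isComplexSub_halfBall : ¬ IsComplexSub (halfBall n hn α) := by
  intro complex
  obtain ⟨p, hp⟩ := halfBall_nonempty hn hα hα₁
  have I_smul_mem := complex p hp (embedL n (0, 1))
  rw [tangentSp_halfBall hn hα hα₁ hp] at I_smul_mem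
  obtain ⟨w, hw⟩ := I_smul_mem ⟨_, rfl⟩
  simpa [embedL, embed] using congrArg Complex.im (congrFun hw ⟨1, by omega⟩)

end HalfBallTangent

/-- The Hermitian form on tangent vectors at `p` whose real part is `hypMetric p`. -/
def hypHerm (p v w : Cn n) : ℂ :=
  ((1 - ∑ i, p i * conj (p i)) * (∑ i, v i * conj (w i)) +
    (∑ i, v i * conj (p i)) * (∑ i, p i * conj (w i))) / (1 - ∑ i, p i * conj (p i)) ^ 2

theorem hypMetric_eq (p v w : Cn n) : hypMetric p v w = (hypHerm p v w).re := rfl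

theorem hypHerm_smul_left (p v w : Cn n) (a : ℂ) :
    hypHerm p (a • v) w = a * hypHerm p v w := by
  simp only [hypHerm, Pi.smul_apply, smul_eq_mul, mul_assoc, ← Finset.mul_sum]
  ring

theorem hypHerm_add_left (p v v' w : Cn n) :
    hypHerm p (v + v') w = hypHerm p v w + hypHerm p v' w := by
  simp only [hypHerm, Pi.add_apply, add_mul, Finset.sum_add_distrib]
  ring

theorem conj_hypHerm (p v w : Cn n) : conj (hypHerm p v w) = hypHerm p w v := by
  simp only [hypHerm, map_div₀, map_add, map_sub, map_mul, map_pow, map_sum, map_one,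
    Complex.conj_conj, mul_comm]

theorem hypHerm_smul_right (p v w : Cn n) (a : ℂ) :
    hypHerm p v (a • w) = conj a * hypHerm p v w := by
  rw [← conj_hypHerm, hypHerm_smul_left, map_mul, conj_hypHerm]

theorem hypHerm_add_right (p v w w' : Cn n) :
    hypHerm p v (w + w') = hypHerm p v w + hypHerm p v w' := by
  rw [← conj_hypHerm, hypHerm_add_left, map_add, conj_hypHerm, conj_hypHerm]

theorem hypHerm_self (p v : Cn n) :
    hypHerm p v v = (((1 - nsq p) * nsq v + ‖∑ i, v i * conj (p i)‖ ^ 2) /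
      (1 - nsq p) ^ 2 : ℝ) := by
  have conj_sum : ∑ i, p i * conj (v i) = conj (∑ i, v i * conj (p i)) := by
    simp only [map_sum, map_mul, Complex.conj_conj, mul_comm]
  rw [hypHerm, conj_sum, Complex.mul_conj, Complex.normSq_eq_norm_sq, sum_mul_conj_self,
    sum_mul_conj_self]
  push_cast
  ring

theorem hypHerm_self_ne_zero {p v : Cn n} (hp : p ∈ ball n) (hv : 0 < nsq v) :
    hypHerm p v v ≠ 0 := by
  have one_sub_pos : 0 < 1 - nsq p := sub_pos.2 (mem_ball_iff.1 hp)
  rw [hypHerm_self]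
  exact_mod_cast (by positivity : _ ≠ (0 : ℝ))

theorem im_hypHerm_eq_zero_of_orthogonal {p e f : Cn n} (he : hypHerm p e e ≠ 0) {a : ℂ} {t : ℝ}
    (orthogonal : hypHerm p (a • e + (t : ℂ) • f) e = 0) :
    (hypHerm p (a • e + (t : ℂ) • f) f).im = 0 := by
  have orthogonal_conj := congrArg conj orthogonal
  simp only [hypHerm_add_left, hypHerm_smul_left, map_add, map_mul, conj_hypHerm, map_zero,
    Complex.conj_ofReal] at orthogonal orthogonal_conj ⊢
  refine Complex.conj_eq_iff_im.1 (mul_left_cancel₀ he ?_)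
  simp only [map_add, map_mul, conj_hypHerm, Complex.conj_ofReal]
  linear_combination hypHerm p f e * orthogonal_conj - hypHerm p e f * orthogonal

theorem hypMetric_I_smul_eq_zero {p e f : Cn n} (he : hypHerm p e e ≠ 0) {a : ℂ} {t : ℝ}
    (orthogonal : hypHerm p (a • e + (t : ℂ) • f) e = 0) (b : ℂ) (s : ℝ) :
    hypMetric p (Complex.I • (a • e + (t : ℂ) • f)) (b • e + (s : ℂ) • f) = 0 := by
  have im_eq_zero := im_hypHerm_eq_zero_of_orthogonal he orthogonal
  rw [hypMetric_eq, hypHerm_smul_left, hypHerm_add_right, hypHerm_smul_right, orthogonal,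
    hypHerm_smul_right, mul_zero, zero_add, Complex.conj_ofReal, Complex.I_mul_re,
    Complex.im_ofReal_mul, im_eq_zero, mul_zero, neg_zero]

/-- The constant real frame of the complex line `ℂe`. -/
def complexLineFrame (e : Cn n) : Fin 2 → Cn n := ![e, Complex.I • e]

theorem smul_add_smul_I_smul (e : Cn n) (x y : ℝ) :
    x • e + y • Complex.I • e = (x + y * Complex.I : ℂ) • e := by
  rw [add_smul, mul_smul, Complex.coe_smul, Complex.coe_smul]

theorem mem_span_complexLineFrame {e v : Cn n} :
    v ∈ Submodule.span ℝ (Set.range (complexLineFrame e)) ↔ ∃ a : ℂ, v = a • e := by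
  rw [complexLineFrame, Matrix.range_cons, Matrix.range_cons, Matrix.range_empty, Set.union_empty,
    Set.singleton_union, Submodule.mem_span_pair]
  constructor
  · rintro ⟨x, y, rfl⟩
    exact ⟨_, smul_add_smul_I_smul e x y⟩
  · rintro ⟨a, rfl⟩
    exact ⟨a.re, a.im, by rw [smul_add_smul_I_smul, Complex.re_add_im]⟩

theorem linearIndependent_complexLineFrame {e : Cn n} (he : e ≠ 0) :
    LinearIndependent ℝ (complexLineFrame e) := by
  refine LinearIndependent.pair_iff.2 fun x y h => ?_
  rw [smul_add_smul_I_smul] at h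
  simpa [Complex.ext_iff] using (smul_eq_zero.1 h).resolve_right he

theorem hypHerm_eq_zero_of_hypMetric {p v e : Cn n}
    (h : ∀ u ∈ Submodule.span ℝ (Set.range (complexLineFrame e)), hypMetric p v u = 0) :
    hypHerm p v e = 0 := by
  have re_eq := h e (mem_span_complexLineFrame.2 ⟨1, (one_smul ℂ e).symm⟩)
  have im_eq := h (Complex.I • e) (mem_span_complexLineFrame.2 ⟨Complex.I, rfl⟩)
  rw [hypMetric_eq] at re_eq im_eq
  rw [hypHerm_smul_right] at im_eq
  exact Complex.ext re_eq (by simpa using im_eq)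

theorem embedL_eq (a : ℂ) (t : ℝ) :
    embedL n (a, t) = a • embed n (1, 0) + (t : ℂ) • embed n (0, 1) := by
  ext i
  simp only [embedL, LinearMap.coe_mk, AddHom.coe_mk, embed, Pi.add_apply, Pi.smul_apply]
  split_ifs <;> simp

theorem isCRSubmanifold_halfBall (hn : 2 ≤ n) {α : ℝ} (hα : 0 < α) (hα₁ : α < 1) :
    IsCRSubmanifold 3 (halfBall n hn α) := by
  set e : Cn n := embed n (1, 0)
  have nsq_e : nsq e = 1 := by simp [e, nsq_embed hn]
  have e_ne : e ≠ 0 := by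
    intro e_eq
    simp [e_eq, nsq] at nsq_e
  refine ⟨fun z hz => hz.1, isSubmanifold_halfBall hn hα hα₁,
    fun _ => Submodule.span ℝ (Set.range (complexLineFrame e)), ⟨fun p hp v hv => ?_, 2, ?_⟩,
    fun p hp => ⟨fun v hv => ?_, fun v hv orthogonal u hu => ?_⟩⟩
  · obtain ⟨a, rfl⟩ := mem_span_complexLineFrame.1 hv
    rw [tangentSp_halfBall hn hα hα₁ hp]
    exact ⟨(a, 0), by simp [embedL_eq, e]⟩
  · exact fun p _ => ⟨Set.univ, isOpen_univ, Set.mem_univ p, fun i _ => complexLineFrame e i,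
      fun i => contDiffOn_const, fun x _ => ⟨linearIndependent_complexLineFrame e_ne, rfl⟩⟩
  · obtain ⟨a, rfl⟩ := mem_span_complexLineFrame.1 hv
    exact mem_span_complexLineFrame.2 ⟨Complex.I * a, by rw [mul_smul]⟩
  · rw [tangentSp_halfBall hn hα hα₁ hp] at hv hu
    obtain ⟨⟨a, t⟩, rfl⟩ := hv
    obtain ⟨⟨b, s⟩, rfl⟩ := hu
    rw [embedL_eq] at orthogonal ⊢
    rw [embedL_eq]
    exact hypMetric_I_smul_eq_zero (hypHerm_self_ne_zero hp.1 (nsq_e ▸ one_pos))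
      (hypHerm_eq_zero_of_hypMetric orthogonal) b s

end BallForms

end

open BallForms Filter MeasureTheory in
theorem mainTheorem6_general (n : ℕ) (hn : 2 ≤ n) (α : ℝ) (hα₀ : 0 < α) (hα₁ : α < 1) :
    (IsCRSubmanifold 3 (halfBall n hn α) ∧ ¬ IsTotallyReal (halfBall n hn α) ∧
      ¬ IsComplexSub (halfBall n hn α)) ∧
    ∃ C : ℝ, 0 < C ∧ ∀ Γ : Subgroup (SU n),
      ∀ p₀ ∈ ball n, halfBall n hn α ⊆ dirichlet Γ p₀ →
      0 < setDist (halfBall n hn α) (frontier (dirichlet Γ p₀) ∩ ball n) →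
      ∀ (m : ℕ) (ρ : Γ →* Matrix.unitaryGroup (Fin m) ℂ) (j : Fin m),
        (∀ᶠ k : ℕ in atTop,
          (∀ z ∈ ball n, ∀ p ∈ halfBall n hn α, Summable (thetaTerm Γ ρ j k z p)) ∧
          (∀ z ∈ ball n, Integrable (thetaIntegrand Γ ρ j k z) (halfBallMeasure n α)) ∧
          IsAutomorphicForm Γ ρ k (thetaSub Γ ρ j k (halfBallMeasure n α)) ∧
          IntegrableOn (innerDensity k (thetaSub Γ ρ j k (halfBallMeasure n α))
            (thetaSub Γ ρ j k (halfBallMeasure n α))) (dirichlet Γ p₀) ∧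
          ‖innerProd Γ p₀ k (thetaSub Γ ρ j k (halfBallMeasure n α))
            (thetaSub Γ ρ j k (halfBallMeasure n α))‖ ≤ C * (k : ℝ) ^ ((n : ℝ) - 2)) ∧
        ∀ c : ℝ, c ≠ 0 → ¬ Asymptotics.IsEquivalent atTop
          (fun k : ℕ => (innerProd Γ p₀ k (thetaSub Γ ρ j k (halfBallMeasure n α))
            (thetaSub Γ ρ j k (halfBallMeasure n α))).re)
          (fun k : ℕ => c * (k : ℝ) ^ ((n : ℝ) - 3 / 2)) := by
  refine ⟨⟨isCRSubmanifold_halfBall hn hα₀ hα₁, not_isTotallyReal_halfBall hn hα₀ hα₁,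
    not_isComplexSub_halfBall hn hα₀ hα₁⟩, normConst n α, normConst_pos n α, ?_⟩
  intro Γ p₀ hp₀ subset_dirichlet dist_pos m ρ j
  have closure_subset : closure (halfBall n hn α) ⊆ interior (dirichlet Γ p₀) :=
    closure_subset_interior_of_setDist_pos (closure_halfBall_subset_ball hn hα₀ hα₁)
      subset_dirichlet dist_pos
  have wandering := isWandering_dirichlet Γ hp₀
  have convergence : IsConvergenceType Γ :=
    wandering.isConvergenceType_of_interior_nonempty (dirichlet_subset_ball Γ p₀)
      (((halfBall_nonempty hn hα₀ hα₁).mono subset_closure).mono closure_subset)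
  have := convergence.countable
  have isFiniteMeasure := isFiniteMeasure_halfBallMeasure (n := n) hα₀
  have nrm_le := ae_halfBallMeasure_nrm_le hn hα₀
  have norm_bound := eventually_integrableOn_innerDensity_halfBall hn hα₀ hα₁ ρ j wandering
    (measurableSet_dirichlet Γ hp₀) (dirichlet_subset_ball Γ p₀) closure_subset
  refine ⟨?_, fun c hc => not_isEquivalent_of_le_rpow (by linarith) hc
    (norm_bound.mono fun k hk => (Complex.abs_re_le_norm _).trans hk.2)⟩
  filter_upwards [norm_bound, eventually_ge_atTop 2] with k ⟨integrable, norm_le⟩ hk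
  obtain ⟨l, rfl⟩ := Nat.exists_eq_add_of_le' hk
  exact ⟨fun z hz p hp => summable_thetaTerm convergence hk hz hp.1,
    fun z hz => integrable_thetaIntegrand convergence hα₁ nrm_le (Nat.le_add_left 1 l) hz,
    isAutomorphicForm_thetaSub convergence hα₁ nrm_le (Nat.le_add_left 1 l), integrable, norm_le⟩

open BallForms Filter MeasureTheory in
theorem mainTheorem6 (n : ℕ) (hn : 2 ≤ n) (α : ℝ) (hα₀ : 0 < α) (hα₁ : α < 1) :
    (IsCRSubmanifold 3 (halfBall n hn α) ∧ ¬ IsTotallyReal (halfBall n hn α) ∧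
      ¬ IsComplexSub (halfBall n hn α)) ∧
    ∃ C : ℝ, 0 < C ∧ ∀ Γ : Subgroup (SU n),
      DiscreteTopology Γ → ActsFreely Γ → CompactSpace (BallQuotient Γ) →
      ∀ p₀ ∈ ball n, halfBall n hn α ⊆ dirichlet Γ p₀ →
      0 < setDist (halfBall n hn α) (frontier (dirichlet Γ p₀) ∩ ball n) →
      ∀ (m : ℕ) (ρ : Γ →* Matrix.unitaryGroup (Fin m) ℂ) (j : Fin m),
        (∀ᶠ k : ℕ in atTop,
          (∀ z ∈ ball n, ∀ p ∈ halfBall n hn α, Summable (thetaTerm Γ ρ j k z p)) ∧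
          (∀ z ∈ ball n, Integrable (thetaIntegrand Γ ρ j k z) (halfBallMeasure n α)) ∧
          IsAutomorphicForm Γ ρ k (thetaSub Γ ρ j k (halfBallMeasure n α)) ∧
          IntegrableOn (innerDensity k (thetaSub Γ ρ j k (halfBallMeasure n α))
            (thetaSub Γ ρ j k (halfBallMeasure n α))) (dirichlet Γ p₀) ∧
          ‖innerProd Γ p₀ k (thetaSub Γ ρ j k (halfBallMeasure n α))
            (thetaSub Γ ρ j k (halfBallMeasure n α))‖ ≤ C * (k : ℝ) ^ ((n : ℝ) - 2)) ∧
        ∀ c : ℝ, c ≠ 0 → ¬ Asymptotics.IsEquivalent atTop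
          (fun k : ℕ => (innerProd Γ p₀ k (thetaSub Γ ρ j k (halfBallMeasure n α))
            (thetaSub Γ ρ j k (halfBallMeasure n α))).re)
          (fun k : ℕ => c * (k : ℝ) ^ ((n : ℝ) - 3 / 2)) := by
  obtain ⟨cr, C, C_pos, bound⟩ := mainTheorem6_general n hn α hα₀ hα₁
  exact ⟨cr, C, C_pos, fun Γ _ _ _ => bound Γ⟩
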